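/- **Setting.** Let $d\in\mathbb N$, let $\mathcal D$ be a probability distribution, $f(x,\xi)$ a sampling function on $\mathbb R^d$, $F(x)=\mathbb E_{\xi\sim\mathcal D}[f(x,\xi)]$ (the expectations, $\nabla F$ and the stochastic gradients $\nabla f(x,\xi)$ are assumed to exist, with $(x,\xi)\mapsto\nabla f(x,\xi)$ measurable), and let $\sigma,\hat\sigma,\beta\ge 0$ be such that 1. $F^*:=\inf_x F(x)>-\infty$; 2. $\mathbb E_\xi[\nabla f(x,\xi)]=\nabla F(x)$ and $\mathbb E_\xi\|\nabla f(x,\xi)-\nabla F(x)\|^2\le\sigma^2$ for all $x$; 3. $\mathbb E_\xi\|\nabla f(x,\xi)-\nabla f(y,\xi)\|^2\le\beta^2\|x-y\|^2$ for all $x,y$; 5. $\|\nabla f(x,\xi)-\nabla f(x,\xi')\|\le 2\hat\sigma$ for all $x$ and ($\mathcal D$-almost) all $\xi,\xi'$. **Algorithm (META-STORM).** Parameters $a_0,b_0,\eta>0$, $p\in[\frac{3-\sqrt7}{2},\frac12]$, $q=\frac{1-p}{2}$, and an initial point $x_1\in\mathbb R^d$. With i.i.d. samples $\xi_1,\xi_2,\dots\sim\mathcal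 D$, put $d_1=\nabla f(x_1,\xi_1)$, $a_1=1$, and for $t=1,2,\dots$ $$b_t=\Big(b_0^{1/p}+\sum_{i=1}^t\|d_i\|^2\Big)^p/a_t^q,\qquad x_{t+1}=x_t-\frac{\eta}{b_t}d_t,$$ $$a_{t+1}=\Big(1+\sum_{i=1}^t\frac{\|\nabla f(x_i,\xi_i)-\nabla f(x_i,\xi_{i+1})\|^2}{a_0^2}\Big)^{-2/3},$$ $$d_{t+1}=\nabla f(x_{t+1},\xi_{t+1})+(1-a_{t+1})\,(d_t-\nabla f(x_t,\xi_{t+1})).$$ After $T$ iterations the output is $x_{\rm out}=x_\tau$ with $\tau$ uniform on $\{1,\dots,T\}$ and independent of the samples. **Constants.** Let $\hat p=\frac{3(1-p)}{4-p}$, $\Delta=F(x_1)-F^*$, $\beta_{\max}=\max\{\beta,1\}$, $s_T=1+2\sigma^2T/a_0^2$, let $\lambda>0$ be arbitrary, and $$K_0=\Big(\max\Big\{1,\frac{1728\hat\sigma^6}{a_0^6}\Big\}+\frac{4\hat\sigma^2}{a_0^2}\Big)^{-2/3},\qquad c=1+\frac{6\hat\sigma^{4/3}}{a_0^{4/3}},$$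 $$K_1(\ell)=3\Big(\sigma^2+\frac{24(1+\ell^2)\hat\sigma^2}{\ell^2}\Big)+\frac{72\hat\sigma^2\big(\sigma^2+8c(3a_0^2+5\hat\sigma^2)\big)}{a_0^2K_0^{2\ell-1/2}},$$ $$K_2(\ell)=\begin{cases}\frac{9(1+2\ell^2)a_0^2}{\ell^2(4\ell-1)}&\ell\ne\frac14\\[2pt]\frac{3(1+2\ell^2)a_0^2}{\ell^2}&\ell=\frac14\end{cases},\qquad K_3(\ell)=\frac{144\hat\sigma^2c}{K_0^{2\ell-1/2}a_0^2}+\frac{3(1+2\ell^2)}{\ell^2}\Big(\frac{4\hat\sigma^2}{a_0^2}\Big)^{4\ell/3},$$ $K_1=K_1(q)$, $K_2=K_2(q)$, and $K_4=\big(K_3(q)+\frac{3(1+2q^2)}{q^2}\big)\eta^2\beta^2\kappa$ with $\kappa=\frac1{4q-1}$ if $p\neq\frac12$ and $\kappa=1$ if $p=\frac12$; $$K_5=b_0^{\frac1p-1}+\frac2\eta\Delta+\frac{\lambda K_1(1/4)}{\eta\beta_{\max}},\quad K_6=\frac{\lambda K_2(1/4)}{\eta\beta_{\max}},\quad K_7=\frac{(K_8+K_9)^{\frac1p-1}}{1-p},$$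 $$K_8=(1+\lambda K_3(1/4))\eta\beta_{\max},\qquad K_9=\Big(\frac1\lambda+\frac{2\hat\sigma^{2/3}}{a_0^{2/3}\lambda}+54\lambda\Big)\eta\beta_{\max}.$$ **Theorem.** $\hat p\in[\frac37,\sqrt7-2]$, and for every $T$ the following holds. (a) If $\beta>0$, then for every $\lambda>0$ $$\mathbb E\Big[\Big(\sum_{t=1}^T\|\nabla F(x_t)\|^2\Big)^{\hat p}\Big]\le 4A_T+4\Big(K_5+\big(K_6+\tfrac{K_7}{3}\big)\log s_T+K_7\log\frac{K_8+K_9}{b_0}\Big)^{\frac{\hat p}{1-p}}s_T^{\hat p/3},$$ where $$A_T=\begin{cases}\Big(\frac{2K_1}{K_4}\Big)^{\frac{\hat p}{1-2p}}+\Big(\Big(\frac{2K_2}{K_4}\Big)^{\frac{\hat p}{1-2p}}+(2K_4)^{\frac{\hat p}{2p}}\Big)s_T^{\hat p/3}&p\ne\frac12,\\[4pt]\Big(2K_1+2\big(K_2+\tfrac{K_4}{3}\big)\log s_T+\frac{2K_4}{\hat p}\log\frac{4K_4}{b_0^{2\hat p}}\Big)_+^{\hat p}s_T^{\hat p/3}+b_0^{2\hat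 p}&p=\frac12,\end{cases}$$ and $u_+=\max\{u,0\}$. (b) Let $\bar\beta=\max\{\beta,2\}$ and $$R_T=\Delta^{\frac{\hat p}{1-p}}+\bar\beta^{\frac{\hat p}{p}}\log^{\frac{\hat p}{1-p}}\bar\beta+\bar\beta^{\frac{\hat p}{p}}\log^{\frac{\hat p}{1-p}}(1+\sigma^2T).$$ There is a constant $C$ depending only on $p,a_0,b_0,\eta,\sigma,\hat\sigma$ (not on $T,\beta,\Delta,d$ or the problem) such that $$\mathbb E\Big[\Big(\sum_{t=1}^T\|\nabla F(x_t)\|^2\Big)^{\hat p}\Big]\le C\,R_T\,(1+\sigma^2T)^{\hat p/3},$$ and, for $T\ge1$, $$\mathbb E\big[\|\nabla F(x_{\rm out})\|^{2\hat p}\big]\le C\,R_T\Big(\frac1{T^{\hat p}}+\frac{\sigma^{2\hat p/3}}{T^{2\hat p/3}}\Big).$$ The random variables whose expectations are bounded are integrable. -/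

import Mathlib

open MeasureTheory ProbabilityTheory

noncomputable section

namespace MetaStorm

section Problem

variable {d : ℕ} {Ξ : Type*} [MeasurableSpace Ξ]

/-- The objective `F(x) = 𝔼_{ξ ∼ 𝒟} [f(x, ξ)]`. -/
def objective (𝒟 : Measure Ξ) (f : EuclideanSpace ℝ (Fin d) → Ξ → ℝ)
    (x : EuclideanSpace ℝ (Fin d)) : ℝ :=
  ∫ ξ, f x ξ ∂𝒟

/-- `∇F(x)`. -/
def trueGrad (𝒟 : Measure Ξ) (f : EuclideanSpace ℝ (Fin d) → Ξ → ℝ)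
    (x : EuclideanSpace ℝ (Fin d)) : EuclideanSpace ℝ (Fin d) :=
  gradient (objective 𝒟 f) x

/-- The stochastic gradient `∇f(x, ξ)` (gradient in the variable `x`). -/
def stochGrad (f : EuclideanSpace ℝ (Fin d) → Ξ → ℝ)
    (x : EuclideanSpace ℝ (Fin d)) (ξ : Ξ) : EuclideanSpace ℝ (Fin d) :=
  gradient (fun y => f y ξ) x

/-- The initial gap `F(x₁) - F*`, where `F* = inf F`. -/
def initialGap (𝒟 : Measure Ξ) (f : EuclideanSpace ℝ (Fin d) → Ξ → ℝ)
    (x₁ : EuclideanSpace ℝ (Fin d)) : ℝ :=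
  objective 𝒟 f x₁ - ⨅ x, objective 𝒟 f x

/-- The standing assumptions on the stochastic optimization problem. The first six fields say that
`F`, `∇F` and `∇f` are well defined (and that `∇f` is measurable); the others are the
quantitative assumptions. "For all samples in the support" is stated in the weaker form "for almost
all samples". -/
structure Assumptions (𝒟 : Measure Ξ) (f : EuclideanSpace ℝ (Fin d) → Ξ → ℝ)
    (σ σhat β : ℝ) : Prop where
  isProbabilityMeasure : IsProbabilityMeasure 𝒟
  integrable_f : ∀ x, Integrable (f x) 𝒟
  differentiable_f : ∀ x, ∀ᵐ ξ ∂𝒟, DifferentiableAt ℝ (fun y => f y ξ) x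
  differentiable_objective : Differentiable ℝ (objective 𝒟 f)
  measurable_grad : Measurable fun z : EuclideanSpace ℝ (Fin d) × Ξ => stochGrad f z.1 z.2
  integrable_grad : ∀ x, Integrable (stochGrad f x) 𝒟
  /-- The objective is bounded below. -/
  bddBelow : BddBelow (Set.range (objective 𝒟 f))
  /-- The stochastic gradients are unbiased ... -/
  unbiased : ∀ x, ∫ ξ, stochGrad f x ξ ∂𝒟 = trueGrad 𝒟 f x
  /-- ... and have variance at most `σ²`. -/
  integrable_variance : ∀ x, Integrable (fun ξ => ‖stochGrad f x ξ - trueGrad 𝒟 f x‖ ^ 2) 𝒟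
  variance_le : ∀ x, ∫ ξ, ‖stochGrad f x ξ - trueGrad 𝒟 f x‖ ^ 2 ∂𝒟 ≤ σ ^ 2
  /-- Averaged `β`-smoothness. -/
  averaged_smooth : ∀ x y,
    ∫ ξ, ‖stochGrad f x ξ - stochGrad f y ξ‖ ^ 2 ∂𝒟 ≤ β ^ 2 * ‖x - y‖ ^ 2
  /-- Bounded stochastic gradient differences. -/
  bounded_diff : ∀ x, ∀ᵐ ξ ∂𝒟, ∀ᵐ ξ' ∂𝒟, ‖stochGrad f x ξ - stochGrad f x ξ'‖ ≤ 2 * σhat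

/-- `ξ 1, ξ 2, …` are independent samples from `𝒟` (`ξ 0` is never used by the algorithm). -/
structure IsSampling {Ω : Type*} [MeasurableSpace Ω] (μ : Measure Ω) (𝒟 : Measure Ξ)
    (ξ : ℕ → Ω → Ξ) : Prop where
  measurable : ∀ t, Measurable (ξ t)
  law : ∀ t, μ.map (ξ t) = 𝒟
  indep : iIndepFun ξ μ

/-- `τ` is uniformly distributed on `{1, …, T}` and independent of all the samples. -/
structure IsUniformIndex {Ω : Type*} [MeasurableSpace Ω] (μ : Measure Ω)
    (ξ : ℕ → Ω → Ξ) (T : ℕ) (τ : Ω → ℕ) : Prop where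
  measurable : Measurable τ
  law : μ.map τ = uniformOn (Finset.Icc 1 T : Set ℕ)
  indep : IndepFun τ (fun ω t => ξ t ω) μ

end Problem

section Algorithm

/-- The state of META-STORM in iteration `t`. -/
structure State (d : ℕ) where
  /-- the iterate `x_t` -/
  x : EuclideanSpace ℝ (Fin d)
  /-- the direction `d_t` -/
  dir : EuclideanSpace ℝ (Fin d)
  /-- `∑_{i ≤ t} ‖d_i‖²` -/
  sumDir : ℝ
  /-- `∑_{i < t} ‖∇f(x_i, ξ_i) - ∇f(x_i, ξ_{i+1})‖²` -/
  sumDiff : ℝ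

/-- The momentum parameter `a_t = (1 + ∑_{i < t} ‖∇f(x_i, ξ_i) - ∇f(x_i, ξ_{i+1})‖² / a₀²)^{-2/3}`. -/
def State.a {d : ℕ} (a₀ : ℝ) (st : State d) : ℝ :=
  (1 + st.sumDiff / a₀ ^ 2) ^ (-(2 / 3) : ℝ)

/-- `b_t = (b₀^{1/p} + ∑_{i ≤ t} ‖d_i‖²)^p / a_t^q` with `q = (1 - p) / 2`. -/
def State.b {d : ℕ} (p a₀ b₀ : ℝ) (st : State d) : ℝ :=
  (b₀ ^ (1 / p) + st.sumDir) ^ p / (st.a a₀) ^ ((1 - p) / 2)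

variable {d : ℕ} {Ξ : Type*}

/-- One iteration of META-STORM with stochastic gradient oracle `g`; `s` is the sample used so far
(`ξ_t`) and `s'` the new one (`ξ_{t+1}`). -/
def State.next (g : EuclideanSpace ℝ (Fin d) → Ξ → EuclideanSpace ℝ (Fin d))
    (p a₀ b₀ η : ℝ) (s s' : Ξ) (st : State d) : State d :=
  let x' := st.x - (η / st.b p a₀ b₀) • st.dir
  let sumDiff' := st.sumDiff + ‖g st.x s - g st.x s'‖ ^ 2
  let a' := (1 + sumDiff' / a₀ ^ 2) ^ (-(2 / 3) : ℝ)
  let dir' := g x' s' + (1 - a') • (st.dir - g st.x s')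
  { x := x', dir := dir', sumDir := st.sumDir + ‖dir'‖ ^ 2, sumDiff := sumDiff' }

/-- The run of META-STORM from the initial point `x₁` along the samples `s 1, s 2, …`. Iterations
are numbered from `1`; the value at `0` is a dummy. -/
def run (g : EuclideanSpace ℝ (Fin d) → Ξ → EuclideanSpace ℝ (Fin d))
    (p a₀ b₀ η : ℝ) (x₁ : EuclideanSpace ℝ (Fin d)) (s : ℕ → Ξ) : ℕ → State d
  | 0 => ⟨x₁, 0, 0, 0⟩
  | 1 => ⟨x₁, g x₁ (s 1), ‖g x₁ (s 1)‖ ^ 2, 0⟩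
  | t + 2 => (run g p a₀ b₀ η x₁ s (t + 1)).next g p a₀ b₀ η (s (t + 1)) (s (t + 2))

variable (g : EuclideanSpace ℝ (Fin d) → Ξ → EuclideanSpace ℝ (Fin d))
  (p a₀ b₀ η : ℝ) (x₁ : EuclideanSpace ℝ (Fin d)) (s : ℕ → Ξ)

theorem run_a_one : (run g p a₀ b₀ η x₁ s 1).a a₀ = 1 := by
  simp [run, State.a]

/-- `x_{t+1} = x_t - (η / b_t) d_t`. -/
theorem run_x_succ (t : ℕ) : (run g p a₀ b₀ η x₁ s (t + 2)).x =
    (run g p a₀ b₀ η x₁ s (t + 1)).x -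
      (η / (run g p a₀ b₀ η x₁ s (t + 1)).b p a₀ b₀) • (run g p a₀ b₀ η x₁ s (t + 1)).dir :=
  rfl

/-- `d_{t+1} = ∇f(x_{t+1}, ξ_{t+1}) + (1 - a_{t+1}) (d_t - ∇f(x_t, ξ_{t+1}))`. -/
theorem run_dir_succ (t : ℕ) : (run g p a₀ b₀ η x₁ s (t + 2)).dir =
    g (run g p a₀ b₀ η x₁ s (t + 2)).x (s (t + 2)) +
      (1 - (run g p a₀ b₀ η x₁ s (t + 2)).a a₀) •
        ((run g p a₀ b₀ η x₁ s (t + 1)).dir - g (run g p a₀ b₀ η x₁ s (t + 1)).x (s (t + 2))) :=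
  rfl

theorem run_sumDir (t : ℕ) : (run g p a₀ b₀ η x₁ s t).sumDir =
    ∑ i ∈ Finset.Icc 1 t, ‖(run g p a₀ b₀ η x₁ s i).dir‖ ^ 2 := by
  induction t with
  | zero => simp [run]
  | succ t ih =>
    rw [Finset.sum_Icc_succ_top (by omega), ← ih]
    cases t <;> simp [run, State.next]

theorem run_sumDiff (t : ℕ) : (run g p a₀ b₀ η x₁ s (t + 1)).sumDiff =
    ∑ i ∈ Finset.Icc 1 t, ‖g (run g p a₀ b₀ η x₁ s i).x (s i) -
      g (run g p a₀ b₀ η x₁ s i).x (s (i + 1))‖ ^ 2 := by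
  induction t with
  | zero => simp [run]
  | succ t ih =>
    rw [Finset.sum_Icc_succ_top (by omega), ← ih]
    simp [run, State.next]

end Algorithm

section Output

variable {d : ℕ} {Ξ Ω : Type*} [MeasurableSpace Ξ]

/-- The random iterate `x_t` of META-STORM, run on the sampling functions `f` and samples `ξ`. -/
def iterate (f : EuclideanSpace ℝ (Fin d) → Ξ → ℝ) (p a₀ b₀ η : ℝ)
    (x₁ : EuclideanSpace ℝ (Fin d)) (ξ : ℕ → Ω → Ξ) (t : ℕ) (ω : Ω) :
    EuclideanSpace ℝ (Fin d) :=
  (run (stochGrad f) p a₀ b₀ η x₁ (fun i => ξ i ω) t).x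

/-- `H_T = ∑_{t ≤ T} ‖∇F(x_t)‖²`. -/
def gradSum (𝒟 : Measure Ξ) (f : EuclideanSpace ℝ (Fin d) → Ξ → ℝ) (p a₀ b₀ η : ℝ)
    (x₁ : EuclideanSpace ℝ (Fin d)) (ξ : ℕ → Ω → Ξ) (T : ℕ) (ω : Ω) : ℝ :=
  ∑ t ∈ Finset.Icc 1 T, ‖trueGrad 𝒟 f (iterate f p a₀ b₀ η x₁ ξ t ω)‖ ^ 2

/-- The norm of `∇F` at the output `x_out = x_τ`, where `τ` is the random output index. -/
def outGradNorm (𝒟 : Measure Ξ) (f : EuclideanSpace ℝ (Fin d) → Ξ → ℝ) (p a₀ b₀ η : ℝ)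
    (x₁ : EuclideanSpace ℝ (Fin d)) (ξ : ℕ → Ω → Ξ) (τ : Ω → ℕ) (ω : Ω) : ℝ :=
  ‖trueGrad 𝒟 f (iterate f p a₀ b₀ η x₁ ξ (τ ω) ω)‖

end Output

section Constants

/-- The exponent `p̂ = 3 (1 - p) / (4 - p)`. -/
def pHat (p : ℝ) : ℝ := 3 * (1 - p) / (4 - p)

def K₀ (a₀ σhat : ℝ) : ℝ :=
  (max 1 (1728 * σhat ^ 6 / a₀ ^ 6) + 4 * σhat ^ 2 / a₀ ^ 2) ^ (-(2 / 3) : ℝ)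

/-- `1 + 6 σhat^{4/3} / a₀^{4/3}`, an abbreviation used in `K₁` and `K₃`. -/
def diffFactor (a₀ σhat : ℝ) : ℝ :=
  1 + 6 * σhat ^ (4 / 3 : ℝ) / a₀ ^ (4 / 3 : ℝ)

def K₁ (a₀ σ σhat ℓ : ℝ) : ℝ :=
  3 * (σ ^ 2 + 24 * (1 + ℓ ^ 2) * σhat ^ 2 / ℓ ^ 2) +
    72 * σhat ^ 2 * (σ ^ 2 + 8 * diffFactor a₀ σhat * (3 * a₀ ^ 2 + 5 * σhat ^ 2)) /
      (a₀ ^ 2 * K₀ a₀ σhat ^ (2 * ℓ - 1 / 2))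

def K₂ (a₀ ℓ : ℝ) : ℝ :=
  if ℓ = 1 / 4 then 3 * (1 + 2 * ℓ ^ 2) * a₀ ^ 2 / ℓ ^ 2
  else 9 * (1 + 2 * ℓ ^ 2) * a₀ ^ 2 / (ℓ ^ 2 * (4 * ℓ - 1))

def K₃ (a₀ σhat ℓ : ℝ) : ℝ :=
  144 * σhat ^ 2 / (K₀ a₀ σhat ^ (2 * ℓ - 1 / 2) * a₀ ^ 2) * diffFactor a₀ σhat +
    3 * (1 + 2 * ℓ ^ 2) / ℓ ^ 2 * (4 * σhat ^ 2 / a₀ ^ 2) ^ (4 * ℓ / 3)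

def K₄ (a₀ η σhat β q : ℝ) : ℝ :=
  if q = 1 / 4 then (K₃ a₀ σhat q + 3 * (1 + 2 * q ^ 2) / q ^ 2) * (η ^ 2 * β ^ 2)
  else (K₃ a₀ σhat q + 3 * (1 + 2 * q ^ 2) / q ^ 2) * (η ^ 2 * β ^ 2 / (4 * q - 1))

/-- Here `Δ` stands for `F(x₁) - F*`, and `lam` is a free positive parameter. -/
def K₅ (p a₀ b₀ η σ σhat β Δ lam : ℝ) : ℝ :=
  b₀ ^ (1 / p - 1) + 2 / η * Δ + lam * K₁ a₀ σ σhat (1 / 4) / (η * max β 1)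

def K₆ (a₀ η β lam : ℝ) : ℝ :=
  lam * K₂ a₀ (1 / 4) / (η * max β 1)

def K₈ (a₀ η σhat β lam : ℝ) : ℝ :=
  (1 + lam * K₃ a₀ σhat (1 / 4)) * (η * max β 1)

def K₉ (a₀ η σhat β lam : ℝ) : ℝ :=
  (1 / lam + 2 * σhat ^ (2 / 3 : ℝ) / (a₀ ^ (2 / 3 : ℝ) * lam) + 54 * lam) * (η * max β 1)

def K₇ (p a₀ η σhat β lam : ℝ) : ℝ :=
  (K₈ a₀ η σhat β lam + K₉ a₀ η σhat β lam) ^ (1 / p - 1) / (1 - p)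

/-- The first part of the explicit bound, in terms of `k₁ = K₁(q)`, `k₂ = K₂(q)`, `k₄ = K₄` and
`s = 1 + 2 σ² T / a₀²`. For `p = 1/2` the base of the power can be negative (`k₄` may be small), so
its positive part is taken. -/
def boundE (p b₀ k₁ k₂ k₄ s : ℝ) : ℝ :=
  if p = 1 / 2 then
    (max 0 (2 * k₁ + 2 * (k₂ + k₄ / 3) * Real.log s +
        2 * k₄ / pHat p * Real.log (4 * k₄ / b₀ ^ (2 * pHat p)))) ^ pHat p * s ^ (pHat p / 3) +
      b₀ ^ (2 * pHat p)
  else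
    (2 * k₁ / k₄) ^ (pHat p / (1 - 2 * p)) +
      ((2 * k₂ / k₄) ^ (pHat p / (1 - 2 * p)) + (2 * k₄) ^ (pHat p / (2 * p))) * s ^ (pHat p / 3)

/-- The second part of the explicit bound, in terms of `k₅ = K₅`, …, `k₈ + k₉ = K₈ + K₉` and
`s = 1 + 2 σ² T / a₀²`. -/
def boundD (p b₀ k₅ k₆ k₇ k₈ k₉ s : ℝ) : ℝ :=
  (k₅ + (k₆ + k₇ / 3) * Real.log s + k₇ * Real.log ((k₈ + k₉) / b₀)) ^ (pHat p / (1 - p)) *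
    s ^ (pHat p / 3)

/-- The explicit bound on `𝔼[(∑_{t ≤ T} ‖∇F(x_t)‖²)^{p̂}]`. -/
def explicitBound (p a₀ b₀ η σ σhat β Δ lam : ℝ) (T : ℕ) : ℝ :=
  4 * boundE p b₀ (K₁ a₀ σ σhat ((1 - p) / 2)) (K₂ a₀ ((1 - p) / 2))
      (K₄ a₀ η σhat β ((1 - p) / 2)) (1 + 2 * σ ^ 2 * T / a₀ ^ 2) +
    4 * boundD p b₀ (K₅ p a₀ b₀ η σ σhat β Δ lam) (K₆ a₀ η β lam) (K₇ p a₀ η σhat β lam)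
      (K₈ a₀ η σhat β lam) (K₉ a₀ η σhat β lam) (1 + 2 * σ ^ 2 * T / a₀ ^ 2)

/-- The order factor
`Δ^{p̂/(1-p)} + B^{p̂/p} log^{p̂/(1-p)} B + B^{p̂/p} log^{p̂/(1-p)} (1 + σ² T)`. -/
def rateFactor (p σ B Δ : ℝ) (T : ℕ) : ℝ :=
  Δ ^ (pHat p / (1 - p)) +
    B ^ (pHat p / p) * Real.log B ^ (pHat p / (1 - p)) +
    B ^ (pHat p / p) * Real.log (1 + σ ^ 2 * T) ^ (pHat p / (1 - p))

end Constants

end MetaStorm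

end

open MetaStorm

/-! Write e_t = d_t - ∇F(x_t) for the momentum error and S_t = a_t^(-3/2). Then S_t is 1 plus the
accumulated squared gradient differences over a₀², and E S_{T+1} ≤ s_T. Since ‖∇F(x_t)‖² ≤ 2‖e_t‖² +
2‖d_t‖², it suffices to bound the p̂-th moments of E = ∑‖e_t‖² and D = ∑‖d_t‖².

Errors. One has e_{t+1} = (1 - a_{t+1})(e_t + Z) + a_{t+1} ν, where ν is the noise of the fresh
sample at x_{t+1} and Z its change from x_t to x_{t+1}; the second moment of Z is at most β²‖x_{t+1}
- x_t‖². The obstacle is that a_{t+1} depends on the fresh sample, so the cross term with e_t is not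
conditionally centred. It becomes centred once weight and momentum are frozen at time t
(`norm_sq_next_error_le`), and bounded noise controls what the freezing costs
(`weighted_error_step`, `unweighted_error_step`). With weights S^(4ℓ/3) this bounds E ∑
a_{t+1}^(1-2ℓ)‖e_t‖² by the squared step lengths plus constants (`integral_err_le`). The growth of
the weights is absorbed by the momentum when S is large and by the unweighted estimate when it is
not. The terms ‖ν‖² are dominated in expectation by increments of S, whose weighted sums give a
power or a logarithm of S.

Directions. The descent lemma and the error bound with ℓ = 1/4 control E ∑ (2‖d_t‖²/b_t - k
S_t^(1/3)‖d_t‖²/b_t²), where k = K₈ + K₉. Pathwise, `rpow_sum_dir_le` bounds S^(-(1-p)/3) D^(1-p) by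
such a sum plus a logarithm. Weighted AM-GM splits k S^(1/3)/b² into a part proportional to 1/b and
a part whose sum is logarithmic. Hölder against E S_{T+1} ≤ s_T then bounds E D^p̂.

Closing the loop. With ℓ = q the weight in the error bound cancels against b_t², and the steps
contribute K₄ E D^(1-2p), or a logarithm of D if p = 1/2. For p < 1/2, either E E^p̂ ≤ E D^p̂ and
the direction bound suffices, or the reverse inequality makes the error bound self-bounding; Jensen
needs 1 - 2p ≤ p̂ here, which is the lower limit on p. For p = 1/2 the logarithm is estimated by the
direction bound itself, and the error is dominated by it, so that the term A_T is not even needed.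

The rate follows with λ = 1 and max(β, 2) in place of β. The output bound follows by averaging over
the independent index and concavity of the power p̂. -/

namespace MetaStorm

/-! ### One-step inequalities for the momentum error. -/

section Step

variable {E : Type*} [NormedAddCommGroup E] [InnerProductSpace ℝ E]

theorem two_mul_abs_inner_le (u v : E) {c : ℝ} (hc : 0 < c) :
    2 * |inner ℝ u v| ≤ ‖u‖ ^ 2 / c + c * ‖v‖ ^ 2 := by
  have h := abs_real_inner_le_norm u v
  have h2 : 0 ≤ (‖u‖ / Real.sqrt c - Real.sqrt c * ‖v‖) ^ 2 := sq_nonneg _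
  have hs : 0 < Real.sqrt c := Real.sqrt_pos.2 hc
  have hsq : Real.sqrt c ^ 2 = c := Real.sq_sqrt hc.le
  have : (‖u‖ / Real.sqrt c - Real.sqrt c * ‖v‖) ^ 2 =
      ‖u‖ ^ 2 / c + c * ‖v‖ ^ 2 - 2 * (‖u‖ * ‖v‖) := by
    rw [sub_sq, div_pow, mul_pow, hsq]
    field_simp
    ring
  linarith

theorem norm_add_sq_le_two (u v : E) : ‖u + v‖ ^ 2 ≤ 2 * ‖u‖ ^ 2 + 2 * ‖v‖ ^ 2 := by
  have h := parallelogram_law_with_norm ℝ u v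
  nlinarith [sq_nonneg ‖u - v‖]

/-- Expansion of the squared norm of the next momentum error. -/
theorem norm_sq_next_error_le (e Z ν : E) (a a' W W' : ℝ) (hW' : 0 ≤ W') :
    W' * ‖(1 - a') • e + (1 - a') • Z + a' • ν‖ ^ 2 ≤
      W' * (1 - a') ^ 2 * ‖e‖ ^ 2 + W' * (2 * ((1 - a') ^ 2 * ‖Z‖ ^ 2) + 2 * a' ^ 2 * ‖ν‖ ^ 2) +
      2 * (W * (1 - a)) * inner ℝ e ((1 - a) • Z + a • ν) +
      2 * (W' * (1 - a') - W * (1 - a)) * (1 - a) * inner ℝ e Z +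
      2 * (W' * (1 - a') - W * (1 - a)) * inner ℝ e (a • ν) -
      2 * W' * (1 - a') * (a - a') * inner ℝ e (ν - Z) := by
  have h1 : ‖(1 - a') • e + (1 - a') • Z + a' • ν‖ ^ 2 =
      (1 - a') ^ 2 * ‖e‖ ^ 2 + 2 * (1 - a') * ((1 - a') * inner ℝ e Z + a' * inner ℝ e ν) +
        ‖(1 - a') • Z + a' • ν‖ ^ 2 := by
    rw [add_assoc, norm_add_sq_real, norm_smul, mul_pow, Real.norm_eq_abs, sq_abs,
      inner_add_right, inner_smul_left, inner_smul_left, inner_smul_right, inner_smul_right]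
    simp only [conj_trivial]
    ring
  have h2 : ‖(1 - a') • Z + a' • ν‖ ^ 2 ≤ 2 * ((1 - a') ^ 2 * ‖Z‖ ^ 2) + 2 * a' ^ 2 * ‖ν‖ ^ 2 := by
    have := norm_add_sq_le_two ((1 - a') • Z) (a' • ν)
    simp only [norm_smul, mul_pow, Real.norm_eq_abs, sq_abs] at this
    linarith
  -- Uses (1 - a')Z + a'ν = (1 - a)Z + aν - (a - a')(ν - Z) and splits W'(1 - a') into W(1 - a) plus
  -- a remainder. In the application a' and W' depend on the fresh sample while a and W do not, so
  -- the fully frozen product averages to zero.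
  rw [h1, inner_add_right, inner_smul_right, inner_smul_right, inner_sub_right]
  have h3 := mul_le_mul_of_nonneg_left h2 hW'
  linarith

set_option maxHeartbeats 1000000 in
/-- One-step recursion for the weighted momentum error. -/
theorem weighted_error_step (e Z ν : E) {a a' ρ W W' s : ℝ} (ha' : 0 ≤ a') (haa : a' ≤ a)
    (ha : a ≤ 1) (hρ0 : 0 ≤ ρ) (hρ1 : ρ ≤ 1) (haρ : a - a' ≤ a * ρ) (hW : 0 ≤ W) (hWW : W ≤ W')
    (hWρ : W' - W ≤ W' * ρ) (hν : ‖ν‖ ≤ s) (hνZ : ‖ν - Z‖ ≤ s) :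
    W' * ‖(1 - a') • e + (1 - a') • Z + a' • ν‖ ^ 2 + W' * a' * ‖e‖ ^ 2 ≤
      W * ‖e‖ ^ 2 + 2 * (W' * ρ) * ‖e‖ ^ 2 + 5 * (W' * ‖Z‖ ^ 2) + 2 * (W' * a' ^ 2 * ‖ν‖ ^ 2) +
        15 * s ^ 2 * (W' * ρ * a ^ 2) +
        2 * (W * (1 - a)) * inner ℝ e ((1 - a) • Z + a • ν) := by
  have h := norm_sq_next_error_le e Z ν a a' W W' (hW.trans hWW)
  have hW' : 0 ≤ W' := hW.trans hWW
  have ha0 : 0 ≤ a := ha'.trans haa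
  -- C is the price of freezing the coefficient. The three leftover inner products `y1`, `y2`, `y3`
  -- are split by Young's inequality so that each costs W'ρ‖e‖²/3. Together with W' - W ≤ W'ρ this
  -- gives the total 2W'ρ‖e‖².
  set C := W' * (1 - a') - W * (1 - a) with hC
  have hC' : C = (W' - W) * (1 - a') + W * (a - a') := by rw [hC]; ring
  have hC0 : 0 ≤ C := by
    rw [hC']
    exact add_nonneg (mul_nonneg (by linarith) (by linarith)) (mul_nonneg hW (by linarith))
  have hC1 : C ≤ W' * ρ * (1 - a' + a) := by
    have h1 : (W' - W) * (1 - a') ≤ W' * ρ * (1 - a') :=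
      mul_le_mul_of_nonneg_right hWρ (by linarith)
    have h2 : W * (a - a') ≤ W' * (a * ρ) := mul_le_mul hWW haρ (by linarith) hW'
    rw [hC']; linarith
  have hWρ0 : 0 ≤ W' * ρ := mul_nonneg hW' hρ0
  have hC2 : C ≤ 2 * (W' * ρ) := by
    have := mul_le_mul_of_nonneg_left (show 1 - a' + a ≤ 2 by linarith) hWρ0
    linarith
  have hC3 : C * (1 - a) ≤ W' * ρ := by
    have h1 : C * (1 - a) ≤ W' * ρ * (1 - a' + a) * (1 - a) :=
      mul_le_mul_of_nonneg_right hC1 (by linarith)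
    have h2 : (1 - a' + a) * (1 - a) ≤ 1 := by
      have := mul_nonneg ha' (sub_nonneg.2 ha)
      linarith [sq_nonneg a]
    have h3 := mul_le_mul_of_nonneg_left h2 hWρ0
    linarith
  have hs2 : ‖ν‖ ^ 2 ≤ s ^ 2 := pow_le_pow_left₀ (norm_nonneg _) hν 2
  have hs3 : ‖ν - Z‖ ^ 2 ≤ s ^ 2 := pow_le_pow_left₀ (norm_nonneg _) hνZ 2
  have y1 : 2 * C * (1 - a) * inner ℝ e Z ≤ W' * ρ * (‖e‖ ^ 2 / 3 + 3 * ‖Z‖ ^ 2) := by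
    have := two_mul_abs_inner_le e Z (c := 3) (by norm_num)
    have h1 := le_abs_self (inner ℝ e Z)
    calc 2 * C * (1 - a) * inner ℝ e Z = C * (1 - a) * (2 * inner ℝ e Z) := by ring
      _ ≤ C * (1 - a) * (‖e‖ ^ 2 / 3 + 3 * ‖Z‖ ^ 2) :=
          mul_le_mul_of_nonneg_left (by linarith) (mul_nonneg hC0 (by linarith))
      _ ≤ _ := mul_le_mul_of_nonneg_right hC3 (by positivity)
  have y2 : 2 * C * inner ℝ e (a • ν) ≤ W' * ρ * (‖e‖ ^ 2 / 3 + 12 * (a ^ 2 * s ^ 2)) := by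
    have := two_mul_abs_inner_le e (a • ν) (c := 6) (by norm_num)
    rw [norm_smul, mul_pow, Real.norm_eq_abs, sq_abs] at this
    have h1 := le_abs_self (inner ℝ e (a • ν))
    have h4 : a ^ 2 * ‖ν‖ ^ 2 ≤ a ^ 2 * s ^ 2 := mul_le_mul_of_nonneg_left hs2 (sq_nonneg a)
    calc 2 * C * inner ℝ e (a • ν) = C * (2 * inner ℝ e (a • ν)) := by ring
      _ ≤ C * (‖e‖ ^ 2 / 6 + 6 * (a ^ 2 * s ^ 2)) :=
          mul_le_mul_of_nonneg_left (by linarith) hC0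
      _ ≤ 2 * (W' * ρ) * (‖e‖ ^ 2 / 6 + 6 * (a ^ 2 * s ^ 2)) :=
          mul_le_mul_of_nonneg_right hC2 (by positivity)
      _ = _ := by ring
  have y3 : -(2 * W' * (1 - a') * (a - a') * inner ℝ e (ν - Z)) ≤
      W' * ρ * (‖e‖ ^ 2 / 3 + 3 * (a ^ 2 * s ^ 2)) := by
    have := two_mul_abs_inner_le e (a • (ν - Z)) (c := 3) (by norm_num)
    rw [norm_smul, mul_pow, Real.norm_eq_abs, sq_abs, inner_smul_right, abs_mul,
      abs_of_nonneg ha0] at this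
    have h1 := neg_abs_le (inner ℝ e (ν - Z))
    have h4 : a ^ 2 * ‖ν - Z‖ ^ 2 ≤ a ^ 2 * s ^ 2 := mul_le_mul_of_nonneg_left hs3 (sq_nonneg a)
    have h5 : (1 - a') * (a - a') ≤ a * ρ :=
      (mul_le_of_le_one_left (by linarith) (by linarith)).trans haρ
    have h6 : 0 ≤ (1 - a') * (a - a') := mul_nonneg (by linarith) (by linarith)
    calc -(2 * W' * (1 - a') * (a - a') * inner ℝ e (ν - Z))
        = 2 * W' * ((1 - a') * (a - a')) * (-inner ℝ e (ν - Z)) := by ring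
      _ ≤ 2 * W' * ((1 - a') * (a - a')) * |inner ℝ e (ν - Z)| :=
          mul_le_mul_of_nonneg_left (by linarith) (by positivity)
      _ ≤ 2 * W' * (a * ρ) * |inner ℝ e (ν - Z)| := by gcongr
      _ = W' * ρ * (2 * (a * |inner ℝ e (ν - Z)|)) := by ring
      _ ≤ _ := mul_le_mul_of_nonneg_left (by linarith) hWρ0
  have g1 : W' * (1 - a') ^ 2 * ‖e‖ ^ 2 + W' * a' * ‖e‖ ^ 2 ≤
      W * ‖e‖ ^ 2 + W' * ρ * ‖e‖ ^ 2 := by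
    have h8 : 0 ≤ W' * a' * (1 - a') := mul_nonneg (mul_nonneg hW' ha') (by linarith)
    have h7 : W' * (1 - a') ^ 2 + W' * a' ≤ W + W' * ρ := by linarith
    have h9 := mul_le_mul_of_nonneg_right h7 (sq_nonneg ‖e‖)
    linarith
  have g2 : W' * (2 * ((1 - a') ^ 2 * ‖Z‖ ^ 2)) + W' * ρ * (3 * ‖Z‖ ^ 2) ≤ 5 * (W' * ‖Z‖ ^ 2) := by
    have h7 : W' * 2 * (1 - a') ^ 2 + W' * ρ * 3 ≤ 5 * W' := by
      have h8 : (1 - a') ^ 2 ≤ 1 := pow_le_one₀ (by linarith) (by linarith)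
      have h9 := mul_le_mul_of_nonneg_left h8 hW'
      have h10 := mul_le_mul_of_nonneg_left hρ1 hW'
      linarith
    have h9 := mul_le_mul_of_nonneg_right h7 (sq_nonneg ‖Z‖)
    linarith
  linarith

set_option maxHeartbeats 1000000 in
/-- One-step recursion for the unweighted momentum error. -/
theorem unweighted_error_step (e Z ν : E) {a a' D s : ℝ} (ha' : 0 ≤ a') (haa : a' ≤ a)
    (ha : a ≤ 1) (hD : 0 ≤ D) (haD : a - a' ≤ D * a') (hν : ‖ν‖ ≤ s) (hνZ : ‖ν - Z‖ ≤ s) :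
    ‖(1 - a') • e + (1 - a') • Z + a' • ν‖ ^ 2 + a' / 2 * ‖e‖ ^ 2 ≤
      ‖e‖ ^ 2 + (2 + 3 / 2 * D) * ‖Z‖ ^ 2 + 2 * (a' ^ 2 * ‖ν‖ ^ 2) +
        12 * D * s ^ 2 * (a - a') +
        2 * (1 - a) * inner ℝ e ((1 - a) • Z + a • ν) := by
  have h := norm_sq_next_error_le e Z ν a a' 1 1 zero_le_one
  have ha0 : 0 ≤ a := ha'.trans haa
  have hs2 : ‖ν‖ ^ 2 ≤ s ^ 2 := pow_le_pow_left₀ (norm_nonneg _) hν 2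
  have hs3 : ‖ν - Z‖ ^ 2 ≤ s ^ 2 := pow_le_pow_left₀ (norm_nonneg _) hνZ 2
  have h0 : 0 ≤ a - a' := by linarith
  -- The Young weight 6/a' makes each leftover term cost a'‖e‖²/6. Three of them consume half of the
  -- gain a'‖e‖², and the rest is proportional to a - a', which telescopes. If a' = 0 then a = a'
  -- and nothing is left over.
  have key : ∀ (v : E), 2 * ((a - a') * |inner ℝ e v|) ≤
      a' / 6 * ‖e‖ ^ 2 + 6 * (D * (a - a')) * ‖v‖ ^ 2 := by
    intro v
    rcases eq_or_lt_of_le ha' with h1 | h1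
    · have h2 : a - a' = 0 := by nlinarith
      rw [h2, ← h1]; simp
    · have h2 := two_mul_abs_inner_le e ((a - a') • v) (c := 6 / a') (by positivity)
      rw [norm_smul, mul_pow, Real.norm_eq_abs, sq_abs, inner_smul_right, abs_mul,
        abs_of_nonneg h0] at h2
      have h3 : 6 / a' * ((a - a') ^ 2 * ‖v‖ ^ 2) ≤ 6 * (D * (a - a')) * ‖v‖ ^ 2 := by
        have : 6 / a' * ((a - a') ^ 2 * ‖v‖ ^ 2) = 6 * ((a - a') / a' * (a - a')) * ‖v‖ ^ 2 := by
          field_simp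
        rw [this]
        have : (a - a') / a' ≤ D := by rwa [div_le_iff₀ h1]
        gcongr
      have h4 : ‖e‖ ^ 2 / (6 / a') = a' / 6 * ‖e‖ ^ 2 := by field_simp
      linarith
  have y1 : 2 * (a - a') * (1 - a) * inner ℝ e Z ≤
      a' / 6 * ‖e‖ ^ 2 + 3 / 2 * D * ‖Z‖ ^ 2 := by
    have h1 := key ((1 - a) • Z)
    rw [inner_smul_right, norm_smul, mul_pow, Real.norm_eq_abs, sq_abs] at h1
    have h2 := le_abs_self ((1 - a) * inner ℝ e Z)
    have h3 : (a - a') * (1 - a) ^ 2 ≤ 1 / 4 := by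
      have h5 : a * (1 - a) ≤ 1 / 4 := by linarith [sq_nonneg (a - 1 / 2)]
      have h6 : (a - a') * (1 - a) ^ 2 ≤ a * (1 - a) := by
        have h7 : (1 - a) ^ 2 ≤ 1 - a := by
          have := mul_nonneg ha0 (sub_nonneg.2 ha)
          linarith
        exact mul_le_mul (by linarith) h7 (sq_nonneg _) ha0
      linarith
    have h4 : 6 * (D * (a - a')) * ((1 - a) ^ 2 * ‖Z‖ ^ 2) ≤ 3 / 2 * D * ‖Z‖ ^ 2 := by
      have : 6 * (D * (a - a')) * ((1 - a) ^ 2 * ‖Z‖ ^ 2) =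
          6 * (D * ‖Z‖ ^ 2) * ((a - a') * (1 - a) ^ 2) := by ring
      rw [this]
      have h5 : 0 ≤ D * ‖Z‖ ^ 2 := by positivity
      have h6 := mul_le_mul_of_nonneg_left h3 h5
      linarith
    have h7 := mul_le_mul_of_nonneg_left h2 h0
    linarith
  have y2 : 2 * (a - a') * inner ℝ e (a • ν) ≤
      a' / 6 * ‖e‖ ^ 2 + 6 * (D * (a - a')) * s ^ 2 := by
    have h1 := key (a • ν)
    rw [norm_smul, mul_pow, Real.norm_eq_abs, sq_abs] at h1
    have h2 := le_abs_self (inner ℝ e (a • ν))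
    have h3 : a ^ 2 * ‖ν‖ ^ 2 ≤ s ^ 2 := by
      exact (mul_le_of_le_one_left (sq_nonneg _) (pow_le_one₀ ha0 ha)).trans hs2
    have h4 : 6 * (D * (a - a')) * (a ^ 2 * ‖ν‖ ^ 2) ≤ 6 * (D * (a - a')) * s ^ 2 := by gcongr
    have h7 := mul_le_mul_of_nonneg_left h2 h0
    linarith
  have y3 : -(2 * 1 * (1 - a') * (a - a') * inner ℝ e (ν - Z)) ≤
      a' / 6 * ‖e‖ ^ 2 + 6 * (D * (a - a')) * s ^ 2 := by
    have h1 := key (ν - Z)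
    have h2 := neg_abs_le (inner ℝ e (ν - Z))
    have h4 : 6 * (D * (a - a')) * ‖ν - Z‖ ^ 2 ≤ 6 * (D * (a - a')) * s ^ 2 := by gcongr
    have h5 : -(2 * 1 * (1 - a') * (a - a') * inner ℝ e (ν - Z)) ≤
        2 * ((a - a') * |inner ℝ e (ν - Z)|) := by
      calc -(2 * 1 * (1 - a') * (a - a') * inner ℝ e (ν - Z))
          = 2 * ((a - a') * (1 - a')) * (-inner ℝ e (ν - Z)) := by ring
        _ ≤ 2 * ((a - a') * (1 - a')) * |inner ℝ e (ν - Z)| :=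
          mul_le_mul_of_nonneg_left (by linarith)
            (mul_nonneg zero_le_two (mul_nonneg h0 (by linarith)))
        _ ≤ 2 * ((a - a') * 1) * |inner ℝ e (ν - Z)| := by gcongr; linarith
        _ = _ := by ring
    linarith
  have e1 : (1 * (1 - a') - 1 * (1 - a) : ℝ) = a - a' := by ring
  rw [e1] at h
  have g1 : (1 - a') ^ 2 * ‖e‖ ^ 2 + a' * ‖e‖ ^ 2 ≤ ‖e‖ ^ 2 := by
    have h8 := mul_nonneg ha' (show 0 ≤ 1 - a' by linarith)
    have h7 : (1 - a') ^ 2 + a' ≤ 1 := by linarith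
    have h9 := mul_le_mul_of_nonneg_right h7 (sq_nonneg ‖e‖)
    linarith
  have g2 : (1 - a') ^ 2 * ‖Z‖ ^ 2 ≤ ‖Z‖ ^ 2 := by
    exact mul_le_of_le_one_left (sq_nonneg _) (pow_le_one₀ (by linarith) (by linarith))
  linarith

end Step

/-! ### Elementary inequalities for powers of S. -/

section Scalar

variable {x y δ r : ℝ}

/-- Because x/y ≤ 1 and r ≤ 1, x/y ≤ (x/y)^r. The same relative increment ρ = 1 - x/y thus controls
both the growth of the weight and, by the next lemma, the decay of the momentum. -/
theorem rpow_sub_rpow_le (hx : 0 < x) (hxy : x ≤ y) (hr1 : r ≤ 1) :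
    y ^ r - x ^ r ≤ y ^ r * (1 - x / y) := by
  have hy : 0 < y := hx.trans_le hxy
  have h1 : x / y ≤ (x / y) ^ r := by
    have h := Real.rpow_le_rpow_of_exponent_ge (div_pos hx hy) ((div_le_one hy).2 hxy) hr1
    rwa [Real.rpow_one] at h
  have h2 : x ^ r = y ^ r * (x / y) ^ r := by
    rw [← Real.mul_rpow hy.le (div_pos hx hy).le, mul_div_cancel₀ _ hy.ne']
  rw [h2]
  have := mul_le_mul_of_nonneg_left h1 (Real.rpow_pos_of_pos hy r).le
  linarith

theorem rpow_neg_sub_rpow_neg_le (hx : 0 < x) (hxy : x ≤ y) (hr1 : r ≤ 1) :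
    x ^ (-r) - y ^ (-r) ≤ x ^ (-r) * (1 - x / y) := by
  have hy : 0 < y := hx.trans_le hxy
  have h1 : x / y ≤ (x / y) ^ r := by
    have h := Real.rpow_le_rpow_of_exponent_ge (div_pos hx hy) ((div_le_one hy).2 hxy) hr1
    rwa [Real.rpow_one] at h
  have h2 : y ^ (-r) = x ^ (-r) * (x / y) ^ r := by
    rw [Real.div_rpow hx.le hy.le, Real.rpow_neg hx.le, Real.rpow_neg hy.le]
    have := (Real.rpow_pos_of_pos hx r).ne'
    field_simp
  rw [h2]
  have := mul_le_mul_of_nonneg_left h1 (Real.rpow_pos_of_pos hx (-r)).le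
  linarith

theorem rpow_add_le_of_le_one (hx : 0 ≤ x) (hy : 0 ≤ y) (hr0 : 0 ≤ r) (hr1 : r ≤ 1) :
    (x + y) ^ r ≤ x ^ r + y ^ r := Real.rpow_add_le_add_rpow hx hy hr0 hr1

theorem rpow_le_rpow_add (hx : 0 < x) (hδ : 0 ≤ δ) (hxy : x ≤ y) (hyx : y - x ≤ δ)
    (hr0 : 0 ≤ r) (hr1 : r ≤ 1) : y ^ r ≤ x ^ r + δ ^ r :=
  (Real.rpow_le_rpow (hx.le.trans hxy) (by linarith) hr0).trans
    (rpow_add_le_of_le_one hx.le hδ hr0 hr1)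

/-- Subadditivity of the power gives y^r ≤ x^r + δ^r, and x ≥ 1 turns this into y^r ≤ x^r(1 + δ^r).
Consecutive momentum parameters are therefore comparable up to a constant factor. -/
theorem rpow_neg_sub_le_mul (hx : 1 ≤ x) (hδ : 0 ≤ δ) (hxy : x ≤ y) (hyx : y - x ≤ δ)
    (hr0 : 0 ≤ r) (hr1 : r ≤ 1) : x ^ (-r) - y ^ (-r) ≤ δ ^ r * y ^ (-r) := by
  have hx0 : 0 < x := by linarith
  have hy : 0 < y := hx0.trans_le hxy
  have h1 := rpow_le_rpow_add hx0 hδ hxy hyx hr0 hr1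
  have hX := Real.rpow_pos_of_pos hx0 r
  have hY := Real.rpow_pos_of_pos hy r
  have hX1 : 1 ≤ x ^ r := Real.one_le_rpow hx hr0
  have hD := Real.rpow_nonneg hδ r
  rw [Real.rpow_neg hx0.le, Real.rpow_neg hy.le]
  have h2 : y ^ r ≤ x ^ r * (1 + δ ^ r) := by nlinarith
  rw [sub_le_iff_le_add, ← add_one_mul, inv_le_iff_one_le_mul₀ hX]
  calc (1 : ℝ) = y ^ r * (y ^ r)⁻¹ := (mul_inv_cancel₀ hY.ne').symm
    _ ≤ x ^ r * (1 + δ ^ r) * (y ^ r)⁻¹ := by gcongr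
    _ = _ := by ring

/-- Past a threshold the relative growth of the weight is absorbed by the momentum parameter. -/
theorem weight_growth_le (hx : 1 ≤ x) (hδ : 0 ≤ δ) (hxy : x ≤ y) (hyx : y - x ≤ δ)
    (hr : 1 / 3 ≤ r) :
    y ^ r * (1 - x / y) ≤ y ^ (-(2 / 3) : ℝ) *
      (y ^ r / 3 + δ * (max 1 (27 * δ ^ 3) + δ) ^ (r - 1 / 3)) := by
  have hx0 : 0 < x := by linarith
  have hy : 0 < y := hx0.trans_le hxy
  have hy1 : 1 ≤ y := hx.trans hxy
  have hρ : 1 - x / y ≤ δ / y := by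
    rw [one_sub_div hy.ne']; gcongr
  have hM : 0 ≤ max 1 (27 * δ ^ 3) + δ := add_nonneg (zero_le_one.trans (le_max_left _ _)) hδ
  have ha := Real.rpow_pos_of_pos hy (-(2 / 3) : ℝ)
  have hW := Real.rpow_pos_of_pos hy r
  have hP : 0 ≤ δ * (max 1 (27 * δ ^ 3) + δ) ^ (r - 1 / 3) :=
    mul_nonneg hδ (Real.rpow_nonneg hM _)
  have e1 : y ^ (1 / 3 : ℝ) / y = y ^ (-(2 / 3) : ℝ) := by
    rw [← Real.rpow_sub_one hy.ne']; norm_num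
  -- Above the threshold 27δ³ one has 3δ ≤ y^(1/3), so the relative growth δ/y is at most a third of
  -- y^(-2/3). Below it y itself is bounded, and y^r δ/y = y^(-2/3) · δ y^(r - 1/3) is a constant
  -- times the momentum.
  rcases le_total (27 * δ ^ 3) y with h | h
  · have h1 : 3 * δ ≤ y ^ (1 / 3 : ℝ) := by
      have h2 := Real.rpow_le_rpow (by positivity) h (show (0 : ℝ) ≤ 1 / 3 by norm_num)
      have h3 : 27 * δ ^ 3 = (3 * δ) ^ (3 : ℝ) := by norm_cast; ring
      rw [h3, ← Real.rpow_mul (by positivity)] at h2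
      norm_num at h2 ⊢
      exact h2
    have h2 : δ / y ≤ y ^ (-(2 / 3) : ℝ) / 3 := by
      rw [← e1, div_div, mul_comm y 3, ← div_div]; gcongr; linarith
    calc y ^ r * (1 - x / y) ≤ y ^ r * (y ^ (-(2 / 3) : ℝ) / 3) := by
          gcongr; exact hρ.trans h2
      _ = y ^ (-(2 / 3) : ℝ) * (y ^ r / 3) := by ring
      _ ≤ _ := by gcongr; linarith
  · have h1 : y ^ (r - 1 / 3) ≤ (max 1 (27 * δ ^ 3) + δ) ^ (r - 1 / 3) :=
      Real.rpow_le_rpow hy.le ((h.trans (le_max_right _ _)).trans (by linarith)) (by linarith)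
    have e2 : y ^ r / y = y ^ (-(2 / 3) : ℝ) * y ^ (r - 1 / 3) := by
      rw [← Real.rpow_sub_one hy.ne', ← Real.rpow_add hy]; congr 1; ring
    calc y ^ r * (1 - x / y) ≤ y ^ r * (δ / y) := by gcongr
      _ = y ^ (-(2 / 3) : ℝ) * (δ * y ^ (r - 1 / 3)) := by
          rw [mul_div_assoc', mul_comm (y ^ r), mul_div_assoc, e2]; ring
      _ ≤ y ^ (-(2 / 3) : ℝ) * (δ * (max 1 (27 * δ ^ 3) + δ) ^ (r - 1 / 3)) := by gcongr
      _ ≤ _ := by gcongr; linarith [hW]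

theorem mul_rpow_le_sub_rpow {κ : ℝ} (hκ0 : 0 < κ) (hκ1 : κ ≤ 1) (hx : 0 < x) (hxy : x ≤ y) :
    y ^ (κ - 1) * (y - x) ≤ (y ^ κ - x ^ κ) / κ := by
  have hy : 0 < y := hx.trans_le hxy
  have h := rpow_one_add_le_one_add_mul_self (s := x / y - 1) (p := κ)
    (by linarith [div_pos hx hy]) hκ0.le hκ1
  rw [add_sub_cancel, Real.div_rpow hx.le hy.le] at h
  have hY := Real.rpow_pos_of_pos hy κ
  rw [le_div_iff₀ hκ0, Real.rpow_sub_one hy.ne']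
  rw [div_le_iff₀ hY] at h
  have : y ^ κ / y * (y - x) * κ = y ^ κ * κ - κ * (x / y) * y ^ κ := by field_simp
  rw [this]; linarith

theorem inv_mul_le_sub_log (hx : 0 < x) (hxy : x ≤ y) :
    y⁻¹ * (y - x) ≤ Real.log y - Real.log x := by
  have hy : 0 < y := hx.trans_le hxy
  have h := Real.log_le_sub_one_of_pos (div_pos hx hy)
  rw [Real.log_div hx.ne' hy.ne'] at h
  have : y⁻¹ * (y - x) = 1 - x / y := by field_simp
  linarith

theorem rpow_neg_four_thirds_mul_le (hx : 0 < x) (hxy : x ≤ y) :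
    y ^ (-(4 / 3) : ℝ) * (y - x) ≤ 3 * (x ^ (-(1 / 3) : ℝ) - y ^ (-(1 / 3) : ℝ)) := by
  have hy : 0 < y := hx.trans_le hxy
  have hz : 0 < x / y := div_pos hx hy
  -- Tangent line at 1 of the convex function z^(-1/3).
  have h1 : 1 - (1 / 3) * (x / y - 1) ≤ (x / y) ^ (-(1 / 3) : ℝ) := by
    rw [Real.rpow_def_of_pos hz]
    have := Real.add_one_le_exp (Real.log (x / y) * (-(1 / 3)))
    have := Real.log_le_sub_one_of_pos hz
    linarith
  rw [Real.div_rpow hx.le hy.le, le_div_iff₀ (Real.rpow_pos_of_pos hy _)] at h1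
  have e1 : y ^ (-(4 / 3) : ℝ) = y ^ (-(1 / 3) : ℝ) / y := by
    rw [← Real.rpow_sub_one hy.ne']; norm_num
  have : y ^ (-(4 / 3) : ℝ) * (y - x) = y ^ (-(1 / 3) : ℝ) - (x / y) * y ^ (-(1 / 3) : ℝ) := by
    rw [e1]; field_simp
  rw [this]; linarith

/-- `∑ W_{n+1} (1 - S_n / S_{n+1}) a_n²` telescopes. -/
theorem weight_noise_step (hx : 1 ≤ x) (hδ : 0 ≤ δ) (hxy : x ≤ y) (hyx : y - x ≤ δ)
    (hr0 : 0 ≤ r) (hr : r ≤ 2 / 3) :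
    y ^ r * (1 - x / y) * (x ^ (-(2 / 3) : ℝ)) ^ 2 ≤
      3 / 2 * (1 + δ ^ r) * (x ^ (-(2 / 3) : ℝ) - y ^ (-(2 / 3) : ℝ)) := by
  have hx0 : 0 < x := by linarith
  have hy : 0 < y := hx0.trans_le hxy
  have hz : 0 < x / y := div_pos hx0 hy
  have hz1 : x / y ≤ 1 := (div_le_one hy).2 hxy
  have hD := Real.rpow_nonneg hδ r
  have h1 : y ^ r ≤ (1 + δ ^ r) * x ^ r := by
    have h := rpow_le_rpow_add hx0 hδ hxy hyx hr0 (by linarith)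
    have hX1 : 1 ≤ x ^ r := Real.one_le_rpow hx hr0
    nlinarith
  have h2 : x ^ r * (x ^ (-(2 / 3) : ℝ)) ^ 2 ≤ x ^ (-(2 / 3) : ℝ) := by
    have h3 : x ^ r * x ^ (-(2 / 3) : ℝ) ≤ 1 := by
      rw [← Real.rpow_add hx0]
      exact Real.rpow_le_one_of_one_le_of_nonpos hx (by linarith)
    have := Real.rpow_pos_of_pos hx0 (-(2 / 3) : ℝ)
    nlinarith
  -- Concavity of z^(2/3) bounds the relative increment by that of the momentum. Since S^r a² ≤ a
  -- for r ≤ 2/3, the product telescopes as a - a'.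
  have h3 : (1 - x / y) ≤ 3 / 2 * (1 - (x / y) ^ (2 / 3 : ℝ)) := by
    have h := rpow_one_add_le_one_add_mul_self (s := x / y - 1) (p := 2 / 3)
      (by linarith) (by norm_num) (by norm_num)
    rw [add_sub_cancel] at h
    linarith
  have h4 : y ^ (-(2 / 3) : ℝ) = x ^ (-(2 / 3) : ℝ) * (x / y) ^ (2 / 3 : ℝ) := by
    rw [Real.div_rpow hx0.le hy.le, Real.rpow_neg hx0.le, Real.rpow_neg hy.le]
    have := (Real.rpow_pos_of_pos hx0 (2 / 3)).ne'
    field_simp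
  have h0 : 0 ≤ 1 - x / y := by linarith
  have ha := Real.rpow_pos_of_pos hx0 (-(2 / 3) : ℝ)
  rw [h4]
  calc y ^ r * (1 - x / y) * (x ^ (-(2 / 3) : ℝ)) ^ 2
      ≤ (1 + δ ^ r) * x ^ r * (1 - x / y) * (x ^ (-(2 / 3) : ℝ)) ^ 2 := by gcongr
    _ = (1 + δ ^ r) * (1 - x / y) * (x ^ r * (x ^ (-(2 / 3) : ℝ)) ^ 2) := by ring
    _ ≤ (1 + δ ^ r) * (1 - x / y) * x ^ (-(2 / 3) : ℝ) := by gcongr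
    _ ≤ (1 + δ ^ r) * (3 / 2 * (1 - (x / y) ^ (2 / 3 : ℝ))) * x ^ (-(2 / 3) : ℝ) := by gcongr
    _ = _ := by ring

end Scalar

/-! ### Sums of increments of S against decreasing weights. -/

section Sums

variable {S : ℕ → ℝ} {δ : ℝ}

theorem sum_weight_noise_le {r : ℝ} (hS1 : ∀ n, 1 ≤ S n) (hδ : 0 ≤ δ) (hmono : Monotone S)
    (hstep : ∀ n, S (n + 1) - S n ≤ δ) (hr0 : 0 ≤ r) (hr : r ≤ 2 / 3) (N : ℕ) :
    ∑ n ∈ Finset.range N, S (n + 1) ^ r * (1 - S n / S (n + 1)) * (S n ^ (-(2 / 3) : ℝ)) ^ 2 ≤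
      3 / 2 * (1 + δ ^ r) := by
  have hD := Real.rpow_nonneg hδ r
  calc _ ≤ ∑ n ∈ Finset.range N,
        3 / 2 * (1 + δ ^ r) * (S n ^ (-(2 / 3) : ℝ) - S (n + 1) ^ (-(2 / 3) : ℝ)) :=
        Finset.sum_le_sum fun n _ =>
          weight_noise_step (hS1 n) hδ (hmono n.le_succ) (hstep n) hr0 hr
    _ = 3 / 2 * (1 + δ ^ r) * (S 0 ^ (-(2 / 3) : ℝ) - S N ^ (-(2 / 3) : ℝ)) := by
        rw [← Finset.mul_sum, Finset.sum_range_sub' (fun n => S n ^ (-(2 / 3) : ℝ))]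
    _ ≤ 3 / 2 * (1 + δ ^ r) * 1 := by
        gcongr
        have h1 : S 0 ^ (-(2 / 3) : ℝ) ≤ 1 :=
          Real.rpow_le_one_of_one_le_of_nonpos (hS1 0) (by norm_num)
        have h2 := Real.rpow_nonneg (zero_le_one.trans (hS1 N)) (-(2 / 3) : ℝ)
        linarith
    _ = _ := mul_one _

/-- Sums of increments against a lagged decreasing weight. -/
theorem sum_lagged_le (w Ψ : ℝ → ℝ) (hw0 : ∀ x, 1 ≤ x → 0 ≤ w x) (hw1 : ∀ x, 1 ≤ x → w x ≤ 1)
    (hanti : ∀ x y, 1 ≤ x → x ≤ y → w y ≤ w x)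
    (hΨ : ∀ x y, 1 ≤ x → x ≤ y → w y * (y - x) ≤ Ψ y - Ψ x)
    (hS1 : ∀ n, 1 ≤ S n) (hδ : 0 ≤ δ) (hmono : Monotone S)
    (hstep : ∀ n, S (n + 1) - S n ≤ δ) (k N : ℕ) :
    ∑ n ∈ Finset.range N, w (S (n + k)) * (S (n + k + 1) - S (n + k)) ≤
      δ + (Ψ (S (N + k)) - Ψ (S k)) := by
  -- The weight is taken at the left end of each increment, while the integral comparison needs the
  -- right end. Moving it costs at most δ times the drop of w, and the drops telescope to at most 1.
  have h : ∀ n, w (S (n + k)) * (S (n + k + 1) - S (n + k)) ≤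
      δ * (w (S (n + k)) - w (S (n + 1 + k))) + (Ψ (S (n + 1 + k)) - Ψ (S (n + k))) := by
    intro n
    have e : n + 1 + k = n + k + 1 := by omega
    rw [e]
    have h1 := hΨ _ _ (hS1 (n + k)) (hmono (n + k).le_succ)
    have h2 := mul_le_mul_of_nonneg_right (hstep (n + k))
      (sub_nonneg.2 (hanti _ _ (hS1 (n + k)) (hmono (n + k).le_succ)))
    simp only [Nat.succ_eq_add_one] at h1 h2
    linarith
  refine (Finset.sum_le_sum fun n _ => h n).trans ?_
  rw [Finset.sum_add_distrib, ← Finset.mul_sum,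
    Finset.sum_range_sub' (fun n => w (S (n + k))), Finset.sum_range_sub (fun n => Ψ (S (n + k)))]
  have h3 := hw1 _ (hS1 (0 + k))
  have h4 := hw0 _ (hS1 (N + k))
  have : δ * (w (S (0 + k)) - w (S (N + k))) ≤ δ * 1 := by gcongr; linarith
  simp only [zero_add] at *
  linarith

theorem sum_lagged_rpow_four_thirds_le (hS1 : ∀ n, 1 ≤ S n) (hδ : 0 ≤ δ) (hmono : Monotone S)
    (hstep : ∀ n, S (n + 1) - S n ≤ δ) (k N : ℕ) :
    ∑ n ∈ Finset.range N, S (n + k) ^ (-(4 / 3) : ℝ) * (S (n + k + 1) - S (n + k)) ≤ δ + 3 := by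
  have h := sum_lagged_le (fun x => x ^ (-(4 / 3) : ℝ)) (fun x => -3 * x ^ (-(1 / 3) : ℝ))
    (fun x hx => Real.rpow_nonneg (by linarith) _)
    (fun x hx => Real.rpow_le_one_of_one_le_of_nonpos hx (by norm_num))
    (fun x y hx hxy => Real.rpow_le_rpow_of_nonpos (by linarith) hxy (by norm_num))
    (fun x y hx hxy => by
      have := rpow_neg_four_thirds_mul_le (by linarith) hxy
      linarith) hS1 hδ hmono hstep k N
  have h1 : S k ^ (-(1 / 3) : ℝ) ≤ 1 :=
    Real.rpow_le_one_of_one_le_of_nonpos (hS1 k) (by norm_num)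
  have h2 := Real.rpow_nonneg (zero_le_one.trans (hS1 (N + k))) (-(1 / 3) : ℝ)
  linarith

theorem sum_lagged_inv_le (hS1 : ∀ n, 1 ≤ S n) (hδ : 0 ≤ δ) (hmono : Monotone S)
    (hstep : ∀ n, S (n + 1) - S n ≤ δ) (k N : ℕ) :
    ∑ n ∈ Finset.range N, S (n + k) ^ (-1 : ℝ) * (S (n + k + 1) - S (n + k)) ≤
      δ + Real.log (S (N + k)) := by
  have h := sum_lagged_le (fun x => x ^ (-1 : ℝ)) Real.log
    (fun x hx => Real.rpow_nonneg (by linarith) _)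
    (fun x hx => Real.rpow_le_one_of_one_le_of_nonpos hx (by norm_num))
    (fun x y hx hxy => Real.rpow_le_rpow_of_nonpos (by linarith) hxy (by norm_num))
    (fun x y hx hxy => by
      have := inv_mul_le_sub_log (by linarith) hxy
      rw [Real.rpow_neg_one]
      linarith) hS1 hδ hmono hstep k N
  have h1 := Real.log_nonneg (hS1 k)
  linarith

theorem sum_lagged_rpow_le {κ : ℝ} (hκ0 : 0 < κ) (hκ1 : κ ≤ 1) (hS1 : ∀ n, 1 ≤ S n) (hδ : 0 ≤ δ)
    (hmono : Monotone S) (hstep : ∀ n, S (n + 1) - S n ≤ δ) (k N : ℕ) :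
    ∑ n ∈ Finset.range N, S (n + k) ^ (κ - 1) * (S (n + k + 1) - S (n + k)) ≤
      δ + S (N + k) ^ κ / κ := by
  have h := sum_lagged_le (fun x => x ^ (κ - 1)) (fun x => x ^ κ / κ)
    (fun x hx => Real.rpow_nonneg (by linarith) _)
    (fun x hx => Real.rpow_le_one_of_one_le_of_nonpos hx (by linarith))
    (fun x y hx hxy => Real.rpow_le_rpow_of_nonpos (by linarith) hxy (by linarith))
    (fun x y hx hxy => by
      have := mul_rpow_le_sub_rpow hκ0 hκ1 (by linarith) hxy
      rw [← sub_div]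
      linarith) hS1 hδ hmono hstep k N
  have h1 := div_nonneg (Real.rpow_nonneg (zero_le_one.trans (hS1 k)) κ) hκ0.le
  linarith

end Sums

/-! ### Fubini for independent pairs and the bias-variance identity. -/

section Probability

variable {Ω U Ξ : Type*} [MeasurableSpace Ω] [MeasurableSpace U] [MeasurableSpace Ξ]
  {μ : Measure Ω} [IsProbabilityMeasure μ] {𝒟 : Measure Ξ}

theorem map_pair_eq {X : Ω → U} {ζ : Ω → Ξ} (hX : Measurable X) (hζ : Measurable ζ)
    (hlaw : μ.map ζ = 𝒟) (hind : IndepFun X ζ μ) :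
    μ.map (fun ω => (X ω, ζ ω)) = (μ.map X).prod 𝒟 := by
  rw [← hlaw]
  exact (indepFun_iff_map_prod_eq_prod_map_map hX.aemeasurable hζ.aemeasurable).1 hind

theorem ae_of_forall_ae {X : Ω → U} {ζ : Ω → Ξ} (hX : Measurable X) (hζ : Measurable ζ)
    (hlaw : μ.map ζ = 𝒟) (hind : IndepFun X ζ μ) {P : Set (U × Ξ)} (hP : MeasurableSet P)
    (h : ∀ᵐ u ∂μ.map X, ∀ᵐ s ∂𝒟, (u, s) ∈ P) : ∀ᵐ ω ∂μ, (X ω, ζ ω) ∈ P := by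
  have : IsProbabilityMeasure 𝒟 := hlaw ▸ Measure.isProbabilityMeasure_map hζ.aemeasurable
  have h1 : ∀ᵐ z ∂(μ.map X).prod 𝒟, z ∈ P := (Measure.ae_prod_mem_iff_ae_ae_mem hP).2 h
  rw [← map_pair_eq hX hζ hlaw hind] at h1
  exact ae_of_ae_map (hX.prodMk hζ).aemeasurable h1

/-- Takes the place of conditional expectation: if X is the past and ζ the fresh sample, their joint
law is a product, so a bound on the integral over the sample that holds for every frozen past may be
integrated. -/
theorem integral_pair_le {X : Ω → U} {ζ : Ω → Ξ} (hX : Measurable X) (hζ : Measurable ζ)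
    (hlaw : μ.map ζ = 𝒟) (hind : IndepFun X ζ μ) {Φ : U × Ξ → ℝ} (hΦ : Measurable Φ)
    (hint : Integrable (fun ω => Φ (X ω, ζ ω)) μ) {Ψ : U → ℝ} (hΨ : Measurable Ψ)
    (hintΨ : Integrable (fun ω => Ψ (X ω)) μ) (h : ∀ u, ∫ s, Φ (u, s) ∂𝒟 ≤ Ψ u) :
    ∫ ω, Φ (X ω, ζ ω) ∂μ ≤ ∫ ω, Ψ (X ω) ∂μ := by
  have : IsProbabilityMeasure 𝒟 := hlaw ▸ Measure.isProbabilityMeasure_map hζ.aemeasurable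
  have hm := map_pair_eq hX hζ hlaw hind
  have h1 : ∫ ω, Φ (X ω, ζ ω) ∂μ = ∫ z, Φ z ∂(μ.map X).prod 𝒟 := by
    rw [← hm, integral_map (hX.prodMk hζ).aemeasurable hΦ.aestronglyMeasurable]
  have h2 : Integrable Φ ((μ.map X).prod 𝒟) := by
    rw [← hm, integrable_map_measure hΦ.aestronglyMeasurable (hX.prodMk hζ).aemeasurable]
    exact hint
  have h3 : ∫ ω, Ψ (X ω) ∂μ = ∫ u, Ψ u ∂μ.map X := by
    rw [integral_map hX.aemeasurable hΨ.aestronglyMeasurable]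
  rw [h1, h3, integral_prod _ h2]
  refine integral_mono h2.integral_prod_left ?_ h
  rw [integrable_map_measure hΨ.aestronglyMeasurable hX.aemeasurable]
  exact hintΨ

theorem integral_pair_eq_zero {X : Ω → U} {ζ : Ω → Ξ} (hX : Measurable X) (hζ : Measurable ζ)
    (hlaw : μ.map ζ = 𝒟) (hind : IndepFun X ζ μ) {Φ : U × Ξ → ℝ} (hΦ : Measurable Φ)
    (hint : Integrable (fun ω => Φ (X ω, ζ ω)) μ) (h : ∀ u, ∫ s, Φ (u, s) ∂𝒟 = 0) :
    ∫ ω, Φ (X ω, ζ ω) ∂μ = 0 := by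
  apply le_antisymm
  · simpa using integral_pair_le hX hζ hlaw hind hΦ hint (Ψ := fun _ => 0) measurable_const
      (by simp) (fun u => (h u).le)
  · have := integral_pair_le hX hζ hlaw hind hΦ.neg hint.neg (Ψ := fun _ => 0) measurable_const
      (by simp) (fun u => by simp [integral_neg, h u])
    simp only [integral_neg, integral_zero, Pi.neg_apply] at this
    linarith

/-- The bias-variance decomposition. -/
theorem integral_norm_sub_sq {E : Type*} [NormedAddCommGroup E] [InnerProductSpace ℝ E]
    [CompleteSpace E] [IsProbabilityMeasure 𝒟] {v : Ξ → E} (hv : Integrable v 𝒟)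
    (hv2 : Integrable (fun s => ‖v s‖ ^ 2) 𝒟) (c : E) :
    ∫ s, ‖v s - c‖ ^ 2 ∂𝒟 = ∫ s, ‖v s‖ ^ 2 ∂𝒟 - 2 * inner ℝ c (∫ s, v s ∂𝒟) + ‖c‖ ^ 2 := by
  have h : ∀ s, ‖v s - c‖ ^ 2 = ‖v s‖ ^ 2 - 2 * inner ℝ c (v s) + ‖c‖ ^ 2 := by
    intro s
    rw [norm_sub_sq_real, real_inner_comm]
  have hi : Integrable (fun s => inner ℝ c (v s)) 𝒟 := hv.const_inner c
  simp_rw [h]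
  have hi' : Integrable (fun s => ‖v s‖ ^ 2 - 2 * inner ℝ c (v s)) 𝒟 := hv2.sub (hi.const_mul 2)
  rw [integral_add hi' (integrable_const _), integral_sub hv2 (hi.const_mul 2), integral_const_mul, integral_inner hv]
  simp

theorem norm_integral_sq_le {E : Type*} [NormedAddCommGroup E] [InnerProductSpace ℝ E]
    [CompleteSpace E] [IsProbabilityMeasure 𝒟] {v : Ξ → E} (hv : Integrable v 𝒟)
    (hv2 : Integrable (fun s => ‖v s‖ ^ 2) 𝒟) :
    ‖∫ s, v s ∂𝒟‖ ^ 2 ≤ ∫ s, ‖v s‖ ^ 2 ∂𝒟 := by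
  have h := integral_norm_sub_sq hv hv2 (∫ s, v s ∂𝒟)
  have h0 : 0 ≤ ∫ s, ‖v s - ∫ s, v s ∂𝒟‖ ^ 2 ∂𝒟 := integral_nonneg fun s => sq_nonneg _
  rw [h, real_inner_self_eq_norm_sq] at h0
  linarith

theorem integral_norm_sub_integral_sq_le {E : Type*} [NormedAddCommGroup E]
    [InnerProductSpace ℝ E]
    [CompleteSpace E] [IsProbabilityMeasure 𝒟] {v : Ξ → E} (hv : Integrable v 𝒟)
    (hv2 : Integrable (fun s => ‖v s‖ ^ 2) 𝒟) :
    ∫ s, ‖v s - ∫ s, v s ∂𝒟‖ ^ 2 ∂𝒟 ≤ ∫ s, ‖v s‖ ^ 2 ∂𝒟 := by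
  rw [integral_norm_sub_sq hv hv2, real_inner_self_eq_norm_sq]
  linarith [sq_nonneg ‖∫ s, v s ∂𝒟‖]

end Probability

/-! ### Independence of the past and the next sample. -/

section Independence

variable {Ω U Ξ : Type*} [MeasurableSpace Ω] [MeasurableSpace U] [MeasurableSpace Ξ]
  {μ : Measure Ω}

/-- A function of `ξ 0, …, ξ N` is independent of `ξ (N + 1)`. -/
theorem indepFun_of_depends {ξ : ℕ → Ω → Ξ} (hm : ∀ t, Measurable (ξ t)) (hind : iIndepFun ξ μ)
    (N : ℕ) {Ψ : (ℕ → Ξ) → U} (hΨ : Measurable Ψ)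
    (hdep : ∀ s s' : ℕ → Ξ, (∀ i ≤ N, s i = s' i) → Ψ s = Ψ s') :
    IndepFun (fun ω => Ψ (fun i => ξ i ω)) (ξ (N + 1)) μ := by
  have h := hind.indepFun_finset (Finset.range (N + 1)) {N + 1} (by simp) hm
  -- Extends a finite history to a full sequence by repeating its last entry; by `hdep`, Ψ does not
  -- see the repeated entries.
  let tr : ((Finset.range (N + 1)) → Ξ) → ℕ → Ξ :=
    fun h i => h ⟨min i N, Finset.mem_range.2 (by omega)⟩
  have htr : Measurable tr := measurable_pi_lambda _ fun i => measurable_pi_apply _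
  have h2 := h.comp (φ := fun h => Ψ (tr h)) 
    (ψ := fun h : ({N + 1} : Finset ℕ) → Ξ => h ⟨N + 1, by simp⟩)
    (hΨ.comp htr) (measurable_pi_apply (X := fun _ : ({N + 1} : Finset ℕ) => Ξ) ⟨N + 1, by simp⟩)
  have e : (fun ω => Ψ (fun i => ξ i ω)) =
      (fun h => Ψ (tr h)) ∘ fun ω (i : Finset.range (N + 1)) => ξ i ω := by
    funext ω
    refine hdep _ _ fun i hi => ?_
    simp [tr, min_eq_left hi]
  rw [e]
  exact h2

end Independence

/-! ### The run as a measurable function of finitely many samples. -/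

section Run

variable {d : ℕ} {Ξ : Type*} (g : EuclideanSpace ℝ (Fin d) → Ξ → EuclideanSpace ℝ (Fin d))
  (p a₀ b₀ η : ℝ) (x₁ : EuclideanSpace ℝ (Fin d))

theorem run_congr (n : ℕ) {s s' : ℕ → Ξ} (h : ∀ i ≤ n, s i = s' i) :
    run g p a₀ b₀ η x₁ s n = run g p a₀ b₀ η x₁ s' n := by
  induction n with
  | zero => rfl
  | succ n ih =>
    cases n with
    | zero => simp [run, h 1 le_rfl]
    | succ n =>
      simp only [run]
      rw [ih fun i hi => h i (by omega), h (n + 1) (by omega), h (n + 2) (by omega)]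

theorem measurable_run [MeasurableSpace Ξ]
    (hg : Measurable fun z : EuclideanSpace ℝ (Fin d) × Ξ => g z.1 z.2) (n : ℕ) :
    Measurable (fun s => (run g p a₀ b₀ η x₁ s n).x) ∧
      Measurable (fun s => (run g p a₀ b₀ η x₁ s n).dir) ∧
      Measurable (fun s => (run g p a₀ b₀ η x₁ s n).sumDir) ∧
      Measurable (fun s => (run g p a₀ b₀ η x₁ s n).sumDiff) := by
  have hg' : ∀ {X : (ℕ → Ξ) → EuclideanSpace ℝ (Fin d)} (i : ℕ), Measurable X →
      Measurable fun s => g (X s) (s i) := fun i hX =>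
    hg.comp (hX.prodMk (measurable_pi_apply i))
  induction n with
  | zero => simp [run, measurable_const]
  | succ n ih =>
    cases n with
    | zero =>
      have h := hg' (X := fun _ => x₁) 1 measurable_const
      exact ⟨measurable_const, h, h.norm.pow_const 2, measurable_const⟩
    | succ n =>
      obtain ⟨hx, hd, hD, hS⟩ := ih
      have hb : Measurable fun s => (run g p a₀ b₀ η x₁ s (n + 1)).b p a₀ b₀ := by
        unfold State.b State.a
        exact ((measurable_const.add hD).pow_const p).div
          (((measurable_const.add (hS.div_const _)).pow_const _).pow_const _)
      have hx' : Measurable fun s => (run g p a₀ b₀ η x₁ s (n + 2)).x :=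
        hx.sub ((measurable_const.div hb).smul hd)
      have hS' : Measurable fun s => (run g p a₀ b₀ η x₁ s (n + 2)).sumDiff :=
        hS.add (((hg' (n + 1) hx).sub (hg' (n + 2) hx)).norm.pow_const 2)
      have hd' : Measurable fun s => (run g p a₀ b₀ η x₁ s (n + 2)).dir :=
        (hg' (n + 2) hx').add ((measurable_const.sub
          ((measurable_const.add (hS'.div_const _)).pow_const _)).smul (hd.sub (hg' (n + 2) hx)))
      exact ⟨hx', hd', hD.add (hd'.norm.pow_const 2), hS'⟩

end Run

/-! ### Regularity of the objective and moments of the noise. -/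

section Objective

variable {d : ℕ} {Ξ : Type*} [MeasurableSpace Ξ] {𝒟 : Measure Ξ}
  {f : EuclideanSpace ℝ (Fin d) → Ξ → ℝ} {σ σhat β : ℝ}

local notation "E" => EuclideanSpace ℝ (Fin d)

theorem Assumptions.measurable_section (h : Assumptions 𝒟 f σ σhat β) (x : E) :
    Measurable (stochGrad f x) := h.measurable_grad.comp (measurable_const.prodMk measurable_id)

theorem Assumptions.integrable_noise (h : Assumptions 𝒟 f σ σhat β) (x : E) :
    Integrable (fun s => stochGrad f x s - trueGrad 𝒟 f x) 𝒟 := by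
  have := h.isProbabilityMeasure
  exact (h.integrable_grad x).sub (integrable_const _)

theorem Assumptions.integral_noise (h : Assumptions 𝒟 f σ σhat β) (x : E) :
    ∫ s, (stochGrad f x s - trueGrad 𝒟 f x) ∂𝒟 = 0 := by
  have := h.isProbabilityMeasure
  rw [integral_sub (h.integrable_grad x) (integrable_const _), h.unbiased x]
  simp

theorem Assumptions.memLp_grad (h : Assumptions 𝒟 f σ σhat β) (x : E) :
    MemLp (stochGrad f x) 2 𝒟 := by
  have := h.isProbabilityMeasure
  have h1 : MemLp (fun s => stochGrad f x s - trueGrad 𝒟 f x) 2 𝒟 :=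
    (memLp_two_iff_integrable_sq_norm
      ((h.measurable_section x).sub measurable_const).aestronglyMeasurable).2
      (h.integrable_variance x)
  have h2 := h1.add (memLp_const (trueGrad 𝒟 f x))
  refine h2.congr_norm (h.measurable_section x).aestronglyMeasurable (.of_forall fun s => ?_)
  simp

theorem Assumptions.integrable_diff_sq (h : Assumptions 𝒟 f σ σhat β) (x y : E) :
    Integrable (fun s => ‖stochGrad f x s - stochGrad f y s‖ ^ 2) 𝒟 :=
  (memLp_two_iff_integrable_sq_norm
    ((h.measurable_section x).sub (h.measurable_section y)).aestronglyMeasurable).1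
    ((h.memLp_grad x).sub (h.memLp_grad y))

theorem Assumptions.norm_trueGrad_sub_le (h : Assumptions 𝒟 f σ σhat β) (hβ : 0 ≤ β) (x y : E) :
    ‖trueGrad 𝒟 f x - trueGrad 𝒟 f y‖ ≤ β * ‖x - y‖ := by
  have := h.isProbabilityMeasure
  have h1 := norm_integral_sq_le ((h.integrable_grad x).sub (h.integrable_grad y))
    (h.integrable_diff_sq x y)
  simp only [Pi.sub_apply] at h1
  rw [integral_sub (h.integrable_grad x) (h.integrable_grad y), h.unbiased, h.unbiased] at h1
  have h2 := h1.trans (h.averaged_smooth x y)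
  rw [← mul_pow] at h2
  exact le_of_sq_le_sq h2 (by positivity)

theorem Assumptions.continuous_trueGrad (h : Assumptions 𝒟 f σ σhat β) (hβ : 0 ≤ β) :
    Continuous (trueGrad 𝒟 f) :=
  (LipschitzWith.of_dist_le_mul (K := ⟨β, hβ⟩) fun x y => by
    rw [dist_eq_norm, dist_eq_norm]; exact h.norm_trueGrad_sub_le hβ x y).continuous

/-- The increments of the noise have second moment at most `β² ‖x - y‖²`. -/
theorem Assumptions.integral_noise_sub_sq_le (h : Assumptions 𝒟 f σ σhat β) (x y : E) :
    ∫ s, ‖(stochGrad f x s - trueGrad 𝒟 f x) - (stochGrad f y s - trueGrad 𝒟 f y)‖ ^ 2 ∂𝒟 ≤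
      β ^ 2 * ‖x - y‖ ^ 2 := by
  have := h.isProbabilityMeasure
  have h1 := integral_norm_sub_integral_sq_le ((h.integrable_grad x).sub (h.integrable_grad y))
    (h.integrable_diff_sq x y)
  simp only [Pi.sub_apply] at h1
  rw [integral_sub (h.integrable_grad x) (h.integrable_grad y), h.unbiased, h.unbiased] at h1
  refine le_trans (le_of_eq ?_) (h1.trans (h.averaged_smooth x y))
  congr 1; funext s; congr 2; abel

/-- Bias-variance decomposition around the frozen sample s; the noise of s' is centred, so there is
no cross term. Read as a lower bound it compares noise with gradient differences, and read as an
upper bound it gives them variance at most 2σ². -/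
theorem Assumptions.integral_sub_sample_sq (h : Assumptions 𝒟 f σ σhat β) (x : E) (s : Ξ) :
    ∫ s', ‖stochGrad f x s - stochGrad f x s'‖ ^ 2 ∂𝒟 =
      ‖stochGrad f x s - trueGrad 𝒟 f x‖ ^ 2 +
        ∫ s', ‖stochGrad f x s' - trueGrad 𝒟 f x‖ ^ 2 ∂𝒟 := by
  have := h.isProbabilityMeasure
  have h1 := integral_norm_sub_sq (h.integrable_noise x) (h.integrable_variance x)
    (stochGrad f x s - trueGrad 𝒟 f x)
  rw [h.integral_noise x, inner_zero_right] at h1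
  have h2 : ∀ s', ‖stochGrad f x s - stochGrad f x s'‖ ^ 2 =
      ‖stochGrad f x s' - trueGrad 𝒟 f x - (stochGrad f x s - trueGrad 𝒟 f x)‖ ^ 2 := by
    intro s'
    rw [← norm_neg]; congr 2; abel
  simp_rw [h2]
  rw [h1]; ring

/-- By unbiasedness the noise is the average over s' of the differences of stochastic gradients,
each bounded by 2σhat. -/
theorem Assumptions.ae_noise_le (h : Assumptions 𝒟 f σ σhat β) (x : E) :
    ∀ᵐ s ∂𝒟, ‖stochGrad f x s - trueGrad 𝒟 f x‖ ≤ 2 * σhat := by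
  have := h.isProbabilityMeasure
  filter_upwards [h.bounded_diff x] with s hs
  have h1 : stochGrad f x s - trueGrad 𝒟 f x = ∫ s', (stochGrad f x s - stochGrad f x s') ∂𝒟 := by
    rw [integral_sub (integrable_const _) (h.integrable_grad x), h.unbiased]
    simp
  rw [h1]
  have h2 := norm_integral_le_of_norm_le_const hs
  simpa using h2

theorem Assumptions.mono {β' : ℝ} (h : Assumptions 𝒟 f σ σhat β) (hβ : 0 ≤ β) (hβ' : β ≤ β') :
    Assumptions 𝒟 f σ σhat β' :=
  { h with
    averaged_smooth := fun x y => (h.averaged_smooth x y).trans (by gcongr) }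

/-- The descent lemma. -/
theorem Assumptions.objective_le (h : Assumptions 𝒟 f σ σhat β) (hβ : 0 ≤ β) (x y : E) :
    objective 𝒟 f y ≤ objective 𝒟 f x + inner ℝ (trueGrad 𝒟 f x) (y - x) +
      β / 2 * ‖y - x‖ ^ 2 := by
  set v := y - x with hv
  have hd : ∀ t : ℝ, HasDerivAt (fun t : ℝ => objective 𝒟 f (x + t • v))
      (inner ℝ (trueGrad 𝒟 f (x + t • v)) v) t := by
    intro t
    have h1 := (h.differentiable_objective (x + t • v)).hasGradientAt.hasFDerivAt
    have h2 : HasDerivAt (fun t : ℝ => x + t • v) v t := by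
      simpa using ((hasDerivAt_id t).smul_const v).const_add x
    have h3 := h1.comp_hasDerivAt t h2
    exact h3
  -- F along the segment minus its quadratic upper model. The Lipschitz gradient makes ψ
  -- nonincreasing on [0, 1], and comparing endpoints is the claim.
  let ψ : ℝ → ℝ := fun t => objective 𝒟 f (x + t • v) - t * inner ℝ (trueGrad 𝒟 f x) v -
    β / 2 * ‖v‖ ^ 2 * t ^ 2
  have hψ : ∀ t, HasDerivAt ψ (inner ℝ (trueGrad 𝒟 f (x + t • v)) v -
      1 * inner ℝ (trueGrad 𝒟 f x) v - β / 2 * ‖v‖ ^ 2 * (2 * t)) t := by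
    intro t
    have h1 := (hasDerivAt_id t).mul_const (inner ℝ (trueGrad 𝒟 f x) v)
    have h2 := (hasDerivAt_pow 2 t).const_mul (β / 2 * ‖v‖ ^ 2)
    have h3 := ((hd t).sub h1).sub h2
    exact h3.congr_deriv (by simp)
  have hanti : AntitoneOn ψ (Set.Icc 0 1) := by
    refine antitoneOn_of_deriv_nonpos (convex_Icc 0 1)
      (fun t _ => (hψ t).continuousAt.continuousWithinAt)
      (fun t _ => (hψ t).differentiableAt.differentiableWithinAt) fun t ht => ?_
    rw [interior_Icc] at ht
    rw [(hψ t).deriv, one_mul, ← inner_sub_left]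
    have h1 := real_inner_le_norm (trueGrad 𝒟 f (x + t • v) - trueGrad 𝒟 f x) v
    have h2 := h.norm_trueGrad_sub_le hβ (x + t • v) x
    rw [add_sub_cancel_left, norm_smul, Real.norm_eq_abs, abs_of_pos ht.1] at h2
    have h3 := mul_le_mul_of_nonneg_right h2 (norm_nonneg v)
    linarith
  have h1 := hanti (Set.left_mem_Icc.2 zero_le_one) (Set.right_mem_Icc.2 zero_le_one) zero_le_one
  simp only [ψ, one_smul, zero_smul, add_zero, hv, add_sub_cancel] at h1
  linarith

end Objective

/-! ### Calculus of essentially bounded random variables. -/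

section EssBdd

variable {Ω : Type*} [MeasurableSpace Ω] {μ : Measure Ω}
  {F : Type*} [NormedAddCommGroup F] [MeasurableSpace F]

/-- Measurable and essentially bounded random variables. -/
structure EssBdd (μ : Measure Ω) (X : Ω → F) : Prop where
  meas : Measurable X
  bdd : ∃ C : ℝ, ∀ᵐ ω ∂μ, ‖X ω‖ ≤ C

namespace EssBdd

theorem const (c : F) : EssBdd μ (fun _ : Ω => c) :=
  ⟨measurable_const, ‖c‖, .of_forall fun _ => le_rfl⟩

theorem mono {X : Ω → F} {Y : Ω → ℝ} (hX : Measurable X) (hY : EssBdd μ Y)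
    (h : ∀ᵐ ω ∂μ, ‖X ω‖ ≤ Y ω) : EssBdd μ X := by
  obtain ⟨C, hC⟩ := hY.bdd
  refine ⟨hX, C, ?_⟩
  filter_upwards [hC, h] with ω h1 h2
  exact h2.trans ((le_abs_self _).trans h1)

theorem norm [BorelSpace F] {X : Ω → F} (hX : EssBdd μ X) : EssBdd μ (fun ω => ‖X ω‖) := by
  obtain ⟨C, hC⟩ := hX.bdd
  exact ⟨hX.meas.norm, C, by simpa using hC⟩

section Add

variable [BorelSpace F] [SecondCountableTopology F]

theorem add {X Y : Ω → F} (hX : EssBdd μ X) (hY : EssBdd μ Y) :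
    EssBdd μ (fun ω => X ω + Y ω) := by
  obtain ⟨C, hC⟩ := hX.bdd
  obtain ⟨C', hC'⟩ := hY.bdd
  refine ⟨hX.meas.add hY.meas, C + C', ?_⟩
  filter_upwards [hC, hC'] with ω h1 h2
  exact (norm_add_le _ _).trans (add_le_add h1 h2)

theorem sub {X Y : Ω → F} (hX : EssBdd μ X) (hY : EssBdd μ Y) :
    EssBdd μ (fun ω => X ω - Y ω) := by
  obtain ⟨C, hC⟩ := hX.bdd
  obtain ⟨C', hC'⟩ := hY.bdd
  refine ⟨hX.meas.sub hY.meas, C + C', ?_⟩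
  filter_upwards [hC, hC'] with ω h1 h2
  exact (norm_sub_le _ _).trans (add_le_add h1 h2)

theorem smul [NormedSpace ℝ F] {c : Ω → ℝ} {X : Ω → F} (hc : EssBdd μ c) (hX : EssBdd μ X) :
    EssBdd μ (fun ω => c ω • X ω) := by
  obtain ⟨C, hC⟩ := hc.bdd
  obtain ⟨C', hC'⟩ := hX.bdd
  refine ⟨hc.meas.smul hX.meas, C * C', ?_⟩
  filter_upwards [hC, hC'] with ω h1 h2
  rw [norm_smul]
  exact mul_le_mul h1 h2 (norm_nonneg _) ((norm_nonneg _).trans h1)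

theorem integrable [IsFiniteMeasure μ] {X : Ω → F} (hX : EssBdd μ X) : Integrable X μ := by
  obtain ⟨C, hC⟩ := hX.bdd
  exact Integrable.of_bound hX.meas.aestronglyMeasurable C hC

theorem sum {ι : Type*} {X : ι → Ω → F} (s : Finset ι) (hX : ∀ i ∈ s, EssBdd μ (X i)) :
    EssBdd μ (fun ω => ∑ i ∈ s, X i ω) := by
  classical
  induction s using Finset.induction_on with
  | empty => simpa using const (0 : F)
  | insert i s hi ih =>
    simp_rw [Finset.sum_insert hi]
    exact (hX i (by simp)).add (ih fun j hj => hX j (by simp [hj]))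

end Add

theorem mul {X Y : Ω → ℝ} (hX : EssBdd μ X) (hY : EssBdd μ Y) :
    EssBdd μ (fun ω => X ω * Y ω) := hX.smul hY

theorem const_mul {X : Ω → ℝ} (c : ℝ) (hX : EssBdd μ X) : EssBdd μ (fun ω => c * X ω) :=
  (const c).mul hX

theorem sq {X : Ω → ℝ} (hX : EssBdd μ X) : EssBdd μ (fun ω => X ω ^ 2) := by
  simp_rw [pow_two]; exact hX.mul hX

theorem inner [InnerProductSpace ℝ F] [BorelSpace F] [SecondCountableTopology F]
    {X Y : Ω → F} (hX : EssBdd μ X) (hY : EssBdd μ Y) :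
    EssBdd μ (fun ω => inner ℝ (X ω) (Y ω)) :=
  (hX.norm.mul hY.norm).mono (hX.meas.inner hY.meas)
    (.of_forall fun _ => norm_inner_le_norm _ _)

/-- Powers of essentially bounded nonnegative variables. -/
theorem rpow {X : Ω → ℝ} (hX : EssBdd μ X) (h0 : ∀ ω, 0 ≤ X ω) {r : ℝ} (hr : 0 ≤ r) :
    EssBdd μ (fun ω => X ω ^ r) := by
  obtain ⟨C, hC⟩ := hX.bdd
  refine ⟨hX.meas.pow_const r, C ^ r, ?_⟩
  filter_upwards [hC] with ω h1
  rw [Real.norm_of_nonneg (Real.rpow_nonneg (h0 ω) r)]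
  rw [Real.norm_of_nonneg (h0 ω)] at h1
  exact Real.rpow_le_rpow (h0 ω) h1 hr

theorem rpow_of_one_le {X : Ω → ℝ} (hX : EssBdd μ X) (h1 : ∀ ω, 1 ≤ X ω) (r : ℝ) :
    EssBdd μ (fun ω => X ω ^ r) := by
  have h0 : ∀ ω, 0 ≤ X ω := fun ω => zero_le_one.trans (h1 ω)
  rcases le_total 0 r with hr | hr
  · exact hX.rpow h0 hr
  · refine ⟨hX.meas.pow_const r, 1, .of_forall fun ω => ?_⟩
    rw [Real.norm_of_nonneg (Real.rpow_nonneg (h0 ω) r)]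
    exact Real.rpow_le_one_of_one_le_of_nonpos (h1 ω) hr

theorem log_of_one_le {X : Ω → ℝ} (hX : EssBdd μ X) (h1 : ∀ ω, 1 ≤ X ω) :
    EssBdd μ (fun ω => Real.log (X ω)) := by
  refine hX.mono hX.meas.log (.of_forall fun ω => ?_)
  rw [Real.norm_of_nonneg (Real.log_nonneg (h1 ω))]
  linarith [Real.log_le_sub_one_of_pos (zero_lt_one.trans_le (h1 ω))]

end EssBdd

end EssBdd

/-! ### The properties of a run on which the analysis rests. -/

section Trajectory

variable {d : ℕ}

local notation "E" => EuclideanSpace ℝ (Fin d)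

/-- What the analysis uses about a run of META-STORM. Iterations are numbered from `0`: `x n` are
the iterates, `dir n` the directions, `grad n = ∇F(x n)`, `ν n` and `ν' n` the noise of the
stochastic gradient at `x n` for the current and the next sample, and
`S n = 1 + ∑_{i < n} ‖ν i - ν' i‖² / a₀²`. -/
structure Trajectory {Ω : Type*} [MeasurableSpace Ω] (μ : Measure Ω) (σ σhat β p a₀ b₀ η Δ : ℝ)
    (F : EuclideanSpace ℝ (Fin d) → ℝ) (x dir grad ν ν' : ℕ → Ω → EuclideanSpace ℝ (Fin d))
    (S : ℕ → Ω → ℝ) : Prop where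
  bdd_x : ∀ n, EssBdd μ (x n)
  bdd_dir : ∀ n, EssBdd μ (dir n)
  bdd_grad : ∀ n, EssBdd μ (grad n)
  bdd_ν : ∀ n, EssBdd μ (ν n)
  bdd_ν' : ∀ n, EssBdd μ (ν' n)
  bdd_S : ∀ n, EssBdd μ (S n)
  S_zero : ∀ ω, S 0 ω = 1
  S_succ : ∀ n ω, S (n + 1) ω = S n ω + ‖ν n ω - ν' n ω‖ ^ 2 / a₀ ^ 2
  noise_le : ∀ᵐ ω ∂μ, ∀ n,
    ‖ν n ω‖ ≤ 2 * σhat ∧ ‖ν' n ω‖ ≤ 2 * σhat ∧ ‖ν n ω - ν' n ω‖ ≤ 2 * σhat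
  err_zero : ∀ ω, dir 0 ω - grad 0 ω = ν 0 ω
  err_succ : ∀ n ω, dir (n + 1) ω - grad (n + 1) ω =
    (1 - S (n + 1) ω ^ (-(2 / 3) : ℝ)) • (dir n ω - grad n ω) +
      (1 - S (n + 1) ω ^ (-(2 / 3) : ℝ)) • (ν (n + 1) ω - ν' n ω) +
      S (n + 1) ω ^ (-(2 / 3) : ℝ) • ν (n + 1) ω
  x_succ : ∀ n ω, x (n + 1) ω = x n ω - (η / ((b₀ ^ (1 / p) +
    ∑ i ∈ Finset.range (n + 1), ‖dir i ω‖ ^ 2) ^ p /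
      (S n ω ^ (-(2 / 3) : ℝ)) ^ ((1 - p) / 2))) • dir n ω
  descent : ∀ n ω, F (x (n + 1) ω) ≤ F (x n ω) + inner ℝ (grad n ω) (x (n + 1) ω - x n ω) +
    β / 2 * ‖x (n + 1) ω - x n ω‖ ^ 2
  gap : ∀ n ω, F (x 0 ω) - F (x n ω) ≤ Δ
  -- In this and the next two fields the weight is a function of S n, which is known before the
  -- sample entering ν' n is drawn. These are the only conditional statements the analysis needs.
  cross : ∀ n (φ : ℝ → ℝ), Measurable φ → EssBdd μ (fun ω => φ (S n ω)) →
    ∫ ω, φ (S n ω) * inner ℝ (dir n ω - grad n ω)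
      ((1 - S n ω ^ (-(2 / 3) : ℝ)) • (ν (n + 1) ω - ν' n ω) +
        S n ω ^ (-(2 / 3) : ℝ) • ν (n + 1) ω) ∂μ = 0
  increment : ∀ n (φ : ℝ → ℝ), Measurable φ → EssBdd μ (fun ω => φ (S n ω)) → (∀ u, 0 ≤ φ u) →
    ∫ ω, φ (S n ω) * ‖ν (n + 1) ω - ν' n ω‖ ^ 2 ∂μ ≤
      ∫ ω, φ (S n ω) * (β ^ 2 * ‖x (n + 1) ω - x n ω‖ ^ 2) ∂μ
  -- The right-hand side is a₀² times an increment of S, which is why the noise is measured in this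
  -- way.
  noise_swap : ∀ n (φ : ℝ → ℝ), Measurable φ → EssBdd μ (fun ω => φ (S n ω)) → (∀ u, 0 ≤ φ u) →
    ∫ ω, φ (S n ω) * ‖ν n ω‖ ^ 2 ∂μ ≤ ∫ ω, φ (S n ω) * ‖ν n ω - ν' n ω‖ ^ 2 ∂μ
  variance_zero : ∫ ω, ‖ν 0 ω‖ ^ 2 ∂μ ≤ σ ^ 2
  variance : ∀ n, ∫ ω, ‖ν n ω - ν' n ω‖ ^ 2 ∂μ ≤ 2 * σ ^ 2

end Trajectory

/-! ### Measurability, independence and almost sure noise bounds for the run. -/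

section Construction

variable {d : ℕ} {Ξ Ω : Type*}

local notation "E" => EuclideanSpace ℝ (Fin d)

/-- The state in iteration `n + 1` along the random samples. -/
noncomputable abbrev stateAt (f : EuclideanSpace ℝ (Fin d) → Ξ → ℝ) (p a₀ b₀ η : ℝ)
    (x₁ : EuclideanSpace ℝ (Fin d)) (ξ : ℕ → Ω → Ξ) (n : ℕ) (ω : Ω) : State d :=
  run (stochGrad f) p a₀ b₀ η x₁ (fun i => ξ i ω) (n + 1)

theorem le_stepDenominator {p b₀ D a : ℝ} (hp0 : 0 < p) (hp1 : p ≤ 1) (hb₀ : 0 < b₀)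
    (hD : 0 ≤ D) (ha0 : 0 < a) (ha1 : a ≤ 1) :
    b₀ ≤ (b₀ ^ (1 / p) + D) ^ p / a ^ ((1 - p) / 2) := by
  have h1 : b₀ ≤ (b₀ ^ (1 / p) + D) ^ p := by
    calc b₀ = (b₀ ^ (1 / p)) ^ p := by
          rw [← Real.rpow_mul hb₀.le, one_div_mul_cancel hp0.ne', Real.rpow_one]
      _ ≤ _ := Real.rpow_le_rpow (Real.rpow_nonneg hb₀.le _) (by linarith) hp0.le
  have h2 : a ^ ((1 - p) / 2) ≤ 1 := Real.rpow_le_one ha0.le ha1 (by linarith)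
  rw [le_div_iff₀ (Real.rpow_pos_of_pos ha0 _)]
  nlinarith

variable {f : EuclideanSpace ℝ (Fin d) → Ξ → ℝ} {p a₀ b₀ η : ℝ}
  {ξ : ℕ → Ω → Ξ} {x₁ : EuclideanSpace ℝ (Fin d)}

theorem stateAt_sumDiff_nonneg (n : ℕ) (ω : Ω) :
    0 ≤ (stateAt f p a₀ b₀ η x₁ ξ n ω).sumDiff := by
  rw [run_sumDiff]
  exact Finset.sum_nonneg fun _ _ => sq_nonneg _

theorem stateAt_sumDir (n : ℕ) (ω : Ω) :
    (stateAt f p a₀ b₀ η x₁ ξ n ω).sumDir =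
      ∑ i ∈ Finset.range (n + 1), ‖(stateAt f p a₀ b₀ η x₁ ξ i ω).dir‖ ^ 2 := by
  rw [run_sumDir, ← Finset.Ico_add_one_right_eq_Icc, Finset.sum_Ico_eq_sum_range]
  simp [add_comm]

theorem one_le_stateAt_S (n : ℕ) (ω : Ω) :
    1 ≤ 1 + (stateAt f p a₀ b₀ η x₁ ξ n ω).sumDiff / a₀ ^ 2 := by
  have := stateAt_sumDiff_nonneg (f := f) (p := p) (a₀ := a₀) (b₀ := b₀) (η := η) (x₁ := x₁)
    (ξ := ξ) n ω
  have : 0 ≤ (stateAt f p a₀ b₀ η x₁ ξ n ω).sumDiff / a₀ ^ 2 := by positivity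
  linarith

variable [MeasurableSpace Ξ] [MeasurableSpace Ω] {𝒟 : Measure Ξ} {σ σhat β : ℝ} {μ : Measure Ω}

theorem measurable_stateAt (h : Assumptions 𝒟 f σ σhat β) (hs : IsSampling μ 𝒟 ξ) (n : ℕ) :
    Measurable (fun ω => (stateAt f p a₀ b₀ η x₁ ξ n ω).x) ∧
      Measurable (fun ω => (stateAt f p a₀ b₀ η x₁ ξ n ω).dir) ∧
      Measurable (fun ω => (stateAt f p a₀ b₀ η x₁ ξ n ω).sumDir) ∧
      Measurable (fun ω => (stateAt f p a₀ b₀ η x₁ ξ n ω).sumDiff) := by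
  have hξ : Measurable fun ω i => ξ i ω := measurable_pi_lambda _ hs.measurable
  obtain ⟨h1, h2, h3, h4⟩ := measurable_run (stochGrad f) p a₀ b₀ η x₁ h.measurable_grad (n + 1)
  exact ⟨h1.comp hξ, h2.comp hξ, h3.comp hξ, h4.comp hξ⟩

/-- Iterate `n` is independent of the sample used in it. -/
theorem indepFun_stateAt_x (h : Assumptions 𝒟 f σ σhat β) (hs : IsSampling μ 𝒟 ξ) (n : ℕ) :
    IndepFun (fun ω => (stateAt f p a₀ b₀ η x₁ ξ n ω).x) (ξ (n + 1)) μ := by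
  refine indepFun_of_depends hs.measurable hs.indep n
    (Ψ := fun s => (run (stochGrad f) p a₀ b₀ η x₁ s (n + 1)).x)
    (measurable_run (stochGrad f) p a₀ b₀ η x₁ h.measurable_grad (n + 1)).1 ?_
  intro s s' hss
  -- The initial point is deterministic, and later iterates are computed from the preceding state.
  -- An iterate thus uses one sample fewer than the state it belongs to.
  cases n with
  | zero => rfl
  | succ n =>
    simp only [run_x_succ]
    rw [run_congr (stochGrad f) p a₀ b₀ η x₁ (n + 1) hss]

/-- The history up to iteration `n` is independent of the next sample. -/
theorem indepFun_history (h : Assumptions 𝒟 f σ σhat β) (hs : IsSampling μ 𝒟 ξ) (n : ℕ) :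
    IndepFun (fun ω => ((stateAt f p a₀ b₀ η x₁ ξ n ω).x, (stateAt f p a₀ b₀ η x₁ ξ n ω).dir,
      1 + (stateAt f p a₀ b₀ η x₁ ξ n ω).sumDiff / a₀ ^ 2,
      (stateAt f p a₀ b₀ η x₁ ξ (n + 1) ω).x, ξ (n + 1) ω)) (ξ (n + 2)) μ := by
  obtain ⟨h1, h2, h3, h4⟩ := measurable_run (stochGrad f) p a₀ b₀ η x₁ h.measurable_grad (n + 1)
  have h5 := (measurable_run (stochGrad f) p a₀ b₀ η x₁ h.measurable_grad (n + 2)).1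
  refine indepFun_of_depends hs.measurable hs.indep (n + 1)
    (Ψ := fun s => ((run (stochGrad f) p a₀ b₀ η x₁ s (n + 1)).x,
      (run (stochGrad f) p a₀ b₀ η x₁ s (n + 1)).dir,
      1 + (run (stochGrad f) p a₀ b₀ η x₁ s (n + 1)).sumDiff / a₀ ^ 2,
      (run (stochGrad f) p a₀ b₀ η x₁ s (n + 2)).x, s (n + 1)))
    (h1.prodMk (h2.prodMk ((measurable_const.add (h4.div_const _)).prodMk
      (h5.prodMk (measurable_pi_apply _))))) ?_
  intro s s' hss
  simp only [run_x_succ]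
  rw [run_congr (stochGrad f) p a₀ b₀ η x₁ (n + 1) hss, hss (n + 1) le_rfl]

variable [IsProbabilityMeasure μ]

/-- The bounds are assumed at each fixed x and only for almost all samples, so at a random iterate
they require independence. This is used twice: x_n is independent of its own sample, and the pair of
both is independent of the next sample. -/
theorem ae_noise_bounds (h : Assumptions 𝒟 f σ σhat β) (hβ : 0 ≤ β) (hs : IsSampling μ 𝒟 ξ)
    (n : ℕ) : ∀ᵐ ω ∂μ,
    ‖stochGrad f (stateAt f p a₀ b₀ η x₁ ξ n ω).x (ξ (n + 1) ω) -
      trueGrad 𝒟 f (stateAt f p a₀ b₀ η x₁ ξ n ω).x‖ ≤ 2 * σhat ∧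
    ‖stochGrad f (stateAt f p a₀ b₀ η x₁ ξ n ω).x (ξ (n + 2) ω) -
      trueGrad 𝒟 f (stateAt f p a₀ b₀ η x₁ ξ n ω).x‖ ≤ 2 * σhat ∧
    ‖stochGrad f (stateAt f p a₀ b₀ η x₁ ξ n ω).x (ξ (n + 1) ω) -
      stochGrad f (stateAt f p a₀ b₀ η x₁ ξ n ω).x (ξ (n + 2) ω)‖ ≤ 2 * σhat := by
  have := h.isProbabilityMeasure
  have hx := (measurable_stateAt (p := p) (a₀ := a₀) (b₀ := b₀) (η := η) (x₁ := x₁) h hs n).1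
  have hgrad := (h.continuous_trueGrad hβ).measurable
  have hi1 := indepFun_stateAt_x (p := p) (a₀ := a₀) (b₀ := b₀) (η := η) (x₁ := x₁) h hs n
  have hi2 := (indepFun_history (p := p) (a₀ := a₀) (b₀ := b₀) (η := η) (x₁ := x₁) h hs n).comp
    (φ := fun u => (u.1, u.2.2.2.2)) (ψ := id) (by fun_prop) measurable_id
  have hm1 : MeasurableSet {z : E × Ξ | ‖stochGrad f z.1 z.2 - trueGrad 𝒟 f z.1‖ ≤ 2 * σhat} :=
    measurableSet_le (h.measurable_grad.sub (hgrad.comp measurable_fst)).norm measurable_const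
  have hm2 : MeasurableSet {z : (E × Ξ) × Ξ |
      ‖stochGrad f z.1.1 z.2 - trueGrad 𝒟 f z.1.1‖ ≤ 2 * σhat ∧
      ‖stochGrad f z.1.1 z.1.2 - stochGrad f z.1.1 z.2‖ ≤ 2 * σhat} := by
    have e1 : Measurable fun z : (E × Ξ) × Ξ => stochGrad f z.1.1 z.2 :=
      h.measurable_grad.comp
        ((measurable_fst.comp measurable_fst).prodMk measurable_snd)
    have e2 : Measurable fun z : (E × Ξ) × Ξ => stochGrad f z.1.1 z.1.2 :=
      h.measurable_grad.comp measurable_fst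
    have e3 : Measurable fun z : (E × Ξ) × Ξ => trueGrad 𝒟 f z.1.1 :=
      hgrad.comp (measurable_fst.comp measurable_fst)
    exact (measurableSet_le (e1.sub e3).norm measurable_const).inter
      (measurableSet_le (e2.sub e1).norm measurable_const)
  have a1 := ae_of_forall_ae hx (hs.measurable (n + 1)) (hs.law _) hi1 hm1
    (.of_forall fun u => h.ae_noise_le u)
  -- The set of pairs (x, s) for which almost every next sample is good must be measurable before
  -- its almost sure membership can be transferred from the product law.
  have hm3 : MeasurableSet {z : E × Ξ | ∀ᵐ s ∂𝒟, (z, s) ∈ {z : (E × Ξ) × Ξ |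
      ‖stochGrad f z.1.1 z.2 - trueGrad 𝒟 f z.1.1‖ ≤ 2 * σhat ∧
      ‖stochGrad f z.1.1 z.1.2 - stochGrad f z.1.1 z.2‖ ≤ 2 * σhat}} :=
    (measurable_measure_prodMk_left (ν := 𝒟) hm2.compl) (measurableSet_singleton 0)
  have a2 := ae_of_forall_ae hx (hs.measurable (n + 1)) (hs.law _) hi1 hm3
    (.of_forall fun u => by
      filter_upwards [h.bounded_diff u] with s hs1
      filter_upwards [hs1, h.ae_noise_le u] with s' h1 h2
      exact ⟨h2, h1⟩)
  have a3 := ae_of_forall_ae (hx.prodMk (hs.measurable (n + 1))) (hs.measurable (n + 2))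
    (hs.law _) hi2 hm2 ((ae_map_iff (hx.prodMk (hs.measurable (n + 1))).aemeasurable hm3).2 a2)
  filter_upwards [a1, a3] with ω h1 h2
  exact ⟨h1, h2.1, h2.2⟩

end Construction

/-! ### A run satisfies the trajectory properties. -/

section TrajectoryRun

variable {d : ℕ} {Ξ Ω : Type*} {f : EuclideanSpace ℝ (Fin d) → Ξ → ℝ} {p a₀ b₀ η : ℝ}
  {ξ : ℕ → Ω → Ξ} {x₁ : EuclideanSpace ℝ (Fin d)}

local notation "E" => EuclideanSpace ℝ (Fin d)

theorem stateAt_x_succ (n : ℕ) (ω : Ω) :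
    (stateAt f p a₀ b₀ η x₁ ξ (n + 1) ω).x = (stateAt f p a₀ b₀ η x₁ ξ n ω).x -
      (η / ((b₀ ^ (1 / p) +
        ∑ i ∈ Finset.range (n + 1), ‖(stateAt f p a₀ b₀ η x₁ ξ i ω).dir‖ ^ 2) ^ p /
      ((1 + (stateAt f p a₀ b₀ η x₁ ξ n ω).sumDiff / a₀ ^ 2) ^ (-(2 / 3) : ℝ)) ^ ((1 - p) / 2))) •
        (stateAt f p a₀ b₀ η x₁ ξ n ω).dir := by
  rw [← stateAt_sumDir]
  rfl

variable [MeasurableSpace Ξ] {𝒟 : Measure Ξ}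

theorem stateAt_S_succ (n : ℕ) (ω : Ω) :
    1 + (stateAt f p a₀ b₀ η x₁ ξ (n + 1) ω).sumDiff / a₀ ^ 2 =
      1 + (stateAt f p a₀ b₀ η x₁ ξ n ω).sumDiff / a₀ ^ 2 +
      ‖(stochGrad f (stateAt f p a₀ b₀ η x₁ ξ n ω).x (ξ (n + 1) ω) -
          trueGrad 𝒟 f (stateAt f p a₀ b₀ η x₁ ξ n ω).x) -
        (stochGrad f (stateAt f p a₀ b₀ η x₁ ξ n ω).x (ξ (n + 2) ω) -
          trueGrad 𝒟 f (stateAt f p a₀ b₀ η x₁ ξ n ω).x)‖ ^ 2 / a₀ ^ 2 := by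
  rw [sub_sub_sub_cancel_right, add_assoc, ← add_div]
  rfl

theorem stateAt_err_succ (n : ℕ) (ω : Ω) :
    (stateAt f p a₀ b₀ η x₁ ξ (n + 1) ω).dir -
        trueGrad 𝒟 f (stateAt f p a₀ b₀ η x₁ ξ (n + 1) ω).x =
      (1 - (1 + (stateAt f p a₀ b₀ η x₁ ξ (n + 1) ω).sumDiff / a₀ ^ 2) ^ (-(2 / 3) : ℝ)) •
          ((stateAt f p a₀ b₀ η x₁ ξ n ω).dir -
            trueGrad 𝒟 f (stateAt f p a₀ b₀ η x₁ ξ n ω).x) +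
        (1 - (1 + (stateAt f p a₀ b₀ η x₁ ξ (n + 1) ω).sumDiff / a₀ ^ 2) ^ (-(2 / 3) : ℝ)) •
          ((stochGrad f (stateAt f p a₀ b₀ η x₁ ξ (n + 1) ω).x (ξ (n + 2) ω) -
              trueGrad 𝒟 f (stateAt f p a₀ b₀ η x₁ ξ (n + 1) ω).x) -
            (stochGrad f (stateAt f p a₀ b₀ η x₁ ξ n ω).x (ξ (n + 2) ω) -
              trueGrad 𝒟 f (stateAt f p a₀ b₀ η x₁ ξ n ω).x)) +
        (1 + (stateAt f p a₀ b₀ η x₁ ξ (n + 1) ω).sumDiff / a₀ ^ 2) ^ (-(2 / 3) : ℝ) •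
          (stochGrad f (stateAt f p a₀ b₀ η x₁ ξ (n + 1) ω).x (ξ (n + 2) ω) -
            trueGrad 𝒟 f (stateAt f p a₀ b₀ η x₁ ξ (n + 1) ω).x) := by
  have h := run_dir_succ (stochGrad f) p a₀ b₀ η x₁ (fun i => ξ i ω) n
  rw [show (stateAt f p a₀ b₀ η x₁ ξ (n + 1) ω).dir = _ from h]
  simp only [State.a]
  module

variable [MeasurableSpace Ω] {σ σhat β : ℝ} {μ : Measure Ω}

theorem Assumptions.integral_inner_noise (h : Assumptions 𝒟 f σ σhat β) (v x y : E) (r t : ℝ) :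
    ∫ s, inner ℝ v (r • ((stochGrad f x s - trueGrad 𝒟 f x) -
      (stochGrad f y s - trueGrad 𝒟 f y)) + t • (stochGrad f x s - trueGrad 𝒟 f x)) ∂𝒟 = 0 := by
  have i1 := h.integrable_noise x
  have i3 : Integrable (fun s => r • ((stochGrad f x s - trueGrad 𝒟 f x) -
    (stochGrad f y s - trueGrad 𝒟 f y))) 𝒟 := (i1.sub (h.integrable_noise y)).smul r
  have i4 : Integrable (fun s => t • (stochGrad f x s - trueGrad 𝒟 f x)) 𝒟 := i1.smul t
  refine (integral_inner (𝕜 := ℝ) (i3.add i4) v).trans ?_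
  simp only [Pi.add_apply]
  rw [integral_add i3 i4, integral_smul, integral_smul,
    integral_sub i1 (h.integrable_noise y), h.integral_noise, h.integral_noise]
  simp

theorem essBdd_trueGrad (h : Assumptions 𝒟 f σ σhat β) (hβ : 0 ≤ β) {X : Ω → E}
    (hX : EssBdd μ X) : EssBdd μ (fun ω => trueGrad 𝒟 f (X ω)) := by
  refine EssBdd.mono ((h.continuous_trueGrad hβ).measurable.comp hX.meas)
    ((hX.norm.const_mul β).add (EssBdd.const ‖trueGrad 𝒟 f 0‖)) (.of_forall fun ω => ?_)
  have h1 := h.norm_trueGrad_sub_le hβ (X ω) 0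
  rw [sub_zero] at h1
  have h2 := norm_sub_norm_le (trueGrad 𝒟 f (X ω)) (trueGrad 𝒟 f 0)
  linarith

variable [IsProbabilityMeasure μ]

/-- The stochastic gradients need not be bounded over the whole space, but their noise is. Starting
from a fixed x₁, every step is at most |η|/b₀ times the direction and ∇F is Lipschitz, so
boundedness propagates by induction. The bound may grow with n; it serves only integrability. -/
theorem essBdd_stateAt (h : Assumptions 𝒟 f σ σhat β) (hβ : 0 ≤ β) (hs : IsSampling μ 𝒟 ξ)
    (hp0 : 0 < p) (hp1 : p ≤ 1) (hb₀ : 0 < b₀) (n : ℕ) :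
    EssBdd μ (fun ω => (stateAt f p a₀ b₀ η x₁ ξ n ω).x) ∧
      EssBdd μ (fun ω => (stateAt f p a₀ b₀ η x₁ ξ n ω).dir) ∧
      EssBdd μ (fun ω => 1 + (stateAt f p a₀ b₀ η x₁ ξ n ω).sumDiff / a₀ ^ 2) ∧
      EssBdd μ (fun ω => stochGrad f (stateAt f p a₀ b₀ η x₁ ξ n ω).x (ξ (n + 1) ω) -
        trueGrad 𝒟 f (stateAt f p a₀ b₀ η x₁ ξ n ω).x) ∧
      EssBdd μ (fun ω => stochGrad f (stateAt f p a₀ b₀ η x₁ ξ n ω).x (ξ (n + 2) ω) -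
        trueGrad 𝒟 f (stateAt f p a₀ b₀ η x₁ ξ n ω).x) := by
  have hmeas := fun n => measurable_stateAt (p := p) (a₀ := a₀) (b₀ := b₀) (η := η) (x₁ := x₁)
    h hs n
  have hgrad := (h.continuous_trueGrad hβ).measurable
  have hnoise : ∀ n, EssBdd μ (fun ω => stochGrad f (stateAt f p a₀ b₀ η x₁ ξ n ω).x (ξ (n + 1) ω) -
        trueGrad 𝒟 f (stateAt f p a₀ b₀ η x₁ ξ n ω).x) ∧
      EssBdd μ (fun ω => stochGrad f (stateAt f p a₀ b₀ η x₁ ξ n ω).x (ξ (n + 2) ω) -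
        trueGrad 𝒟 f (stateAt f p a₀ b₀ η x₁ ξ n ω).x) := by
    intro n
    have hb := ae_noise_bounds (p := p) (a₀ := a₀) (b₀ := b₀) (η := η) (x₁ := x₁) h hβ hs n
    have hx := (hmeas n).1
    exact ⟨⟨(h.measurable_grad.comp (hx.prodMk (hs.measurable _))).sub (hgrad.comp hx), _,
      hb.mono fun ω h => h.1⟩,
      ⟨(h.measurable_grad.comp (hx.prodMk (hs.measurable _))).sub (hgrad.comp hx), _,
      hb.mono fun ω h => h.2.1⟩⟩
  suffices hmain : EssBdd μ (fun ω => (stateAt f p a₀ b₀ η x₁ ξ n ω).x) ∧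
      EssBdd μ (fun ω => (stateAt f p a₀ b₀ η x₁ ξ n ω).dir) ∧
      EssBdd μ (fun ω => 1 + (stateAt f p a₀ b₀ η x₁ ξ n ω).sumDiff / a₀ ^ 2) from
    ⟨hmain.1, hmain.2.1, hmain.2.2, hnoise n⟩
  induction n with
  | zero =>
    refine ⟨EssBdd.const x₁, ?_, by simpa [stateAt, run] using EssBdd.const (1 : ℝ)⟩
    have h1 := (hnoise 0).1.add (EssBdd.const (trueGrad 𝒟 f x₁))
    simpa [stateAt, run] using h1
  | succ n ih =>
    obtain ⟨hx, hd, hS⟩ := ih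
    have hx' : EssBdd μ (fun ω => (stateAt f p a₀ b₀ η x₁ ξ (n + 1) ω).x) := by
      refine EssBdd.mono (hmeas (n + 1)).1 (hx.norm.add (hd.norm.const_mul (|η| / b₀)))
        (.of_forall fun ω => ?_)
      rw [stateAt_x_succ]
      refine (norm_sub_le _ _).trans (add_le_add_right ?_ _)
      rw [norm_smul]
      gcongr
      rw [norm_div, Real.norm_eq_abs]
      have h1 := one_le_stateAt_S (f := f) (p := p) (a₀ := a₀) (b₀ := b₀) (η := η) (x₁ := x₁)
        (ξ := ξ) n ω
      have h2 := le_stepDenominator hp0 hp1 hb₀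
        (Finset.sum_nonneg fun i (_ : i ∈ Finset.range (n + 1)) =>
          sq_nonneg ‖(stateAt f p a₀ b₀ η x₁ ξ i ω).dir‖)
        (Real.rpow_pos_of_pos (zero_lt_one.trans_le h1) _)
        (Real.rpow_le_one_of_one_le_of_nonpos h1 (show (-(2 / 3) : ℝ) ≤ 0 by norm_num))
      gcongr
      exact h2.trans (le_abs_self _)
    have hS' : EssBdd μ (fun ω => 1 + (stateAt f p a₀ b₀ η x₁ ξ (n + 1) ω).sumDiff / a₀ ^ 2) := by
      simp_rw [stateAt_S_succ (𝒟 := 𝒟) n, div_eq_inv_mul _ (a₀ ^ 2)]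
      simp_rw [div_eq_inv_mul] at hS
      exact hS.add (((hnoise n).1.sub (hnoise n).2).norm.sq.const_mul _)
    refine ⟨hx', ?_, hS'⟩
    have hg := essBdd_trueGrad h hβ hx
    have hg' := essBdd_trueGrad h hβ hx'
    have ha := hS'.rpow_of_one_le (fun ω => one_le_stateAt_S (n + 1) ω) (-(2 / 3) : ℝ)
    have ha' := (EssBdd.const (μ := μ) (1 : ℝ)).sub ha
    -- The new direction is recovered as error plus ∇F, since the error recursion contains only
    -- quantities already known to be bounded.
    have h1 := (((ha'.smul (hd.sub hg)).add (ha'.smul ((hnoise (n + 1)).1.sub (hnoise n).2))).add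
      (ha.smul (hnoise (n + 1)).1)).add hg'
    simp_rw [← stateAt_err_succ] at h1
    simpa using h1

/-- A run of META-STORM is a trajectory. -/
theorem trajectory_run (h : Assumptions 𝒟 f σ σhat β) (hβ : 0 ≤ β) (hs : IsSampling μ 𝒟 ξ)
    (hp0 : 0 < p) (hp1 : p ≤ 1) (hb₀ : 0 < b₀) :
    Trajectory μ σ σhat β p a₀ b₀ η (initialGap 𝒟 f x₁) (objective 𝒟 f)
      (fun n ω => (stateAt f p a₀ b₀ η x₁ ξ n ω).x)
      (fun n ω => (stateAt f p a₀ b₀ η x₁ ξ n ω).dir)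
      (fun n ω => trueGrad 𝒟 f (stateAt f p a₀ b₀ η x₁ ξ n ω).x)
      (fun n ω => stochGrad f (stateAt f p a₀ b₀ η x₁ ξ n ω).x (ξ (n + 1) ω) -
        trueGrad 𝒟 f (stateAt f p a₀ b₀ η x₁ ξ n ω).x)
      (fun n ω => stochGrad f (stateAt f p a₀ b₀ η x₁ ξ n ω).x (ξ (n + 2) ω) -
        trueGrad 𝒟 f (stateAt f p a₀ b₀ η x₁ ξ n ω).x)
      (fun n ω => 1 + (stateAt f p a₀ b₀ η x₁ ξ n ω).sumDiff / a₀ ^ 2) := by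
  have := h.isProbabilityMeasure
  have hb := fun n => essBdd_stateAt (a₀ := a₀) (η := η) (x₁ := x₁) h hβ hs hp0 hp1 hb₀ n
  have hgrad := (h.continuous_trueGrad hβ).measurable
  have hg := fun n => essBdd_trueGrad h hβ (hb n).1
  have hist := fun n => indepFun_history (p := p) (a₀ := a₀) (b₀ := b₀) (η := η) (x₁ := x₁) h hs n
  have hmeas := fun n => measurable_stateAt (p := p) (a₀ := a₀) (b₀ := b₀) (η := η) (x₁ := x₁)
    h hs n
  have hH : ∀ n, Measurable (fun ω => ((stateAt f p a₀ b₀ η x₁ ξ n ω).x,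
      (stateAt f p a₀ b₀ η x₁ ξ n ω).dir, 1 + (stateAt f p a₀ b₀ η x₁ ξ n ω).sumDiff / a₀ ^ 2,
      (stateAt f p a₀ b₀ η x₁ ξ (n + 1) ω).x, ξ (n + 1) ω)) := fun n =>
    (hmeas n).1.prodMk ((hmeas n).2.1.prodMk ((measurable_const.add
      ((hmeas n).2.2.2.div_const _)).prodMk ((hmeas (n + 1)).1.prodMk (hs.measurable (n + 1)))))
  have gx : Measurable fun z : (E × E × ℝ × E × Ξ) × Ξ => stochGrad f z.1.1 z.2 :=
    h.measurable_grad.comp ((by fun_prop : Measurable fun z : (E × E × ℝ × E × Ξ) × Ξ =>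
      (z.1.1, z.2)))
  have gx' : Measurable fun z : (E × E × ℝ × E × Ξ) × Ξ => stochGrad f z.1.2.2.2.1 z.2 :=
    h.measurable_grad.comp ((by fun_prop : Measurable fun z : (E × E × ℝ × E × Ξ) × Ξ =>
      (z.1.2.2.2.1, z.2)))
  have gs : Measurable fun u : E × E × ℝ × E × Ξ => stochGrad f u.1 u.2.2.2.2 :=
    h.measurable_grad.comp ((by fun_prop : Measurable fun u : E × E × ℝ × E × Ξ =>
      (u.1, u.2.2.2.2)))
  have gs' : Measurable fun z : (E × E × ℝ × E × Ξ) × Ξ => stochGrad f z.1.1 z.1.2.2.2.2 :=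
    gs.comp measurable_fst
  have ha := fun n => (hb n).2.2.1.rpow_of_one_le (fun ω => one_le_stateAt_S n ω) (-(2 / 3) : ℝ)
  have ha' := fun n => (EssBdd.const (μ := μ) (1 : ℝ)).sub (ha n)
  have hν := fun n => (hb n).2.2.2.1
  have hν' := fun n => (hb n).2.2.2.2
  have hv : ∀ n, ∫ ω, ‖stochGrad f (stateAt f p a₀ b₀ η x₁ ξ n ω).x (ξ (n + 1) ω) -
      trueGrad 𝒟 f (stateAt f p a₀ b₀ η x₁ ξ n ω).x‖ ^ 2 ∂μ ≤ σ ^ 2 := by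
    intro n
    have key := integral_pair_le (hmeas n).1 (hs.measurable (n + 1)) (hs.law _)
      (indepFun_stateAt_x h hs n)
      (Φ := fun z : E × Ξ => ‖stochGrad f z.1 z.2 - trueGrad 𝒟 f z.1‖ ^ 2)
      ((h.measurable_grad.sub (hgrad.comp measurable_fst)).norm.pow_const 2)
      (hν n).norm.sq.integrable (Ψ := fun _ => σ ^ 2) measurable_const (integrable_const _)
      h.variance_le
    simpa using key
  exact
  { bdd_x := fun n => (hb n).1
    bdd_dir := fun n => (hb n).2.1
    bdd_grad := hg
    bdd_ν := fun n => (hb n).2.2.2.1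
    bdd_ν' := fun n => (hb n).2.2.2.2
    bdd_S := fun n => (hb n).2.2.1
    S_zero := fun ω => by simp [stateAt, run]
    S_succ := fun n ω => stateAt_S_succ n ω
    noise_le := by
      rw [ae_all_iff]
      intro n
      filter_upwards [ae_noise_bounds (p := p) (a₀ := a₀) (b₀ := b₀) (η := η) (x₁ := x₁)
        h hβ hs n] with ω hω
      rwa [sub_sub_sub_cancel_right]
    err_zero := fun ω => by simp [stateAt, run]
    err_succ := fun n ω => stateAt_err_succ n ω
    x_succ := fun n ω => stateAt_x_succ n ω
    descent := fun n ω => h.objective_le hβ _ _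
    gap := fun n ω => by
      have := ciInf_le h.bddBelow (stateAt f p a₀ b₀ η x₁ ξ n ω).x
      unfold initialGap
      simp only [stateAt, run] at this ⊢
      linarith
    cross := by
      intro n φ hφ hφb
      refine integral_pair_eq_zero (hH n) (hs.measurable (n + 2)) (hs.law _) (hist n)
        (Φ := fun z => φ z.1.2.2.1 * inner ℝ (z.1.2.1 - trueGrad 𝒟 f z.1.1)
          ((1 - z.1.2.2.1 ^ (-(2 / 3) : ℝ)) •
            ((stochGrad f z.1.2.2.2.1 z.2 - trueGrad 𝒟 f z.1.2.2.2.1) -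
              (stochGrad f z.1.1 z.2 - trueGrad 𝒟 f z.1.1)) +
            z.1.2.2.1 ^ (-(2 / 3) : ℝ) •
              (stochGrad f z.1.2.2.2.1 z.2 - trueGrad 𝒟 f z.1.2.2.2.1))) ?_ ?_ ?_
      · fun_prop
      · exact (hφb.mul (((hb n).2.1.sub (hg n)).inner (((ha' n).smul
          ((hν (n + 1)).sub (hν' n))).add ((ha n).smul (hν (n + 1)))))).integrable
      · intro u
        dsimp only
        rw [integral_const_mul, h.integral_inner_noise, mul_zero]
    increment := by
      intro n φ hφ hφb hφ0
      refine integral_pair_le (hH n) (hs.measurable (n + 2)) (hs.law _) (hist n)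
        (Φ := fun z => φ z.1.2.2.1 *
          ‖(stochGrad f z.1.2.2.2.1 z.2 - trueGrad 𝒟 f z.1.2.2.2.1) -
              (stochGrad f z.1.1 z.2 - trueGrad 𝒟 f z.1.1)‖ ^ 2) ?_ ?_
        (Ψ := fun u => φ u.2.2.1 * (β ^ 2 * ‖u.2.2.2.1 - u.1‖ ^ 2)) ?_ ?_ ?_
      · fun_prop
      · exact (hφb.mul ((hν (n + 1)).sub (hν' n)).norm.sq).integrable
      · fun_prop
      · exact (hφb.mul (((hb (n + 1)).1.sub (hb n).1).norm.sq.const_mul (β ^ 2))).integrable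
      · intro u
        dsimp only
        rw [integral_const_mul]
        exact mul_le_mul_of_nonneg_left (h.integral_noise_sub_sq_le _ _) (hφ0 _)
    noise_swap := by
      intro n φ hφ hφb hφ0
      -- The inequality is applied to the negatives, because here the integral over the fresh sample
      -- is bounded from below.
      have key := integral_pair_le (hH n) (hs.measurable (n + 2)) (hs.law _) (hist n)
        (Φ := fun z => -(φ z.1.2.2.1 *
          ‖(stochGrad f z.1.1 z.1.2.2.2.2 - trueGrad 𝒟 f z.1.1) -
              (stochGrad f z.1.1 z.2 - trueGrad 𝒟 f z.1.1)‖ ^ 2)) ?_ ?_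
        (Ψ := fun u => -(φ u.2.2.1 * ‖stochGrad f u.1 u.2.2.2.2 - trueGrad 𝒟 f u.1‖ ^ 2)) ?_ ?_ ?_
      · simp only [integral_neg, neg_le_neg_iff] at key
        exact key
      · fun_prop
      · exact (hφb.mul ((hν n).sub (hν' n)).norm.sq).integrable.neg
      · fun_prop
      · exact (hφb.mul (hν n).norm.sq).integrable.neg
      · intro u
        simp only [sub_sub_sub_cancel_right]
        rw [integral_neg, integral_const_mul, h.integral_sub_sample_sq, neg_le_neg_iff]
        refine mul_le_mul_of_nonneg_left ?_ (hφ0 _)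
        exact le_add_of_nonneg_right (integral_nonneg fun _ => sq_nonneg _)
    variance_zero := by
      have := (hv 0)
      exact this
    variance := by
      intro n
      have key := integral_pair_le (hH n) (hs.measurable (n + 2)) (hs.law _) (hist n)
        (Φ := fun z =>
          ‖(stochGrad f z.1.1 z.1.2.2.2.2 - trueGrad 𝒟 f z.1.1) -
              (stochGrad f z.1.1 z.2 - trueGrad 𝒟 f z.1.1)‖ ^ 2) ?_ ?_
        (Ψ := fun u => ‖stochGrad f u.1 u.2.2.2.2 - trueGrad 𝒟 f u.1‖ ^ 2 + σ ^ 2) ?_ ?_ ?_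
      · refine key.trans ?_
        rw [integral_add (hν n).norm.sq.integrable (integrable_const _)]
        have := hv n
        simp only [integral_const, probReal_univ, one_smul]
        linarith
      · fun_prop
      · exact ((hν n).sub (hν' n)).norm.sq.integrable
      · fun_prop
      · exact (hν n).norm.sq.integrable.add (integrable_const _)
      · intro u
        simp only [sub_sub_sub_cancel_right]
        rw [h.integral_sub_sample_sq]
        exact add_le_add_right (h.variance_le _) _ }

end TrajectoryRun

/-! ### Pathwise summation of the error recursion. -/

section Recursion

theorem sum_recursion_le {u gain cost : ℕ → ℝ} {N : ℕ}
    (h : ∀ n < N, u (n + 1) + gain n ≤ u n + cost n) :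
    u N + ∑ n ∈ Finset.range N, gain n ≤ u 0 + ∑ n ∈ Finset.range N, cost n := by
  induction N with
  | zero => simp
  | succ N ih =>
    rw [Finset.sum_range_succ, Finset.sum_range_succ]
    have h1 := ih fun n hn => h n (by omega)
    have h2 := h N (by omega)
    linarith

end Recursion

namespace Trajectory

variable {d : ℕ} {Ω : Type*} [MeasurableSpace Ω] {μ : Measure Ω}
  {σ σhat β p a₀ b₀ η Δ : ℝ} {F : EuclideanSpace ℝ (Fin d) → ℝ}
  {x dir grad ν ν' : ℕ → Ω → EuclideanSpace ℝ (Fin d)} {S : ℕ → Ω → ℝ}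

theorem S_le_succ (h : Trajectory μ σ σhat β p a₀ b₀ η Δ F x dir grad ν ν' S) (n : ℕ) (ω : Ω) :
    S n ω ≤ S (n + 1) ω := by
  rw [h.S_succ]
  have : 0 ≤ ‖ν n ω - ν' n ω‖ ^ 2 / a₀ ^ 2 := by positivity
  linarith

theorem monotone_S (h : Trajectory μ σ σhat β p a₀ b₀ η Δ F x dir grad ν ν' S) (ω : Ω) :
    Monotone fun n => S n ω := monotone_nat_of_le_succ fun n => h.S_le_succ n ω

theorem one_le_S (h : Trajectory μ σ σhat β p a₀ b₀ η Δ F x dir grad ν ν' S) (n : ℕ) (ω : Ω) :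
    1 ≤ S n ω := by
  rw [← h.S_zero ω]
  exact h.monotone_S ω (Nat.zero_le n)

theorem ae_S_step (h : Trajectory μ σ σhat β p a₀ b₀ η Δ F x dir grad ν ν' S) :
    ∀ᵐ ω ∂μ, ∀ n, S (n + 1) ω - S n ω ≤ 4 * σhat ^ 2 / a₀ ^ 2 := by
  filter_upwards [h.noise_le] with ω hω n
  rw [h.S_succ, add_sub_cancel_left]
  gcongr
  calc ‖ν n ω - ν' n ω‖ ^ 2 ≤ (2 * σhat) ^ 2 := pow_le_pow_left₀ (norm_nonneg _) (hω n).2.2 2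
    _ = _ := by ring

theorem essBdd_rpow (h : Trajectory μ σ σhat β p a₀ b₀ η Δ F x dir grad ν ν' S) (n : ℕ) (r : ℝ) :
    EssBdd μ (fun ω => S n ω ^ r) := (h.bdd_S n).rpow_of_one_le (h.one_le_S n) r

theorem essBdd_err (h : Trajectory μ σ σhat β p a₀ b₀ η Δ F x dir grad ν ν' S) (n : ℕ) :
    EssBdd μ (fun ω => dir n ω - grad n ω) := (h.bdd_dir n).sub (h.bdd_grad n)

theorem essBdd_incr (h : Trajectory μ σ σhat β p a₀ b₀ η Δ F x dir grad ν ν' S) (n : ℕ) :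
    EssBdd μ (fun ω => ν (n + 1) ω - ν' n ω) := (h.bdd_ν (n + 1)).sub (h.bdd_ν' n)

theorem essBdd_cross (h : Trajectory μ σ σhat β p a₀ b₀ η Δ F x dir grad ν ν' S) (n : ℕ) :
    EssBdd μ (fun ω => inner ℝ (dir n ω - grad n ω)
      ((1 - S n ω ^ (-(2 / 3) : ℝ)) • (ν (n + 1) ω - ν' n ω) +
        S n ω ^ (-(2 / 3) : ℝ) • ν (n + 1) ω)) :=
  (h.essBdd_err n).inner ((((EssBdd.const 1).sub (h.essBdd_rpow n _)).smul (h.essBdd_incr n)).add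
    ((h.essBdd_rpow n _).smul (h.bdd_ν (n + 1))))

theorem essBdd_sqStep (h : Trajectory μ σ σhat β p a₀ b₀ η Δ F x dir grad ν ν' S) (n : ℕ) :
    EssBdd μ (fun ω => ‖x (n + 1) ω - x n ω‖ ^ 2) := ((h.bdd_x (n + 1)).sub (h.bdd_x n)).norm.sq

theorem essBdd_S_sub (h : Trajectory μ σ σhat β p a₀ b₀ η Δ F x dir grad ν ν' S) (n : ℕ) :
    EssBdd μ (fun ω => S (n + 1) ω - S n ω) := (h.bdd_S (n + 1)).sub (h.bdd_S n)

theorem abs_rpow_S (h : Trajectory μ σ σhat β p a₀ b₀ η Δ F x dir grad ν ν' S) (n : ℕ) (ω : Ω)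
    (r : ℝ) : |S n ω ^ r| = S n ω ^ r :=
  abs_of_nonneg (Real.rpow_nonneg (zero_le_one.trans (h.one_le_S n ω)) r)

theorem integral_increment_le (h : Trajectory μ σ σhat β p a₀ b₀ η Δ F x dir grad ν ν' S) (n : ℕ)
    (r : ℝ) : ∫ ω, S n ω ^ r * ‖ν (n + 1) ω - ν' n ω‖ ^ 2 ∂μ ≤
      β ^ 2 * ∫ ω, S n ω ^ r * ‖x (n + 1) ω - x n ω‖ ^ 2 ∂μ := by
  -- The field demands φ ≥ 0 on all of ℝ. The absolute value ensures this and changes nothing for S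
  -- ≥ 1.
  have key := h.increment n (fun u => |u ^ r|) (by fun_prop)
    (by simpa only [h.abs_rpow_S] using h.essBdd_rpow n r) (fun _ => abs_nonneg _)
  simp only [h.abs_rpow_S] at key
  refine key.trans (le_of_eq ?_)
  rw [← integral_const_mul]
  congr 1; funext ω; ring

/-- Turns noise into increments of S, so that sums of weighted noise become the lagged sums
estimated above, with no logarithmic loss beyond that of S itself. -/
theorem integral_noise_le (h : Trajectory μ σ σhat β p a₀ b₀ η Δ F x dir grad ν ν' S)
    (ha₀ : 0 < a₀) (n : ℕ) (r : ℝ) : ∫ ω, S n ω ^ r * ‖ν n ω‖ ^ 2 ∂μ ≤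
      a₀ ^ 2 * ∫ ω, S n ω ^ r * (S (n + 1) ω - S n ω) ∂μ := by
  have key := h.noise_swap n (fun u => |u ^ r|) (by fun_prop)
    (by simpa only [h.abs_rpow_S] using h.essBdd_rpow n r) (fun _ => abs_nonneg _)
  simp only [h.abs_rpow_S] at key
  refine key.trans (le_of_eq ?_)
  rw [← integral_const_mul]
  congr 1; funext ω
  rw [h.S_succ, add_sub_cancel_left]
  field_simp

theorem integral_cross_eq_zero (h : Trajectory μ σ σhat β p a₀ b₀ η Δ F x dir grad ν ν' S) (n : ℕ)
    (r : ℝ) : ∫ ω, 2 * (S n ω ^ r * (1 - S n ω ^ (-(2 / 3) : ℝ))) *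
      inner ℝ (dir n ω - grad n ω) ((1 - S n ω ^ (-(2 / 3) : ℝ)) • (ν (n + 1) ω - ν' n ω) +
        S n ω ^ (-(2 / 3) : ℝ) • ν (n + 1) ω) ∂μ = 0 :=
  h.cross n (fun u => 2 * (u ^ r * (1 - u ^ (-(2 / 3) : ℝ)))) (by fun_prop)
    (((h.essBdd_rpow n r).mul ((EssBdd.const 1).sub (h.essBdd_rpow n _))).const_mul 2)

/-- Pointwise bound on the error sum, unweighted version. -/
theorem ae_sum_err_le (h : Trajectory μ σ σhat β p a₀ b₀ η Δ F x dir grad ν ν' S) (M : ℕ) :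
    ∀ᵐ ω ∂μ, ∑ n ∈ Finset.range (M + 1),
        S (n + 1) ω ^ (-(2 / 3) : ℝ) * ‖dir n ω - grad n ω‖ ^ 2 ≤
      2 * (‖ν 0 ω‖ ^ 2 + 48 * (4 * σhat ^ 2 / a₀ ^ 2) ^ (2 / 3 : ℝ) * σhat ^ 2 +
        ∑ n ∈ Finset.range M,
          ((2 + 3 / 2 * (4 * σhat ^ 2 / a₀ ^ 2) ^ (2 / 3 : ℝ)) *
            (S n ω ^ (0 : ℝ) * ‖ν (n + 1) ω - ν' n ω‖ ^ 2) +
          2 * (S (n + 1) ω ^ (-(4 / 3) : ℝ) * ‖ν (n + 1) ω‖ ^ 2) +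
          2 * (S n ω ^ (0 : ℝ) * (1 - S n ω ^ (-(2 / 3) : ℝ))) * inner ℝ (dir n ω - grad n ω)
            ((1 - S n ω ^ (-(2 / 3) : ℝ)) • (ν (n + 1) ω - ν' n ω) +
              S n ω ^ (-(2 / 3) : ℝ) • ν (n + 1) ω))) := by
  filter_upwards [h.noise_le, h.ae_S_step] with ω hω hstep
  set δ := 4 * σhat ^ 2 / a₀ ^ 2 with hδ
  have hδ0 : 0 ≤ δ := by positivity
  have hD : 0 ≤ δ ^ (2 / 3 : ℝ) := Real.rpow_nonneg hδ0 _
  have hS1 := fun n => h.one_le_S n ω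
  have ha0 : ∀ n, 0 ≤ S n ω ^ (-(2 / 3) : ℝ) := fun n =>
    Real.rpow_nonneg (zero_le_one.trans (hS1 n)) _
  have ha1 : ∀ n, S n ω ^ (-(2 / 3) : ℝ) ≤ 1 := fun n =>
    Real.rpow_le_one_of_one_le_of_nonpos (hS1 n) (by norm_num)
  have haa : ∀ n, S (n + 1) ω ^ (-(2 / 3) : ℝ) ≤ S n ω ^ (-(2 / 3) : ℝ) := fun n =>
    Real.rpow_le_rpow_of_nonpos (by linarith [hS1 n]) (h.S_le_succ n ω) (by norm_num)
  have haD : ∀ n, S n ω ^ (-(2 / 3) : ℝ) - S (n + 1) ω ^ (-(2 / 3) : ℝ) ≤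
      δ ^ (2 / 3 : ℝ) * S (n + 1) ω ^ (-(2 / 3) : ℝ) := fun n =>
    rpow_neg_sub_le_mul (hS1 n) hδ0 (h.S_le_succ n ω) (hstep n) (by norm_num) (by norm_num)
  have hrec := sum_recursion_le (N := M) (u := fun n => ‖dir n ω - grad n ω‖ ^ 2)
    (gain := fun n => S (n + 1) ω ^ (-(2 / 3) : ℝ) / 2 * ‖dir n ω - grad n ω‖ ^ 2)
    (cost := fun n => ((2 + 3 / 2 * δ ^ (2 / 3 : ℝ)) *
            (S n ω ^ (0 : ℝ) * ‖ν (n + 1) ω - ν' n ω‖ ^ 2) +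
          2 * (S (n + 1) ω ^ (-(4 / 3) : ℝ) * ‖ν (n + 1) ω‖ ^ 2) +
          2 * (S n ω ^ (0 : ℝ) * (1 - S n ω ^ (-(2 / 3) : ℝ))) * inner ℝ (dir n ω - grad n ω)
            ((1 - S n ω ^ (-(2 / 3) : ℝ)) • (ν (n + 1) ω - ν' n ω) +
              S n ω ^ (-(2 / 3) : ℝ) • ν (n + 1) ω)) +
      48 * δ ^ (2 / 3 : ℝ) * σhat ^ 2 *
        (S n ω ^ (-(2 / 3) : ℝ) - S (n + 1) ω ^ (-(2 / 3) : ℝ)))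
    (fun n _ => by
      have h1 := unweighted_error_step (dir n ω - grad n ω) (ν (n + 1) ω - ν' n ω) (ν (n + 1) ω)
        (ha0 (n + 1)) (haa n) (ha1 n) hD (haD n) (hω (n + 1)).1
        (by rw [sub_sub_cancel]; exact (hω n).2.1)
      rw [← h.err_succ] at h1
      have e1 : (S (n + 1) ω ^ (-(2 / 3) : ℝ)) ^ 2 = S (n + 1) ω ^ (-(4 / 3) : ℝ) := by
        rw [← Real.rpow_natCast, ← Real.rpow_mul (zero_le_one.trans (hS1 _))]; norm_num
      rw [e1] at h1
      simp only [Real.rpow_zero, one_mul]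
      linarith)
  -- The last error is handled by the same inequality with zero increment and zero noise. Hence M +
  -- 1 errors cost only M noise terms, and no S beyond index M + 1 occurs; this is why the final
  -- bounds contain s_T and not a later value.
  have hlast := unweighted_error_step (dir M ω - grad M ω) 0 0 (s := 2 * σhat)
        (ha0 (M + 1)) (haa M) (ha1 M) hD (haD M) (by simpa using (norm_nonneg _).trans (hω 0).1)
        (by simpa using (norm_nonneg _).trans (hω 0).1)
  simp only [smul_zero, add_zero, norm_zero, inner_zero_right, mul_zero, ne_eq,
    OfNat.ofNat_ne_zero, not_false_eq_true, zero_pow] at hlast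
  rw [Finset.sum_add_distrib, ← Finset.mul_sum,
    Finset.sum_range_sub' (fun n => S n ω ^ (-(2 / 3) : ℝ)), h.err_zero, h.S_zero,
    Real.one_rpow] at hrec
  have e2 : ∑ n ∈ Finset.range (M + 1), S (n + 1) ω ^ (-(2 / 3) : ℝ) * ‖dir n ω - grad n ω‖ ^ 2 =
      2 * (∑ n ∈ Finset.range M, S (n + 1) ω ^ (-(2 / 3) : ℝ) / 2 * ‖dir n ω - grad n ω‖ ^ 2 +
        S (M + 1) ω ^ (-(2 / 3) : ℝ) / 2 * ‖dir M ω - grad M ω‖ ^ 2) := by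
    rw [Finset.sum_range_succ, mul_add, Finset.mul_sum]
    congr 1
    · exact Finset.sum_congr rfl fun n _ => by ring
    · ring
  rw [e2]
  have h5 : 0 ≤ 48 * δ ^ (2 / 3 : ℝ) * σhat ^ 2 * S (M + 1) ω ^ (-(2 / 3) : ℝ) :=
    mul_nonneg (by positivity) (ha0 _)
  have h6 := sq_nonneg ‖(1 - S (M + 1) ω ^ (-(2 / 3) : ℝ)) • (dir M ω - grad M ω)‖
  linarith

/-- Pointwise bound on the error sum with the weights `S ^ r`. -/
theorem ae_sum_weighted_err_le (h : Trajectory μ σ σhat β p a₀ b₀ η Δ F x dir grad ν ν' S)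
    {r : ℝ} (hr : 1 / 3 ≤ r) (hr' : r ≤ 2 / 3) (M : ℕ) :
    ∀ᵐ ω ∂μ, ∑ n ∈ Finset.range (M + 1),
        S (n + 1) ω ^ (r - 2 / 3) * ‖dir n ω - grad n ω‖ ^ 2 ≤
      3 * (‖ν 0 ω‖ ^ 2 + 90 * σhat ^ 2 * (1 + (4 * σhat ^ 2 / a₀ ^ 2) ^ r) +
        2 * (4 * σhat ^ 2 / a₀ ^ 2 * (max 1 (27 * (4 * σhat ^ 2 / a₀ ^ 2) ^ 3) +
          4 * σhat ^ 2 / a₀ ^ 2) ^ (r - 1 / 3)) * ∑ n ∈ Finset.range (M + 1),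
            S (n + 1) ω ^ (-(2 / 3) : ℝ) * ‖dir n ω - grad n ω‖ ^ 2 +
        ∑ n ∈ Finset.range M,
          (5 * ((S n ω ^ r + (4 * σhat ^ 2 / a₀ ^ 2) ^ r) * ‖ν (n + 1) ω - ν' n ω‖ ^ 2) +
          2 * (S (n + 1) ω ^ (r - 4 / 3) * ‖ν (n + 1) ω‖ ^ 2) +
          2 * (S n ω ^ r * (1 - S n ω ^ (-(2 / 3) : ℝ))) * inner ℝ (dir n ω - grad n ω)
            ((1 - S n ω ^ (-(2 / 3) : ℝ)) • (ν (n + 1) ω - ν' n ω) +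
              S n ω ^ (-(2 / 3) : ℝ) • ν (n + 1) ω))) := by
  filter_upwards [h.noise_le, h.ae_S_step] with ω hω hstep
  set δ := 4 * σhat ^ 2 / a₀ ^ 2 with hδ
  have hδ0 : 0 ≤ δ := by positivity
  set P := δ * (max 1 (27 * δ ^ 3) + δ) ^ (r - 1 / 3) with hP
  have hS1 := fun n => h.one_le_S n ω
  have hS0 := fun n => zero_lt_one.trans_le (hS1 n)
  have ha0 : ∀ n, 0 ≤ S n ω ^ (-(2 / 3) : ℝ) := fun n => Real.rpow_nonneg (hS0 n).le _
  have ha1 : ∀ n, S n ω ^ (-(2 / 3) : ℝ) ≤ 1 := fun n =>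
    Real.rpow_le_one_of_one_le_of_nonpos (hS1 n) (by norm_num)
  have haa : ∀ n, S (n + 1) ω ^ (-(2 / 3) : ℝ) ≤ S n ω ^ (-(2 / 3) : ℝ) := fun n =>
    Real.rpow_le_rpow_of_nonpos (hS0 n) (h.S_le_succ n ω) (by norm_num)
  have hW0 : ∀ n, 0 ≤ S n ω ^ r := fun n => Real.rpow_nonneg (hS0 n).le _
  have hWW : ∀ n, S n ω ^ r ≤ S (n + 1) ω ^ r := fun n =>
    Real.rpow_le_rpow (hS0 n).le (h.S_le_succ n ω) (by linarith)
  have hρ0 : ∀ n, 0 ≤ 1 - S n ω / S (n + 1) ω := fun n => by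
    rw [sub_nonneg, div_le_one (hS0 (n + 1))]; exact h.S_le_succ n ω
  have hρ1 : ∀ n, 1 - S n ω / S (n + 1) ω ≤ 1 := fun n => by
    have := div_pos (hS0 n) (hS0 (n + 1)); linarith
  have haρ := fun n => rpow_neg_sub_rpow_neg_le (r := 2 / 3) (hS0 n) (h.S_le_succ n ω)
    (by norm_num)
  have hWρ := fun n => rpow_sub_rpow_le (r := r) (hS0 n) (h.S_le_succ n ω) (by linarith)
  have e3 : ∀ n, S n ω ^ r * S n ω ^ (-(2 / 3) : ℝ) = S n ω ^ (r - 2 / 3) := fun n => by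
    rw [← Real.rpow_add (hS0 n)]; rfl
  -- Of the gain W'a'‖e‖², the loss 2W'ρ‖e‖² takes at most two thirds, up to 2P a'‖e‖², which is
  -- left to the unweighted estimate. The remaining third explains the factor 3 in the conclusion.
  have hgrow : ∀ n, S (n + 1) ω ^ r * (1 - S n ω / S (n + 1) ω) ≤
      S (n + 1) ω ^ (r - 2 / 3) / 3 + P * S (n + 1) ω ^ (-(2 / 3) : ℝ) := fun n => by
    have h1 := weight_growth_le (hS1 n) hδ0 (h.S_le_succ n ω) (hstep n) hr
    rw [← e3 (n + 1)]
    linarith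
  -- In front of the noise increment the weight must be known before the fresh sample, so S (n+1) ^
  -- r is replaced by S n ^ r + δ ^ r.
  have hW' : ∀ n, S (n + 1) ω ^ r ≤ S n ω ^ r + δ ^ r := fun n =>
    rpow_le_rpow_add (hS0 n) hδ0 (h.S_le_succ n ω) (hstep n) (by linarith) (by linarith)
  set c := fun n => 5 * ((S n ω ^ r + δ ^ r) * ‖ν (n + 1) ω - ν' n ω‖ ^ 2) +
          2 * (S (n + 1) ω ^ (r - 4 / 3) * ‖ν (n + 1) ω‖ ^ 2) +
          2 * (S n ω ^ r * (1 - S n ω ^ (-(2 / 3) : ℝ))) * inner ℝ (dir n ω - grad n ω)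
            ((1 - S n ω ^ (-(2 / 3) : ℝ)) • (ν (n + 1) ω - ν' n ω) +
              S n ω ^ (-(2 / 3) : ℝ) • ν (n + 1) ω) with hc
  have hrec := sum_recursion_le (N := M) (u := fun n => S n ω ^ r * ‖dir n ω - grad n ω‖ ^ 2)
    (gain := fun n => S (n + 1) ω ^ (r - 2 / 3) * ‖dir n ω - grad n ω‖ ^ 2 / 3)
    (cost := fun n => c n + 60 * σhat ^ 2 * (S (n + 1) ω ^ r * (1 - S n ω / S (n + 1) ω) *
        (S n ω ^ (-(2 / 3) : ℝ)) ^ 2) +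
        2 * P * (S (n + 1) ω ^ (-(2 / 3) : ℝ) * ‖dir n ω - grad n ω‖ ^ 2))
    (fun n _ => by
      have h1 := weighted_error_step (dir n ω - grad n ω) (ν (n + 1) ω - ν' n ω) (ν (n + 1) ω)
        (ha0 (n + 1)) (haa n) (ha1 n) (hρ0 n) (hρ1 n) (haρ n) (hW0 n) (hWW n) (hWρ n)
        (hω (n + 1)).1 (by rw [sub_sub_cancel]; exact (hω n).2.1)
      rw [← h.err_succ, e3] at h1
      have e1 : S (n + 1) ω ^ r * (S (n + 1) ω ^ (-(2 / 3) : ℝ)) ^ 2 =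
          S (n + 1) ω ^ (r - 4 / 3) := by
        rw [← Real.rpow_natCast, ← Real.rpow_mul (hS0 _).le, ← Real.rpow_add (hS0 _)]
        congr 1; norm_num; ring
      rw [e1] at h1
      have h2 := mul_le_mul_of_nonneg_right (hgrow n) (sq_nonneg ‖dir n ω - grad n ω‖)
      have h3 := mul_le_mul_of_nonneg_right (hW' n) (sq_nonneg ‖ν (n + 1) ω - ν' n ω‖)
      simp only [hc]
      linarith)
  have hs0 : 0 ≤ 2 * σhat := (norm_nonneg _).trans (hω 0).1
  have hlast := weighted_error_step (dir M ω - grad M ω) 0 0 (s := 2 * σhat)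
        (ha0 (M + 1)) (haa M) (ha1 M) (hρ0 M) (hρ1 M) (haρ M) (hW0 M) (hWW M) (hWρ M)
        (by simpa using hs0) (by simpa using hs0)
  simp only [smul_zero, add_zero, norm_zero, inner_zero_right, mul_zero, ne_eq,
    OfNat.ofNat_ne_zero, not_false_eq_true, zero_pow] at hlast
  have h2 := mul_le_mul_of_nonneg_right (hgrow M) (sq_nonneg ‖dir M ω - grad M ω‖)
  -- The one-step constant 15(2σhat)² = 60σhat², times the telescoped 3/2 (1 + δ^r), yields
  -- 90σhat²(1 + δ^r).
  have hV := sum_weight_noise_le (S := fun n => S n ω) hS1 hδ0 (h.monotone_S ω) hstep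
    (r := r) (by linarith) hr' (M + 1)
  rw [Finset.sum_range_succ] at hV
  have hV2 := mul_le_mul_of_nonneg_left hV (show 0 ≤ 60 * σhat ^ 2 by positivity)
  rw [Finset.sum_add_distrib, Finset.sum_add_distrib, ← Finset.mul_sum, ← Finset.mul_sum,
    ← Finset.sum_div, h.err_zero, h.S_zero, Real.one_rpow, one_mul] at hrec
  rw [e3] at hlast
  have h6 : 0 ≤ S (M + 1) ω ^ r *
      ‖(1 - S (M + 1) ω ^ (-(2 / 3) : ℝ)) • (dir M ω - grad M ω)‖ ^ 2 :=
    mul_nonneg (hW0 _) (sq_nonneg _)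
  rw [Finset.sum_range_succ, Finset.sum_range_succ (fun n => S (n + 1) ω ^ (-(2 / 3) : ℝ) * _)]
  linarith

variable [IsProbabilityMeasure μ]

theorem integral_S_le (h : Trajectory μ σ σhat β p a₀ b₀ η Δ F x dir grad ν ν' S) (n : ℕ) :
    ∫ ω, S n ω ∂μ ≤ 1 + 2 * σ ^ 2 * n / a₀ ^ 2 := by
  induction n with
  | zero => simp [h.S_zero]
  | succ n ih =>
    simp_rw [h.S_succ]
    have hG := ((h.bdd_ν n).sub (h.bdd_ν' n)).norm.sq
    rw [integral_add (h.bdd_S n).integrable (hG.integrable.div_const _), integral_div]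
    have h1 : (∫ ω, ‖ν n ω - ν' n ω‖ ^ 2 ∂μ) / a₀ ^ 2 ≤ 2 * σ ^ 2 / a₀ ^ 2 := by
      gcongr; exact h.variance n
    have h2 : 2 * σ ^ 2 * ((n + 1 : ℕ) : ℝ) / a₀ ^ 2 =
        2 * σ ^ 2 * n / a₀ ^ 2 + 2 * σ ^ 2 / a₀ ^ 2 := by push_cast; ring
    rw [h2]; linarith

end Trajectory

/-! ### Expected error sums. -/

theorem four_mul_sq_div_sq_rpow_le {a₀ σhat : ℝ} (ha₀ : 0 < a₀) (hσhat : 0 ≤ σhat) :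
    (4 * σhat ^ 2 / a₀ ^ 2) ^ (2 / 3 : ℝ) ≤ 3 * (σhat ^ (4 / 3 : ℝ) / a₀ ^ (4 / 3 : ℝ)) := by
  have e : ∀ y : ℝ, 0 ≤ y → (y ^ 2) ^ (2 / 3 : ℝ) = y ^ (4 / 3 : ℝ) := fun y hy => by
    rw [← Real.rpow_natCast, ← Real.rpow_mul hy]; norm_num
  rw [mul_div_assoc, Real.mul_rpow (by norm_num) (by positivity),
    Real.div_rpow (by positivity) (by positivity), e _ hσhat, e _ ha₀.le]
  have h4 : (4 : ℝ) ^ (2 / 3 : ℝ) ≤ 3 := by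
    have h1 : ((4 : ℝ) ^ (2 / 3 : ℝ)) ^ 3 ≤ 3 ^ 3 := by
      rw [← Real.rpow_natCast, ← Real.rpow_mul (by norm_num)]
      norm_num
    exact le_of_pow_le_pow_left₀ (by norm_num) (by norm_num) h1
  gcongr

namespace Trajectory

variable {d : ℕ} {Ω : Type*} [MeasurableSpace Ω] {μ : Measure Ω}
  {σ σhat β p a₀ b₀ η Δ : ℝ} {F : EuclideanSpace ℝ (Fin d) → ℝ}
  {x dir grad ν ν' : ℕ → Ω → EuclideanSpace ℝ (Fin d)} {S : ℕ → Ω → ℝ}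
  [IsProbabilityMeasure μ]

/-- The expected error sum with weights `a_{t+1}`. -/
theorem integral_sum_err_le (h : Trajectory μ σ σhat β p a₀ b₀ η Δ F x dir grad ν ν' S)
    (ha₀ : 0 < a₀) (hσhat : 0 ≤ σhat) (M : ℕ) :
    ∫ ω, ∑ n ∈ Finset.range (M + 1),
        S (n + 1) ω ^ (-(2 / 3) : ℝ) * ‖dir n ω - grad n ω‖ ^ 2 ∂μ ≤
      2 * σ ^ 2 + diffFactor a₀ σhat * (12 * a₀ ^ 2 + 60 * σhat ^ 2) +
        4 * diffFactor a₀ σhat * β ^ 2 *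
          ∑ n ∈ Finset.range M, ∫ ω, ‖x (n + 1) ω - x n ω‖ ^ 2 ∂μ := by
  set δ := 4 * σhat ^ 2 / a₀ ^ 2 with hδ
  have hδ0 : 0 ≤ δ := by positivity
  have hD := four_mul_sq_div_sq_rpow_le ha₀ hσhat
  rw [← hδ] at hD
  have hB := fun n => (h.essBdd_rpow n 0).mul (h.essBdd_incr n).norm.sq
  have hC := fun n => (h.essBdd_rpow (n + 1) (-(4 / 3))).mul (h.bdd_ν (n + 1)).norm.sq
  have hX := fun n => (((h.essBdd_rpow n 0).mul ((EssBdd.const 1).sub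
    (h.essBdd_rpow n (-(2 / 3))))).const_mul 2).mul (h.essBdd_cross n)
  have hBCX := fun n => (((hB n).const_mul (2 + 3 / 2 * δ ^ (2 / 3 : ℝ))).add
    ((hC n).const_mul 2)).add (hX n)
  have hL : EssBdd μ (fun ω => ∑ n ∈ Finset.range (M + 1),
      S (n + 1) ω ^ (-(2 / 3) : ℝ) * ‖dir n ω - grad n ω‖ ^ 2) :=
    EssBdd.sum _ fun n _ => (h.essBdd_rpow (n + 1) _).mul (h.essBdd_err n).norm.sq
  have hsum := EssBdd.sum (Finset.range M) fun n _ => hBCX n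
  have hconst := (h.bdd_ν 0).norm.sq.add (EssBdd.const (μ := μ) (48 * δ ^ (2 / 3 : ℝ) * σhat ^ 2))
  refine (integral_mono_ae hL.integrable ((hconst.add hsum).const_mul 2).integrable
    (h.ae_sum_err_le M)).trans ?_
  rw [integral_const_mul, integral_add hconst.integrable hsum.integrable,
    integral_add (h.bdd_ν 0).norm.sq.integrable (integrable_const _),
    integral_finsetSum _ fun n _ => (hBCX n).integrable]
  have hterm : ∀ n, ∫ ω, ((2 + 3 / 2 * δ ^ (2 / 3 : ℝ)) *
            (S n ω ^ (0 : ℝ) * ‖ν (n + 1) ω - ν' n ω‖ ^ 2) +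
          2 * (S (n + 1) ω ^ (-(4 / 3) : ℝ) * ‖ν (n + 1) ω‖ ^ 2) +
          2 * (S n ω ^ (0 : ℝ) * (1 - S n ω ^ (-(2 / 3) : ℝ))) * inner ℝ (dir n ω - grad n ω)
            ((1 - S n ω ^ (-(2 / 3) : ℝ)) • (ν (n + 1) ω - ν' n ω) +
              S n ω ^ (-(2 / 3) : ℝ) • ν (n + 1) ω)) ∂μ ≤
      (2 + 3 / 2 * δ ^ (2 / 3 : ℝ)) * (β ^ 2 * ∫ ω, ‖x (n + 1) ω - x n ω‖ ^ 2 ∂μ) +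
        2 * (a₀ ^ 2 * ∫ ω, S (n + 1) ω ^ (-(4 / 3) : ℝ) * (S (n + 2) ω - S (n + 1) ω) ∂μ) := by
    intro n
    rw [integral_add (((hB n).const_mul _).add ((hC n).const_mul 2)).integrable (hX n).integrable,
      h.integral_cross_eq_zero, integral_add ((hB n).const_mul _).integrable
        ((hC n).const_mul 2).integrable, integral_const_mul, integral_const_mul, add_zero]
    have h1 := h.integral_increment_le n 0
    have h2 := h.integral_noise_le ha₀ (n + 1) (-(4 / 3))
    simp only [Real.rpow_zero, one_mul] at h1 ⊢
    gcongr
  have hs := Finset.sum_le_sum fun n (_ : n ∈ Finset.range M) => hterm n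
  rw [Finset.sum_add_distrib, ← Finset.mul_sum, ← Finset.mul_sum, ← Finset.mul_sum,
    ← Finset.mul_sum] at hs
  have hnoise : ∑ n ∈ Finset.range M,
      ∫ ω, S (n + 1) ω ^ (-(4 / 3) : ℝ) * (S (n + 2) ω - S (n + 1) ω) ∂μ ≤ δ + 3 := by
    have hN := fun n => (h.essBdd_rpow (n + 1) (-(4 / 3))).mul (h.essBdd_S_sub (n + 1))
    rw [← integral_finsetSum _ fun n _ => (hN n).integrable]
    have : ∫ ω, ∑ n ∈ Finset.range M, S (n + 1) ω ^ (-(4 / 3) : ℝ) *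
        (S (n + 2) ω - S (n + 1) ω) ∂μ ≤ ∫ _, (δ + 3) ∂μ := by
      refine integral_mono_ae (EssBdd.sum _ fun n _ => hN n).integrable (integrable_const _) ?_
      filter_upwards [h.ae_S_step] with ω hstep
      exact sum_lagged_rpow_four_thirds_le (fun n => h.one_le_S n ω) hδ0 (h.monotone_S ω) hstep 1 M
    simpa using this
  have hv := h.variance_zero
  have hQ : 0 ≤ β ^ 2 * ∑ n ∈ Finset.range M, ∫ ω, ‖x (n + 1) ω - x n ω‖ ^ 2 ∂μ :=
    mul_nonneg (sq_nonneg _) (Finset.sum_nonneg fun n _ => integral_nonneg fun _ => sq_nonneg _)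
  have hn2 : a₀ ^ 2 * (∑ n ∈ Finset.range M,
      ∫ ω, S (n + 1) ω ^ (-(4 / 3) : ℝ) * (S (n + 2) ω - S (n + 1) ω) ∂μ) ≤
      4 * σhat ^ 2 + 3 * a₀ ^ 2 := by
    refine (mul_le_mul_of_nonneg_left hnoise (sq_nonneg a₀)).trans (le_of_eq ?_)
    rw [hδ]; field_simp
  have hu : 0 ≤ σhat ^ (4 / 3 : ℝ) / a₀ ^ (4 / 3 : ℝ) := by positivity
  have e1 : diffFactor a₀ σhat = 1 + 6 * (σhat ^ (4 / 3 : ℝ) / a₀ ^ (4 / 3 : ℝ)) := by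
    rw [diffFactor, mul_div_assoc]
  rw [e1]
  simp only [integral_const, probReal_univ, one_smul]
  set u := σhat ^ (4 / 3 : ℝ) / a₀ ^ (4 / 3 : ℝ)
  set Q := ∑ n ∈ Finset.range M, ∫ ω, ‖x (n + 1) ω - x n ω‖ ^ 2 ∂μ
  have k1 : (2 + 3 / 2 * δ ^ (2 / 3 : ℝ)) * (β ^ 2 * Q) ≤ (2 + 3 / 2 * (3 * u)) * (β ^ 2 * Q) := by
    gcongr
  have k2 : 48 * δ ^ (2 / 3 : ℝ) * σhat ^ 2 ≤ 48 * (3 * u) * σhat ^ 2 := by gcongr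
  have k3 : 0 ≤ u * (β ^ 2 * Q) := mul_nonneg hu hQ
  have k4 : 0 ≤ u * a₀ ^ 2 := by positivity
  have k5 : 0 ≤ u * σhat ^ 2 := by positivity
  have k6 := sq_nonneg σhat
  linarith

/-- The expected error sum with weights `S_{t+1} ^ (r - 2/3)`. -/
theorem integral_sum_weighted_err_le
    (h : Trajectory μ σ σhat β p a₀ b₀ η Δ F x dir grad ν ν' S)
    (ha₀ : 0 < a₀) {r : ℝ} (hr : 1 / 3 ≤ r) (hr' : r ≤ 2 / 3) (M : ℕ) :
    ∫ ω, ∑ n ∈ Finset.range (M + 1),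
        S (n + 1) ω ^ (r - 2 / 3) * ‖dir n ω - grad n ω‖ ^ 2 ∂μ ≤
      3 * (σ ^ 2 + 90 * σhat ^ 2 * (1 + (4 * σhat ^ 2 / a₀ ^ 2) ^ r) +
        2 * (4 * σhat ^ 2 / a₀ ^ 2 * (max 1 (27 * (4 * σhat ^ 2 / a₀ ^ 2) ^ 3) +
          4 * σhat ^ 2 / a₀ ^ 2) ^ (r - 1 / 3)) * ∫ ω, ∑ n ∈ Finset.range (M + 1),
            S (n + 1) ω ^ (-(2 / 3) : ℝ) * ‖dir n ω - grad n ω‖ ^ 2 ∂μ +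
        5 * β ^ 2 * ∑ n ∈ Finset.range M, (∫ ω, S n ω ^ r * ‖x (n + 1) ω - x n ω‖ ^ 2 ∂μ +
          (4 * σhat ^ 2 / a₀ ^ 2) ^ r * ∫ ω, ‖x (n + 1) ω - x n ω‖ ^ 2 ∂μ) +
        2 * a₀ ^ 2 * ∫ ω, ∑ n ∈ Finset.range M,
          S (n + 1) ω ^ (r - 4 / 3) * (S (n + 2) ω - S (n + 1) ω) ∂μ) := by
  set δ := 4 * σhat ^ 2 / a₀ ^ 2 with hδ
  have hδ0 : 0 ≤ δ := by positivity
  have hδr : 0 ≤ δ ^ r := Real.rpow_nonneg hδ0 r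
  set P := δ * (max 1 (27 * δ ^ 3) + δ) ^ (r - 1 / 3)
  have hB := fun n => ((h.essBdd_rpow n r).add (EssBdd.const (δ ^ r))).mul
    (h.essBdd_incr n).norm.sq
  have hC := fun n => (h.essBdd_rpow (n + 1) (r - 4 / 3)).mul (h.bdd_ν (n + 1)).norm.sq
  have hX := fun n => (((h.essBdd_rpow n r).mul ((EssBdd.const 1).sub
    (h.essBdd_rpow n (-(2 / 3))))).const_mul 2).mul (h.essBdd_cross n)
  have hBCX := fun n => (((hB n).const_mul 5).add ((hC n).const_mul 2)).add (hX n)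
  have hL : ∀ s : ℝ, EssBdd μ (fun ω => ∑ n ∈ Finset.range (M + 1),
      S (n + 1) ω ^ s * ‖dir n ω - grad n ω‖ ^ 2) := fun s =>
    EssBdd.sum _ fun n _ => (h.essBdd_rpow (n + 1) _).mul (h.essBdd_err n).norm.sq
  have hsum := EssBdd.sum (Finset.range M) fun n _ => hBCX n
  have hconst := (h.bdd_ν 0).norm.sq.add (EssBdd.const (μ := μ) (90 * σhat ^ 2 * (1 + δ ^ r)))
  have hP := (hL (-(2 / 3))).const_mul (2 * P)
  refine (integral_mono_ae (hL _).integrable (((hconst.add hP).add hsum).const_mul 3).integrable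
    (h.ae_sum_weighted_err_le hr hr' M)).trans ?_
  rw [integral_const_mul, integral_add (hconst.add hP).integrable hsum.integrable,
    integral_add hconst.integrable hP.integrable, integral_const_mul,
    integral_add (h.bdd_ν 0).norm.sq.integrable (integrable_const _),
    integral_finsetSum _ fun n _ => (hBCX n).integrable]
  have hterm : ∀ n, ∫ ω, (5 * ((S n ω ^ r + δ ^ r) * ‖ν (n + 1) ω - ν' n ω‖ ^ 2) +
          2 * (S (n + 1) ω ^ (r - 4 / 3) * ‖ν (n + 1) ω‖ ^ 2) +
          2 * (S n ω ^ r * (1 - S n ω ^ (-(2 / 3) : ℝ))) * inner ℝ (dir n ω - grad n ω)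
            ((1 - S n ω ^ (-(2 / 3) : ℝ)) • (ν (n + 1) ω - ν' n ω) +
              S n ω ^ (-(2 / 3) : ℝ) • ν (n + 1) ω)) ∂μ ≤
      5 * β ^ 2 * (∫ ω, S n ω ^ r * ‖x (n + 1) ω - x n ω‖ ^ 2 ∂μ +
          δ ^ r * ∫ ω, ‖x (n + 1) ω - x n ω‖ ^ 2 ∂μ) +
        2 * a₀ ^ 2 * ∫ ω, S (n + 1) ω ^ (r - 4 / 3) * (S (n + 2) ω - S (n + 1) ω) ∂μ := by
    intro n
    rw [integral_add (((hB n).const_mul _).add ((hC n).const_mul 2)).integrable (hX n).integrable,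
      h.integral_cross_eq_zero, integral_add ((hB n).const_mul _).integrable
        ((hC n).const_mul 2).integrable, integral_const_mul, integral_const_mul, add_zero]
    have h1 := h.integral_increment_le n r
    have h0 := h.integral_increment_le n 0
    have h2 := h.integral_noise_le ha₀ (n + 1) (r - 4 / 3)
    simp only [Real.rpow_zero, one_mul] at h0
    simp_rw [add_mul]
    rw [integral_add ((h.essBdd_rpow n r).mul (h.essBdd_incr n).norm.sq).integrable
      ((h.essBdd_incr n).norm.sq.const_mul _).integrable, integral_const_mul]
    have h3 := mul_le_mul_of_nonneg_left h0 hδr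
    linarith
  have hs := Finset.sum_le_sum fun n (_ : n ∈ Finset.range M) => hterm n
  rw [Finset.sum_add_distrib, ← Finset.mul_sum, ← Finset.mul_sum] at hs
  have hN := fun n => (h.essBdd_rpow (n + 1) (r - 4 / 3)).mul (h.essBdd_S_sub (n + 1))
  rw [← integral_finsetSum (Finset.range M) fun n _ => (hN n).integrable] at hs
  have hv := h.variance_zero
  simp only [integral_const, probReal_univ, one_smul]
  linarith

end Trajectory

/-! ### Hölder and Jensen for essentially bounded variables. -/

section Moments

variable {Ω : Type*} [MeasurableSpace Ω] {μ : Measure Ω} [IsProbabilityMeasure μ]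

theorem integral_rpow_mul_rpow_le {X Y : Ω → ℝ} (hX : EssBdd μ X) (hY : EssBdd μ Y)
    (hX0 : ∀ ω, 0 ≤ X ω) (hY0 : ∀ ω, 0 ≤ Y ω) {θ : ℝ} (h0 : 0 < θ) (h1 : θ < 1) :
    ∫ ω, X ω ^ θ * Y ω ^ (1 - θ) ∂μ ≤ (∫ ω, X ω ∂μ) ^ θ * (∫ ω, Y ω ∂μ) ^ (1 - θ) := by
  have hθ : 0 < 1 - θ := by linarith
  have hpq : (1 / θ).HolderConjugate (1 / (1 - θ)) := by
    rw [Real.holderConjugate_iff]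
    refine ⟨by rw [lt_div_iff₀ h0]; linarith, by simp⟩
  have hXr := hX.rpow hX0 h0.le
  have hYr := hY.rpow hY0 hθ.le
  have hmem : ∀ {Z : Ω → ℝ} (q : ENNReal), EssBdd μ Z → MemLp Z q μ := fun q hZ => by
    obtain ⟨C, hC⟩ := hZ.bdd
    exact MemLp.of_bound hZ.meas.aestronglyMeasurable C hC
  have key := integral_mul_le_Lp_mul_Lq_of_nonneg hpq (μ := μ) (f := fun ω => X ω ^ θ)
    (g := fun ω => Y ω ^ (1 - θ)) (.of_forall fun ω => Real.rpow_nonneg (hX0 ω) _)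
    (.of_forall fun ω => Real.rpow_nonneg (hY0 ω) _) (hmem _ hXr) (hmem _ hYr)
  have e1 : ∀ ω, (X ω ^ θ) ^ (1 / θ) = X ω := fun ω => by
    rw [← Real.rpow_mul (hX0 ω), mul_one_div_cancel h0.ne', Real.rpow_one]
  have e2 : ∀ ω, (Y ω ^ (1 - θ)) ^ (1 / (1 - θ)) = Y ω := fun ω => by
    rw [← Real.rpow_mul (hY0 ω), mul_one_div_cancel hθ.ne', Real.rpow_one]
  simpa only [e1, e2, one_div_one_div] using key

theorem integral_rpow_le {X : Ω → ℝ} (hX : EssBdd μ X) (hX0 : ∀ ω, 0 ≤ X ω) {θ : ℝ} (h0 : 0 < θ)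
    (h1 : θ ≤ 1) : ∫ ω, X ω ^ θ ∂μ ≤ (∫ ω, X ω ∂μ) ^ θ := by
  rcases h1.eq_or_lt with rfl | h1
  · simp
  · simpa using integral_rpow_mul_rpow_le hX (EssBdd.const 1) hX0 (fun _ => zero_le_one) h0 h1

theorem one_le_integral {X : Ω → ℝ} (hX : EssBdd μ X) (h1 : ∀ ω, 1 ≤ X ω) : 1 ≤ ∫ ω, X ω ∂μ := by
  have := integral_mono (integrable_const (1 : ℝ)) hX.integrable h1
  simpa using this

/-- Jensen, obtained by integrating the tangent line of the logarithm at the mean. -/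
theorem integral_log_le {X : Ω → ℝ} (hX : EssBdd μ X) (h1 : ∀ ω, 1 ≤ X ω) :
    ∫ ω, Real.log (X ω) ∂μ ≤ Real.log (∫ ω, X ω ∂μ) := by
  have hm := zero_lt_one.trans_le (one_le_integral hX h1)
  set m := ∫ ω, X ω ∂μ with hm'
  have h : ∀ ω, Real.log (X ω) ≤ Real.log m + (m⁻¹ * X ω - 1) := fun ω => by
    have hx := zero_lt_one.trans_le (h1 ω)
    have := Real.log_le_sub_one_of_pos (mul_pos (inv_pos.2 hm) hx)
    rw [Real.log_mul (inv_pos.2 hm).ne' hx.ne', Real.log_inv] at this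
    linarith
  have hi : Integrable (fun ω => m⁻¹ * X ω - 1) μ :=
    (hX.integrable.const_mul m⁻¹).sub (integrable_const (1 : ℝ))
  refine (integral_mono (hX.log_of_one_le h1).integrable ((integrable_const _).add hi) h).trans ?_
  simp only [Pi.add_apply]
  rw [integral_add (integrable_const _) hi, integral_sub (hX.integrable.const_mul _)
    (integrable_const _), integral_const_mul, ← hm', inv_mul_cancel₀ hm.ne']
  simp

end Moments

/-! ### The constants K₀ to K₃. -/

section Constants

/-- Identifies the power of K₀ with the threshold factor of `weight_growth_le` at r = 4ℓ/3; this is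
how K₀ enters K₁ and K₃. -/
theorem one_div_K₀_rpow {a₀ σhat : ℝ} (ha₀ : 0 < a₀) (ℓ : ℝ) :
    1 / K₀ a₀ σhat ^ (2 * ℓ - 1 / 2) =
      (max 1 (27 * (4 * σhat ^ 2 / a₀ ^ 2) ^ 3) + 4 * σhat ^ 2 / a₀ ^ 2) ^
        (4 * ℓ / 3 - 1 / 3) := by
  have e : 1728 * σhat ^ 6 / a₀ ^ 6 = 27 * (4 * σhat ^ 2 / a₀ ^ 2) ^ 3 := by field_simp; ring
  have h0 : 0 < max 1 (27 * (4 * σhat ^ 2 / a₀ ^ 2) ^ 3) + 4 * σhat ^ 2 / a₀ ^ 2 :=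
    add_pos_of_pos_of_nonneg (lt_max_of_lt_left zero_lt_one) (by positivity)
  rw [K₀, e, ← Real.rpow_mul h0.le, one_div, ← Real.rpow_neg h0.le]
  congr 1; ring

theorem one_le_one_div_K₀_rpow {a₀ σhat : ℝ} (ha₀ : 0 < a₀) {ℓ : ℝ}
    (hℓ : 1 / 4 ≤ ℓ) : 1 ≤ 1 / K₀ a₀ σhat ^ (2 * ℓ - 1 / 2) := by
  rw [one_div_K₀_rpow ha₀]
  refine Real.one_le_rpow ((le_max_left _ _).trans (le_add_of_nonneg_right (by positivity)))
    (by linarith)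

theorem one_le_diffFactor {a₀ σhat : ℝ} (ha₀ : 0 < a₀) (hσhat : 0 ≤ σhat) :
    1 ≤ diffFactor a₀ σhat := by
  rw [diffFactor]
  exact le_add_of_nonneg_right (by positivity)

theorem K₁_nonneg {a₀ σ σhat ℓ : ℝ} (ha₀ : 0 < a₀) (hσhat : 0 ≤ σhat) : 0 ≤ K₁ a₀ σ σhat ℓ := by
  have hc := zero_le_one.trans (one_le_diffFactor ha₀ hσhat)
  have hK : 0 ≤ K₀ a₀ σhat := by unfold K₀; positivity
  unfold K₁
  positivity

theorem K₂_nonneg {a₀ ℓ : ℝ} (hℓ : 1 / 4 ≤ ℓ) : 0 ≤ K₂ a₀ ℓ := by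
  unfold K₂
  split_ifs with h
  · positivity
  · have : 0 < 4 * ℓ - 1 := by
      rcases hℓ.eq_or_lt with h1 | h1
      · exact absurd h1.symm h
      · linarith
    positivity

theorem K₃_nonneg {a₀ σhat ℓ : ℝ} (ha₀ : 0 < a₀) (hσhat : 0 ≤ σhat) :
    0 ≤ K₃ a₀ σhat ℓ := by
  have hc := zero_le_one.trans (one_le_diffFactor ha₀ hσhat)
  have hK : 0 ≤ K₀ a₀ σhat := by unfold K₀; positivity
  unfold K₃
  positivity

/-- Collecting the constants in the weighted error bound. -/
theorem err_bound_of_le {t A w κ u c δr i σ₂ b Q WQ L L₀ N Z : ℝ} (ht0 : 0 ≤ t) (et2 : t * A = w)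
    (hκ1 : 1 ≤ κ) (hw : 0 ≤ w) (hu : 0 ≤ u) (ec : c = 1 + 6 * u) (hδr0 : 0 ≤ δr)
    (hδr : δr ≤ 1 + 3 * u) (hinv : 4 ≤ i) (hσ : 0 ≤ σ₂) (hb : 0 ≤ b) (hQ : 0 ≤ Q) (hWQ : 0 ≤ WQ)
    (hmain : L ≤ 3 * (σ₂ + 90 * w * (1 + δr) + 2 * (4 * t * κ) * L₀ +
      5 * b * (WQ + δr * Q) + 2 * A * N))
    (hzero : L₀ ≤ 2 * σ₂ + c * (12 * A + 60 * w) + 4 * c * b * Q)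
    (hnoise : 6 * A * N ≤ 24 * w + Z) :
    L ≤ 3 * σ₂ + 72 * (1 + i) * w + 72 * t * κ * (σ₂ + 8 * c * (3 * A + 5 * w)) + Z +
      b * ((144 * t * κ * c + 3 * (i + 2) * δr) * Q + 3 * (i + 2) * WQ) := by
  -- In the application t = σhat²/a₀², A = a₀², w = σhat², κ is the inverse power of K₀, c =
  -- `diffFactor`, δr = (4σhat²/a₀²)^(4ℓ/3), i = 1/ℓ², σ₂ = σ² and b = β². Q and WQ are the plain
  -- and weighted sums of squared steps, L and L₀ the weighted and unweighted error sums, N the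
  -- noise sum.
  have hc0 : 0 ≤ c := by rw [ec]; positivity
  have hκ0 : 0 ≤ κ := zero_le_one.trans hκ1
  have k1 := mul_le_mul_of_nonneg_left hzero (show 0 ≤ 24 * (t * κ) by positivity)
  have k2 : 24 * (t * κ) * (2 * σ₂ + c * (12 * A + 60 * w) + 4 * c * b * Q) =
      48 * (t * κ * σ₂) + 288 * (κ * c * w) + 1440 * (t * κ * c * w) +
        96 * (t * κ * c * (b * Q)) := by
    linear_combination 288 * κ * c * et2
  rw [k2] at k1
  have k3 : 72 * t * κ * (σ₂ + 8 * c * (3 * A + 5 * w)) =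
      72 * (t * κ * σ₂) + 1728 * (κ * c * w) + 2880 * (t * κ * c * w) := by
    linear_combination 1728 * κ * c * et2
  rw [k3]
  have k4 : w + 6 * (u * w) ≤ κ * c * w := by
    have : c * w = w + 6 * (u * w) := by rw [ec]; ring
    rw [mul_assoc, this]
    exact le_mul_of_one_le_left (by positivity) hκ1
  have k5 : δr * w ≤ w + 3 * (u * w) := by nlinarith
  have k6 : 0 ≤ t * κ * σ₂ := by positivity
  have k7 : 0 ≤ t * κ * c * w := by positivity
  have k8 : 0 ≤ t * κ * c * (b * Q) := by positivity
  have k9 : 4 * (δr * (b * Q)) ≤ i * (δr * (b * Q)) := by gcongr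
  have k10 : 4 * (b * WQ) ≤ i * (b * WQ) := by gcongr
  have k11 : 4 * w ≤ i * w := by gcongr
  have k12 : 0 ≤ δr * (b * Q) := by positivity
  have k13 : 0 ≤ b * WQ := by positivity
  have k14 : 0 ≤ u * w := by positivity
  linarith

end Constants

/-! ### The error bound with collected constants. -/

namespace Trajectory

variable {d : ℕ} {Ω : Type*} [MeasurableSpace Ω] {μ : Measure Ω}
  {σ σhat β p a₀ b₀ η Δ : ℝ} {F : EuclideanSpace ℝ (Fin d) → ℝ}
  {x dir grad ν ν' : ℕ → Ω → EuclideanSpace ℝ (Fin d)} {S : ℕ → Ω → ℝ}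
  [IsProbabilityMeasure μ]

theorem integral_log_S_le (h : Trajectory μ σ σhat β p a₀ b₀ η Δ F x dir grad ν ν' S) (n : ℕ) :
    ∫ ω, Real.log (S n ω) ∂μ ≤ Real.log (1 + 2 * σ ^ 2 * n / a₀ ^ 2) :=
  (integral_log_le (h.bdd_S n) (h.one_le_S n)).trans (Real.log_le_log
    (zero_lt_one.trans_le (one_le_integral (h.bdd_S n) (h.one_le_S n))) (h.integral_S_le n))

theorem integral_rpow_S_le (h : Trajectory μ σ σhat β p a₀ b₀ η Δ F x dir grad ν ν' S) (n : ℕ)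
    {κ : ℝ} (h0 : 0 < κ) (h1 : κ ≤ 1) :
    ∫ ω, S n ω ^ κ ∂μ ≤ (1 + 2 * σ ^ 2 * n / a₀ ^ 2) ^ κ := by
  have hS0 := fun ω => zero_le_one.trans (h.one_le_S n ω)
  exact (integral_rpow_le (h.bdd_S n) hS0 h0 h1).trans
    (Real.rpow_le_rpow (integral_nonneg hS0) (h.integral_S_le n) h0.le)

/-- The accumulated noise of the fresh samples. -/
theorem integral_noise_sum_le (h : Trajectory μ σ σhat β p a₀ b₀ η Δ F x dir grad ν ν' S)
    (ha₀ : 0 < a₀) {ℓ : ℝ} (hℓ : 1 / 4 ≤ ℓ) (hℓ' : ℓ ≤ 1 / 2) (M : ℕ) :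
    6 * a₀ ^ 2 * ∫ ω, ∑ n ∈ Finset.range M,
        S (n + 1) ω ^ (4 * ℓ / 3 - 4 / 3) * (S (n + 2) ω - S (n + 1) ω) ∂μ ≤
      24 * σhat ^ 2 + K₂ a₀ ℓ * (if ℓ = 1 / 4 then
        Real.log (1 + 2 * σ ^ 2 * (M + 1 : ℕ) / a₀ ^ 2) else
        (1 + 2 * σ ^ 2 * (M + 1 : ℕ) / a₀ ^ 2) ^ ((4 * ℓ - 1) / 3)) := by
  set δ := 4 * σhat ^ 2 / a₀ ^ 2 with hδ
  have hδ0 : 0 ≤ δ := by positivity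
  have hN := EssBdd.sum (Finset.range M) fun n _ =>
    (h.essBdd_rpow (n + 1) (4 * ℓ / 3 - 4 / 3)).mul (h.essBdd_S_sub (n + 1))
  have hs1 : 1 ≤ 1 + 2 * σ ^ 2 * (M + 1 : ℕ) / a₀ ^ 2 := le_add_of_nonneg_right (by positivity)
  have e0 : a₀ ^ 2 * δ = 4 * σhat ^ 2 := by rw [hδ]; field_simp
  have hℓ0 : 0 < ℓ := by linarith
  have hinv : 4 ≤ 1 / ℓ ^ 2 := by
    rw [le_div_iff₀ (by positivity)]; nlinarith
  have einv : (1 + 2 * ℓ ^ 2) / ℓ ^ 2 = 1 / ℓ ^ 2 + 2 := by field_simp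
  -- The exponent 4ℓ/3 - 4/3 equals -1 exactly for ℓ = 1/4, where the sum is logarithmic; otherwise
  -- it is (4ℓ - 1)/3 - 1 and the sum is a power.
  by_cases hq : ℓ = 1 / 4
  · rw [if_pos hq]
    have h1 : ∫ ω, ∑ n ∈ Finset.range M, S (n + 1) ω ^ (4 * ℓ / 3 - 4 / 3) *
        (S (n + 2) ω - S (n + 1) ω) ∂μ ≤ ∫ ω, (δ + Real.log (S (M + 1) ω)) ∂μ := by
      refine integral_mono_ae hN.integrable ((EssBdd.const δ).add
        ((h.bdd_S _).log_of_one_le (h.one_le_S _))).integrable ?_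
      filter_upwards [h.ae_S_step] with ω hstep
      have := sum_lagged_inv_le (fun n => h.one_le_S n ω) hδ0 (h.monotone_S ω) hstep 1 M
      rw [hq]; norm_num
      exact this
    rw [integral_add (integrable_const _)
      ((h.bdd_S _).log_of_one_le (h.one_le_S _)).integrable] at h1
    have h2 := h.integral_log_S_le (M + 1)
    have hlog := Real.log_nonneg hs1
    have e2 : K₂ a₀ ℓ = 54 * a₀ ^ 2 := by
      rw [K₂, if_pos hq, hq]; ring
    simp only [integral_const, probReal_univ, one_smul] at h1
    rw [e2]
    set L := Real.log (1 + 2 * σ ^ 2 * (M + 1 : ℕ) / a₀ ^ 2)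
    calc _ ≤ 6 * a₀ ^ 2 * (δ + L) := by gcongr; linarith
      _ ≤ _ := by nlinarith [mul_nonneg (sq_nonneg a₀) hlog]
  · rw [if_neg hq]
    have hκ0 : 0 < 4 * ℓ - 1 := by
      rcases hℓ.eq_or_lt with h1 | h1
      · exact absurd h1.symm hq
      · linarith
    have h1 : ∫ ω, ∑ n ∈ Finset.range M, S (n + 1) ω ^ (4 * ℓ / 3 - 4 / 3) *
        (S (n + 2) ω - S (n + 1) ω) ∂μ ≤
        ∫ ω, (δ + S (M + 1) ω ^ ((4 * ℓ - 1) / 3) / ((4 * ℓ - 1) / 3)) ∂μ := by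
      refine integral_mono_ae hN.integrable ((integrable_const δ).add
        ((h.essBdd_rpow _ _).integrable.div_const _)) ?_
      filter_upwards [h.ae_S_step] with ω hstep
      have := sum_lagged_rpow_le (κ := (4 * ℓ - 1) / 3) (by linarith) (by linarith)
        (fun n => h.one_le_S n ω) hδ0 (h.monotone_S ω) hstep 1 M
      rw [show 4 * ℓ / 3 - 4 / 3 = (4 * ℓ - 1) / 3 - 1 by ring]
      exact this
    rw [integral_add (integrable_const _) ((h.essBdd_rpow _ _).integrable.div_const _),
      integral_div ((4 * ℓ - 1) / 3)] at h1
    have h2 := h.integral_rpow_S_le (M + 1) (κ := (4 * ℓ - 1) / 3) (by linarith) (by linarith)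
    have e2 : K₂ a₀ ℓ = 9 * ((1 + 2 * ℓ ^ 2) / ℓ ^ 2) * a₀ ^ 2 / (4 * ℓ - 1) := by
      rw [K₂, if_neg hq]; field_simp
    simp only [integral_const, probReal_univ, one_smul] at h1
    rw [e2, einv]
    set L := (1 + 2 * σ ^ 2 * (M + 1 : ℕ) / a₀ ^ 2) ^ ((4 * ℓ - 1) / 3)
    have hL : 0 ≤ L := Real.rpow_nonneg (zero_le_one.trans hs1) _
    have hY : 0 ≤ a₀ ^ 2 * L / (4 * ℓ - 1) := by positivity
    calc _ ≤ 6 * a₀ ^ 2 * (δ + L / ((4 * ℓ - 1) / 3)) := by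
          gcongr
          refine h1.trans ?_
          gcongr
      _ = 24 * σhat ^ 2 + 18 * (a₀ ^ 2 * L / (4 * ℓ - 1)) := by
          rw [mul_add, mul_assoc 6, e0]; field_simp; ring
      _ ≤ 24 * σhat ^ 2 + 9 * (1 / ℓ ^ 2 + 2) * (a₀ ^ 2 * L / (4 * ℓ - 1)) := by
          gcongr; linarith
      _ = _ := by ring

/-- The expected error sum with weights `a_{t+1} ^ (1 - 2 ℓ)`. -/
theorem integral_err_le (h : Trajectory μ σ σhat β p a₀ b₀ η Δ F x dir grad ν ν' S)
    (ha₀ : 0 < a₀) (hσhat : 0 ≤ σhat) {ℓ : ℝ} (hℓ : 1 / 4 ≤ ℓ) (hℓ' : ℓ ≤ 1 / 2) (M : ℕ) :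
    ∫ ω, ∑ n ∈ Finset.range (M + 1),
        S (n + 1) ω ^ (4 * ℓ / 3 - 2 / 3) * ‖dir n ω - grad n ω‖ ^ 2 ∂μ ≤
      K₁ a₀ σ σhat ℓ + K₂ a₀ ℓ * (if ℓ = 1 / 4 then
        Real.log (1 + 2 * σ ^ 2 * (M + 1 : ℕ) / a₀ ^ 2) else
        (1 + 2 * σ ^ 2 * (M + 1 : ℕ) / a₀ ^ 2) ^ ((4 * ℓ - 1) / 3)) +
      β ^ 2 * ∫ ω, ∑ n ∈ Finset.range (M + 1),
        (K₃ a₀ σhat ℓ + 3 * (1 + 2 * ℓ ^ 2) / ℓ ^ 2 * S n ω ^ (4 * ℓ / 3)) *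
          ‖x (n + 1) ω - x n ω‖ ^ 2 ∂μ := by
  have hmain := h.integral_sum_weighted_err_le ha₀ (r := 4 * ℓ / 3) (by linarith) (by linarith) M
  have hzero := h.integral_sum_err_le ha₀ hσhat M
  have hnoise := h.integral_noise_sum_le ha₀ hℓ hℓ' M
  have hD := four_mul_sq_div_sq_rpow_le ha₀ hσhat
  rw [← one_div_K₀_rpow ha₀] at hmain
  have hκ1 := one_le_one_div_K₀_rpow (σhat := σhat) ha₀ hℓ
  set Φ := (if ℓ = 1 / 4 then
        Real.log (1 + 2 * σ ^ 2 * (M + 1 : ℕ) / a₀ ^ 2) else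
        (1 + 2 * σ ^ 2 * (M + 1 : ℕ) / a₀ ^ 2) ^ ((4 * ℓ - 1) / 3))
  have hℓ0 : 0 < ℓ := by linarith
  have hinv : 4 ≤ 1 / ℓ ^ 2 := by
    rw [le_div_iff₀ (by positivity)]; nlinarith
  have eK₁ : K₁ a₀ σ σhat ℓ = 3 * σ ^ 2 + 72 * (1 + 1 / ℓ ^ 2) * σhat ^ 2 +
      72 * (σhat ^ 2 / a₀ ^ 2) * (1 / K₀ a₀ σhat ^ (2 * ℓ - 1 / 2)) *
        (σ ^ 2 + 8 * diffFactor a₀ σhat * (3 * a₀ ^ 2 + 5 * σhat ^ 2)) := by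
    rw [K₁]
    have : (1 + ℓ ^ 2) * σhat ^ 2 / ℓ ^ 2 = (1 + 1 / ℓ ^ 2) * σhat ^ 2 := by field_simp; ring
    rw [show 24 * (1 + ℓ ^ 2) * σhat ^ 2 / ℓ ^ 2 = 24 * ((1 + ℓ ^ 2) * σhat ^ 2 / ℓ ^ 2) by ring,
      this]
    field_simp
    ring
  have eK₃ : K₃ a₀ σhat ℓ = 144 * (σhat ^ 2 / a₀ ^ 2) * (1 / K₀ a₀ σhat ^ (2 * ℓ - 1 / 2)) *
      diffFactor a₀ σhat + 3 * (1 / ℓ ^ 2 + 2) * (4 * σhat ^ 2 / a₀ ^ 2) ^ (4 * ℓ / 3) := by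
    rw [K₃]
    have : 3 * (1 + 2 * ℓ ^ 2) / ℓ ^ 2 = 3 * (1 / ℓ ^ 2 + 2) := by field_simp
    rw [this]
    field_simp
  have e3 : 3 * (1 + 2 * ℓ ^ 2) / ℓ ^ 2 = 3 * (1 / ℓ ^ 2 + 2) := by field_simp
  have hδr : (4 * σhat ^ 2 / a₀ ^ 2) ^ (4 * ℓ / 3) ≤
      1 + 3 * (σhat ^ (4 / 3 : ℝ) / a₀ ^ (4 / 3 : ℝ)) := by
    have hδ0 : 0 ≤ 4 * σhat ^ 2 / a₀ ^ 2 := by positivity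
    rcases le_total (4 * σhat ^ 2 / a₀ ^ 2) 1 with h1 | h1
    · have := Real.rpow_le_one hδ0 h1 (show 0 ≤ 4 * ℓ / 3 by linarith)
      have : 0 ≤ σhat ^ (4 / 3 : ℝ) / a₀ ^ (4 / 3 : ℝ) := by positivity
      linarith
    · have := Real.rpow_le_rpow_of_exponent_le h1 (show 4 * ℓ / 3 ≤ 2 / 3 by linarith)
      linarith
  have hδr0 : 0 ≤ (4 * σhat ^ 2 / a₀ ^ 2) ^ (4 * ℓ / 3) := by positivity
  have ec : diffFactor a₀ σhat = 1 + 6 * (σhat ^ (4 / 3 : ℝ) / a₀ ^ (4 / 3 : ℝ)) := by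
    rw [diffFactor, mul_div_assoc]
  have hu : 0 ≤ σhat ^ (4 / 3 : ℝ) / a₀ ^ (4 / 3 : ℝ) := by positivity
  have hWQ := fun n => (h.essBdd_rpow n (4 * ℓ / 3)).mul (h.essBdd_sqStep n)
  have esum : ∫ ω, ∑ n ∈ Finset.range (M + 1),
        (K₃ a₀ σhat ℓ + 3 * (1 + 2 * ℓ ^ 2) / ℓ ^ 2 * S n ω ^ (4 * ℓ / 3)) *
          ‖x (n + 1) ω - x n ω‖ ^ 2 ∂μ = ∑ n ∈ Finset.range (M + 1),
        (K₃ a₀ σhat ℓ * ∫ ω, ‖x (n + 1) ω - x n ω‖ ^ 2 ∂μ + 3 * (1 / ℓ ^ 2 + 2) *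
          ∫ ω, S n ω ^ (4 * ℓ / 3) * ‖x (n + 1) ω - x n ω‖ ^ 2 ∂μ) := by
    have e : ∀ n ω, (K₃ a₀ σhat ℓ + 3 * (1 + 2 * ℓ ^ 2) / ℓ ^ 2 * S n ω ^ (4 * ℓ / 3)) *
        ‖x (n + 1) ω - x n ω‖ ^ 2 = K₃ a₀ σhat ℓ * ‖x (n + 1) ω - x n ω‖ ^ 2 +
        3 * (1 / ℓ ^ 2 + 2) * (S n ω ^ (4 * ℓ / 3) * ‖x (n + 1) ω - x n ω‖ ^ 2) := fun n ω => by
      rw [e3]; ring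
    simp_rw [e]
    rw [integral_finsetSum _ fun n _ => (((h.essBdd_sqStep n).const_mul (K₃ a₀ σhat ℓ)).add
      ((hWQ n).const_mul (3 * (1 / ℓ ^ 2 + 2)))).integrable]
    refine Finset.sum_congr rfl fun n _ => ?_
    rw [integral_add ((h.essBdd_sqStep n).const_mul _).integrable
      ((hWQ n).const_mul _).integrable, integral_const_mul, integral_const_mul]
  have hQ0 : ∀ n, 0 ≤ ∫ ω, ‖x (n + 1) ω - x n ω‖ ^ 2 ∂μ := fun n =>
    integral_nonneg fun _ => sq_nonneg _
  have hWQ0 : ∀ n, 0 ≤ ∫ ω, S n ω ^ (4 * ℓ / 3) * ‖x (n + 1) ω - x n ω‖ ^ 2 ∂μ := fun n =>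
    integral_nonneg fun ω => mul_nonneg
      (Real.rpow_nonneg (zero_le_one.trans (h.one_le_S n ω)) _) (sq_nonneg _)
  have hK₃ := K₃_nonneg (ℓ := ℓ) ha₀ hσhat
  -- Only the first M steps enter the error bound. Adding the last one is harmless and matches the
  -- range of the direction sums.
  have hsub : ∑ n ∈ Finset.range M,
        (K₃ a₀ σhat ℓ * ∫ ω, ‖x (n + 1) ω - x n ω‖ ^ 2 ∂μ + 3 * (1 / ℓ ^ 2 + 2) *
          ∫ ω, S n ω ^ (4 * ℓ / 3) * ‖x (n + 1) ω - x n ω‖ ^ 2 ∂μ) ≤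
      ∑ n ∈ Finset.range (M + 1),
        (K₃ a₀ σhat ℓ * ∫ ω, ‖x (n + 1) ω - x n ω‖ ^ 2 ∂μ + 3 * (1 / ℓ ^ 2 + 2) *
          ∫ ω, S n ω ^ (4 * ℓ / 3) * ‖x (n + 1) ω - x n ω‖ ^ 2 ∂μ) := by
    rw [Finset.sum_range_succ]
    exact le_add_of_nonneg_right (add_nonneg (mul_nonneg hK₃ (hQ0 M))
      (mul_nonneg (by linarith) (hWQ0 M)))
  rw [esum]
  refine le_trans ?_ (add_le_add_right (mul_le_mul_of_nonneg_left hsub (sq_nonneg β)) _)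
  rw [Finset.sum_add_distrib, ← Finset.mul_sum, ← Finset.mul_sum, eK₁, eK₃]
  rw [Finset.sum_add_distrib, ← Finset.mul_sum] at hmain
  refine err_bound_of_le (t := σhat ^ 2 / a₀ ^ 2) (by positivity) (by field_simp) hκ1
    (sq_nonneg _) hu ec hδr0 hδr hinv (sq_nonneg σ) (sq_nonneg β)
    (Finset.sum_nonneg fun n _ => hQ0 n) (Finset.sum_nonneg fun n _ => hWQ0 n) ?_ hzero hnoise
  have e4 : 4 * σhat ^ 2 / a₀ ^ 2 * (1 / K₀ a₀ σhat ^ (2 * ℓ - 1 / 2)) =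
      4 * (σhat ^ 2 / a₀ ^ 2) * (1 / K₀ a₀ σhat ^ (2 * ℓ - 1 / 2)) := by rw [mul_div_assoc]
  rwa [e4] at hmain

end Trajectory

/-! ### The pathwise potential inequality for the directions. -/

section Claim

/-- φ^(1-p) - φ is largest at c = (1-p)^(1/p), with value cp/(1-p), so the claim is c ≤ (1-p)/2.
That follows from 2^w ≤ 1 + w for w = p/(1-p). Weighted AM-GM between φ and c replaces the
maximization. -/
theorem rpow_one_sub_le_add_half {p φ : ℝ} (hp0 : 0 < p) (hp : p ≤ 1 / 2) (hφ : 0 ≤ φ) :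
    φ ^ (1 - p) ≤ φ + p / 2 := by
  have hr : 0 < 1 - p := by linarith
  set w := p / (1 - p) with hw
  have hw0 : 0 < w := div_pos hp0 hr
  have hw1 : w ≤ 1 := by rw [hw, div_le_one hr]; linarith
  have h2w : (2 : ℝ) ^ w ≤ 1 + w := by
    have := rpow_one_add_le_one_add_mul_self (s := 1) (p := w) (by norm_num) hw0.le hw1
    norm_num at this
    exact this
  have e1 : (1 - p)⁻¹ = 1 + w := by rw [hw]; field_simp; ring
  set c := (1 - p) ^ (1 / p) with hc
  have hc0 : 0 ≤ c := Real.rpow_nonneg hr.le _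
  have hcp : c ^ p = 1 - p := by
    rw [hc, ← Real.rpow_mul hr.le, one_div_mul_cancel hp0.ne', Real.rpow_one]
  have hc2 : c ≤ (1 - p) / 2 := by
    have h3 : (1 - p) ^ (1 / w) ≤ 1 / 2 := by
      calc (1 - p) ^ (1 / w) ≤ (2 ^ (-w) : ℝ) ^ (1 / w) := by
            refine Real.rpow_le_rpow hr.le ?_ (by positivity)
            rw [Real.rpow_neg two_pos.le]
            rw [le_inv_comm₀ hr (by positivity), e1]
            exact h2w
        _ = 1 / 2 := by
            rw [← Real.rpow_mul two_pos.le, neg_mul, mul_one_div_cancel hw0.ne', Real.rpow_neg_one]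
            norm_num
    have e2 : 1 / p = 1 / w + 1 := by rw [hw]; field_simp; ring
    rw [hc, e2, Real.rpow_add_one hr.ne']
    nlinarith
  have hy := Real.geom_mean_le_arith_mean2_weighted hr.le hp0.le hφ hc0 (by ring)
  rw [hcp] at hy
  have : φ ^ (1 - p) * (1 - p) ≤ (φ + p / 2) * (1 - p) := by nlinarith
  exact le_of_mul_le_mul_right this hr

/-- The sharp constant is 1/e = 0.3678…, attained at v = e. -/
theorem log_le_mul_of_pos {v : ℝ} (hv : 0 < v) : Real.log v ≤ 0.368 * v := by
  have he := Real.exp_one_gt_d9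
  have h := Real.log_le_sub_one_of_pos (div_pos hv (Real.exp_pos 1))
  rw [Real.log_div hv.ne' (Real.exp_pos 1).ne', Real.log_exp] at h
  have : v / Real.exp 1 ≤ 0.368 * v := by
    rw [div_le_iff₀ (Real.exp_pos 1)]
    nlinarith
  linarith

/-- Absorbs the logarithm left by the telescoping in `rpow_sum_dir_le`. It suffices that the bracket
is at least 0.368 p/(1-p)². After the preceding bounds the bracket is replaced by an affine function
of φ, nonincreasing because 1/(1-p) ≤ 2, whose value at φ = 1 is p/(1-p) - p/2. -/
theorem mul_log_le_mul {p v φ : ℝ} (hp0 : 0 < p) (hp : p ≤ 1 / 2) (hv : 0 < v) (hφ : 0 ≤ φ)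
    (hφ1 : φ ≤ 1) : p / (1 - p) ^ 2 * Real.log v ≤
      v * ((1 - φ) ^ (1 - p) + φ / (1 - p) - φ ^ (1 - p)) := by
  have hr : 0 < 1 - p := by linarith
  have h1 : 1 - φ ≤ (1 - φ) ^ (1 - p) :=
    Real.self_le_rpow_of_le_one (by linarith) (by linarith) (by linarith)
  have h2 := rpow_one_sub_le_add_half hp0 hp hφ
  -- Equivalent to (1-p) - (1-p)²/2 ≥ 0.368. The worst case is p = 1/2, where the left side is
  -- 0.375, so there is little slack.
  have h3 : 0.368 * (p / (1 - p) ^ 2) ≤ p / (1 - p) - p / 2 := by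
    have : p / (1 - p) - p / 2 - 0.368 * (p / (1 - p) ^ 2) =
        p * ((1 - p) - (1 - p) ^ 2 / 2 - 0.368) / (1 - p) ^ 2 := by field_simp
    have h4 : 0 ≤ (1 - p) - (1 - p) ^ 2 / 2 - 0.368 := by nlinarith
    have : 0 ≤ p / (1 - p) - p / 2 - 0.368 * (p / (1 - p) ^ 2) := by rw [this]; positivity
    linarith
  have h5 : p / (1 - p) = 1 / (1 - p) - 1 := by field_simp; ring
  have h6 : 1 / (1 - p) ≤ 2 := by rw [div_le_iff₀ hr]; linarith
  have h7 : 0.368 * (p / (1 - p) ^ 2) ≤ (1 - φ) ^ (1 - p) + φ / (1 - p) - φ ^ (1 - p) := by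
    have : φ / (1 - p) = φ * (1 / (1 - p)) := by ring
    rw [this]
    nlinarith
  calc p / (1 - p) ^ 2 * Real.log v ≤ p / (1 - p) ^ 2 * (0.368 * v) := by
        gcongr; exact log_le_mul_of_pos hv
    _ = v * (0.368 * (p / (1 - p) ^ 2)) := by ring
    _ ≤ _ := by gcongr

/-- The left side is exactly the geometric mean of 1/b and k^(1/p-1)/X with weights (1-2p)/(1-p) and
p/(1-p); the form of b makes the powers of s match. -/
theorem weighted_sq_step_le {p k X s b : ℝ} (hp0 : 0 < p) (hp : p ≤ 1 / 2) (hk : 0 < k) (hX : 0 < X)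
    (hs : 0 < s) (hb : b = X ^ p * s ^ ((1 - p) / 3)) :
    k * (s ^ (1 / 3 : ℝ) / b ^ 2) ≤
      (1 - 2 * p) / (1 - p) * (1 / b) + p / (1 - p) * (k ^ (1 / p - 1) * X⁻¹) := by
  have hr : 0 < 1 - p := by linarith
  have hX' := Real.rpow_pos_of_pos hX p
  have hs' := Real.rpow_pos_of_pos hs ((1 - p) / 3)
  have hs'' := Real.rpow_pos_of_pos hs (1 / 3)
  have hk' := Real.rpow_pos_of_pos hk (1 / p - 1)
  have hb0 : 0 < b := by rw [hb]; positivity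
  refine le_trans (le_of_eq ?_) (Real.geom_mean_le_arith_mean2_weighted (w₁ := (1 - 2 * p) / (1 - p))
    (w₂ := p / (1 - p)) (p₁ := 1 / b) (p₂ := k ^ (1 / p - 1) * X⁻¹)
    (div_nonneg (by linarith) hr.le) (by positivity) (by positivity) (by positivity)
    (by field_simp; ring))
  have hl : 0 < (1 / b) ^ ((1 - 2 * p) / (1 - p)) := by positivity
  have hl' : 0 < (k ^ (1 / p - 1) * X⁻¹) ^ (p / (1 - p)) := by positivity
  -- The monomial identity becomes linear after taking logarithms.
  refine Real.log_injOn_pos (Set.mem_Ioi.2 (by positivity)) (Set.mem_Ioi.2 (mul_pos hl hl')) ?_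
  have hlb : Real.log b = p * Real.log X + (1 - p) / 3 * Real.log s := by
    rw [hb, Real.log_mul hX'.ne' hs'.ne', Real.log_rpow hX, Real.log_rpow hs]
  rw [Real.log_mul hk.ne' (by positivity), Real.log_div hs''.ne' (by positivity), Real.log_pow,
    Real.log_mul hl.ne' hl'.ne', Real.log_rpow hs, Real.log_rpow (one_div_pos.2 hb0),
    Real.log_rpow (mul_pos hk' (inv_pos.2 hX)), Real.log_mul hk'.ne' (by positivity),
    Real.log_rpow hk, Real.log_inv, one_div b, Real.log_inv, hlb]
  field_simp
  ring

/-- The potential argument that controls the sum of the squared directions along a run. -/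
theorem rpow_sum_dir_le {p k b₀ : ℝ} {S y b : ℕ → ℝ} (hp0 : 0 < p) (hp : p ≤ 1 / 2) (hk : 0 < k)
    (hb₀ : 0 < b₀) (hS1 : ∀ n, 1 ≤ S n) (hmono : Monotone S) (hy : ∀ n, 0 ≤ y n)
    (hb : ∀ n, b n = (b₀ ^ (1 / p) + ∑ i ∈ Finset.range (n + 1), y i) ^ p * S n ^ ((1 - p) / 3))
    (N : ℕ) :
    S N ^ (-((1 - p) / 3)) * (∑ n ∈ Finset.range N, y n) ^ (1 - p) ≤
      b₀ ^ (1 / p - 1) + 2 * ∑ n ∈ Finset.range N, y n / b n -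
        k * ∑ n ∈ Finset.range N, S n ^ (1 / 3 : ℝ) * y n / b n ^ 2 +
        k ^ (1 / p - 1) / (1 - p) * (Real.log (k / b₀) + 1 / 3 * Real.log (S N)) := by
  have hr : 0 < 1 - p := by linarith
  have hB : 0 < b₀ ^ (1 / p) := Real.rpow_pos_of_pos hb₀ _
  set D := ∑ n ∈ Finset.range N, y n with hD
  have hD0 : 0 ≤ D := Finset.sum_nonneg fun n _ => hy n
  set X : ℕ → ℝ := fun n => b₀ ^ (1 / p) + ∑ i ∈ Finset.range n, y i with hXdef
  have hX0 : ∀ n, 0 < X n := fun n => add_pos_of_pos_of_nonneg hB (Finset.sum_nonneg fun n _ => hy n)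
  have hXs : ∀ n, X (n + 1) = X n + y n := fun n => by
    simp only [hXdef, Finset.sum_range_succ, add_assoc]
  have hXm : Monotone X := monotone_nat_of_le_succ fun n => by rw [hXs]; linarith [hy n]
  have hS0 : ∀ n, 0 < S n := fun n => zero_lt_one.trans_le (hS1 n)
  set m := 1 / p - 1 with hm
  have hkm : 0 < k ^ m := Real.rpow_pos_of_pos hk m
  have hXN := hX0 N
  have hsN : 0 < S N ^ ((1 - p) / 3) := Real.rpow_pos_of_pos (hS0 N) _
  have hXp : 0 < X N ^ p := Real.rpow_pos_of_pos hXN p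
  have hb0 : ∀ n, 0 < b n := fun n => by
    rw [hb]; exact mul_pos (Real.rpow_pos_of_pos (hX0 (n + 1)) _) (Real.rpow_pos_of_pos (hS0 n) _)
  -- AM-GM uses up 2 - 1/(1-p) of the coefficient 2 of y/b. The remaining 1/(1-p) is bounded below
  -- with the final value X_N^p S_N^((1-p)/3), which dominates every b n; the other AM-GM part
  -- telescopes to log X.
  have hterm : ∀ n ∈ Finset.range N, 1 / (1 - p) * (y n / (X N ^ p * S N ^ ((1 - p) / 3))) -
      p / (1 - p) * k ^ m * (Real.log (X (n + 1)) - Real.log (X n)) ≤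
      2 * (y n / b n) - k * (S n ^ (1 / 3 : ℝ) * y n / b n ^ 2) := by
    intro n hn
    have hn' : n + 1 ≤ N := Finset.mem_range.1 hn
    have h1 := weighted_sq_step_le hp0 hp hk (hX0 (n + 1)) (hS0 n) (hb n)
    have h2 : b n ≤ X N ^ p * S N ^ ((1 - p) / 3) := by
      rw [hb]
      exact mul_le_mul (Real.rpow_le_rpow (hX0 _).le (hXm hn') hp0.le)
        (Real.rpow_le_rpow (hS0 _).le (hmono (by omega)) (by linarith))
        (Real.rpow_nonneg (hS0 _).le _) hXp.le
    have h3 : y n / (X N ^ p * S N ^ ((1 - p) / 3)) ≤ y n / b n :=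
      div_le_div_of_nonneg_left (hy n) (hb0 n) h2
    have h4 := inv_mul_le_sub_log (hX0 n) (hXm n.le_succ)
    rw [Nat.succ_eq_add_one, hXs, add_sub_cancel_left, ← hXs] at h4
    have h5 := mul_le_mul_of_nonneg_right h1 (hy n)
    have e1 : (1 - 2 * p) / (1 - p) = 2 - 1 / (1 - p) := by field_simp; ring
    have h6 := mul_le_mul_of_nonneg_left h3 (one_div_pos.2 hr).le
    have h7 := mul_le_mul_of_nonneg_left h4 (show 0 ≤ p / (1 - p) * k ^ m by positivity)
    rw [e1] at h5
    have e2 : k * (S n ^ (1 / 3 : ℝ) / b n ^ 2) * y n = k * (S n ^ (1 / 3 : ℝ) * y n / b n ^ 2) := by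
      ring
    have e3 : ((2 - 1 / (1 - p)) * (1 / b n) + p / (1 - p) * (k ^ m * (X (n + 1))⁻¹)) * y n =
        2 * (y n / b n) - 1 / (1 - p) * (y n / b n) +
          p / (1 - p) * k ^ m * ((X (n + 1))⁻¹ * y n) := by ring
    rw [e2, e3] at h5
    linarith
  have hsum := Finset.sum_le_sum hterm
  rw [Finset.sum_sub_distrib, Finset.sum_sub_distrib, ← Finset.mul_sum, ← Finset.mul_sum,
    ← Finset.mul_sum, ← Finset.mul_sum, ← Finset.sum_div, Finset.sum_range_sub
    (fun n => Real.log (X n)), ← hD] at hsum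
  have hX00 : Real.log (X 0) = 1 / p * Real.log b₀ := by
    simp only [hXdef, Finset.range_zero, Finset.sum_empty, add_zero, Real.log_rpow hb₀]
  rw [hX00] at hsum
  -- φ is the share of the directions in X_N = b₀^(1/p) + D, and v (below) is X_N^(1-p)
  -- S_N^(-(1-p)/3) in units of k^(1/p-1). In these terms the claim reduces to `mul_log_le_mul`; the
  -- share 1 - φ accounts for b₀^(1/p-1).
  set φ := D / X N with hφ
  have hφ0 : 0 ≤ φ := by positivity
  have hφ1 : φ ≤ 1 := by
    rw [hφ, div_le_one hXN]; simp only [hXdef]; linarith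
  have eφ : D = φ * X N := by rw [hφ]; field_simp
  set v := X N ^ (1 - p) * S N ^ (-((1 - p) / 3)) / k ^ m with hv
  have hv0 : 0 < v := div_pos (mul_pos (Real.rpow_pos_of_pos hXN _)
    (Real.rpow_pos_of_pos (hS0 N) _)) hkm
  have hlv : Real.log v = (1 - p) * Real.log (X N) - (1 - p) / 3 * Real.log (S N) -
      m * Real.log k := by
    rw [hv, Real.log_div (mul_pos (Real.rpow_pos_of_pos hXN _)
      (Real.rpow_pos_of_pos (hS0 N) _)).ne' hkm.ne', Real.log_mul (Real.rpow_pos_of_pos hXN _).ne'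
      (Real.rpow_pos_of_pos (hS0 N) _).ne', Real.log_rpow hXN, Real.log_rpow (hS0 N),
      Real.log_rpow hk]
    ring
  have hmain := mul_log_le_mul hp0 hp hv0 hφ0 hφ1
  have hvk : k ^ m * v = X N ^ (1 - p) * S N ^ (-((1 - p) / 3)) := by rw [hv]; field_simp
  have g1 : S N ^ (-((1 - p) / 3)) * D ^ (1 - p) = k ^ m * v * φ ^ (1 - p) := by
    rw [hvk, eφ, Real.mul_rpow hφ0 hXN.le]; ring
  have g2 : D / (X N ^ p * S N ^ ((1 - p) / 3)) = k ^ m * v * φ := by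
    rw [hvk, hφ, Real.rpow_sub hXN, Real.rpow_one, Real.rpow_neg (hS0 N).le]
    field_simp
  have g3 : k ^ m * v * (1 - φ) ^ (1 - p) ≤ b₀ ^ m := by
    have e : b₀ ^ (1 / p) = (1 - φ) * X N := by rw [hφ]; field_simp; simp [hXdef, ← hD]
    have e' : b₀ ^ m = (b₀ ^ (1 / p)) ^ (1 - p) := by
      rw [← Real.rpow_mul hb₀.le]; congr 1; rw [hm]; field_simp
    rw [e', e, Real.mul_rpow (by linarith) hXN.le, hvk]
    have : S N ^ (-((1 - p) / 3)) ≤ 1 :=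
      Real.rpow_le_one_of_one_le_of_nonpos (hS1 N) (by linarith)
    have h8 : 0 ≤ X N ^ (1 - p) * (1 - φ) ^ (1 - p) :=
      mul_nonneg (Real.rpow_nonneg hXN.le _) (Real.rpow_nonneg (by linarith) _)
    nlinarith
  have g4 := mul_le_mul_of_nonneg_left hmain hkm.le
  rw [g1, Real.log_div hk.ne' hb₀.ne']
  rw [g2] at hsum
  have hlog : 0 ≤ Real.log (S N) := Real.log_nonneg (hS1 N)
  have g5 : k ^ m / (1 - p) * (Real.log k - Real.log b₀ + 1 / 3 * Real.log (S N)) -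
      p / (1 - p) * k ^ m * (Real.log (X N) - 1 / p * Real.log b₀) =
      1 / 3 * (k ^ m * Real.log (S N)) - k ^ m * (p / (1 - p) ^ 2 * Real.log v) := by
    rw [hlv, hm]; field_simp; ring
  have g6 : 0 ≤ k ^ m * Real.log (S N) := by positivity
  have g7 : k ^ m * (v * ((1 - φ) ^ (1 - p) + φ / (1 - p) - φ ^ (1 - p))) =
      k ^ m * v * (1 - φ) ^ (1 - p) + 1 / (1 - p) * (k ^ m * v * φ) - k ^ m * v * φ ^ (1 - p) := by
    ring
  linarith

end Claim

/-! ### The descent inequality along the run. -/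

section StepDenom

variable {d : ℕ} {Ω : Type*}

/-- The denominator `b_t` of the step size, in terms of the directions and `S_t = a_t ^ (-3/2)`. -/
noncomputable def stepDenom (p b₀ : ℝ) (dir : ℕ → Ω → EuclideanSpace ℝ (Fin d)) (S : ℕ → Ω → ℝ)
    (n : ℕ) (ω : Ω) : ℝ :=
  (b₀ ^ (1 / p) + ∑ i ∈ Finset.range (n + 1), ‖dir i ω‖ ^ 2) ^ p * S n ω ^ ((1 - p) / 3)

end StepDenom

theorem four_mul_sq_div_sq_rpow_third_le {a₀ σhat : ℝ} (ha₀ : 0 < a₀) (hσhat : 0 ≤ σhat) :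
    (4 * σhat ^ 2 / a₀ ^ 2) ^ (1 / 3 : ℝ) ≤ 2 * σhat ^ (2 / 3 : ℝ) / a₀ ^ (2 / 3 : ℝ) := by
  have e : 4 * σhat ^ 2 / a₀ ^ 2 = (2 * σhat / a₀) ^ (2 : ℝ) := by
    rw [Real.rpow_two]; field_simp; ring
  have h2 : (2 : ℝ) ^ (2 / 3 : ℝ) ≤ 2 := by
    calc (2 : ℝ) ^ (2 / 3 : ℝ) ≤ 2 ^ (1 : ℝ) :=
          Real.rpow_le_rpow_of_exponent_le one_le_two (by norm_num)
      _ = 2 := Real.rpow_one 2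
  rw [e, ← Real.rpow_mul (by positivity), Real.div_rpow (by positivity) ha₀.le,
    Real.mul_rpow two_pos.le hσhat]
  norm_num
  gcongr

namespace Trajectory

variable {d : ℕ} {Ω : Type*} [MeasurableSpace Ω] {μ : Measure Ω}
  {σ σhat β p a₀ b₀ η Δ : ℝ} {F : EuclideanSpace ℝ (Fin d) → ℝ}
  {x dir grad ν ν' : ℕ → Ω → EuclideanSpace ℝ (Fin d)} {S : ℕ → Ω → ℝ}

theorem le_stepDenom (h : Trajectory μ σ σhat β p a₀ b₀ η Δ F x dir grad ν ν' S)
    (hp0 : 0 < p) (hp : p ≤ 1 / 2) (hb₀ : 0 < b₀) (n : ℕ) (ω : Ω) :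
    b₀ ≤ stepDenom p b₀ dir S n ω := by
  have h1 : b₀ ≤ (b₀ ^ (1 / p) + ∑ i ∈ Finset.range (n + 1), ‖dir i ω‖ ^ 2) ^ p := by
    calc b₀ = (b₀ ^ (1 / p)) ^ p := by
          rw [← Real.rpow_mul hb₀.le, one_div_mul_cancel hp0.ne', Real.rpow_one]
      _ ≤ _ := Real.rpow_le_rpow (Real.rpow_nonneg hb₀.le _)
        (le_add_of_nonneg_right (Finset.sum_nonneg fun _ _ => sq_nonneg _)) hp0.le
  exact h1.trans (le_mul_of_one_le_right (hb₀.le.trans h1)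
    (Real.one_le_rpow (h.one_le_S n ω) (by linarith)))

theorem x_succ_sub (h : Trajectory μ σ σhat β p a₀ b₀ η Δ F x dir grad ν ν' S) (n : ℕ) (ω : Ω) :
    x (n + 1) ω - x n ω = -(η / stepDenom p b₀ dir S n ω) • dir n ω := by
  have hS := zero_le_one.trans (h.one_le_S n ω)
  have e : stepDenom p b₀ dir S n ω = (b₀ ^ (1 / p) +
    ∑ i ∈ Finset.range (n + 1), ‖dir i ω‖ ^ 2) ^ p /
      (S n ω ^ (-(2 / 3) : ℝ)) ^ ((1 - p) / 2) := by
    rw [stepDenom, ← Real.rpow_mul hS, div_eq_mul_inv _ ((S n ω) ^ _), ← Real.rpow_neg hS]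
    congr 2; ring
  rw [h.x_succ, e, sub_sub_cancel_left, neg_smul]

theorem norm_sq_step (h : Trajectory μ σ σhat β p a₀ b₀ η Δ F x dir grad ν ν' S) (n : ℕ) (ω : Ω) :
    ‖x (n + 1) ω - x n ω‖ ^ 2 = η ^ 2 * (‖dir n ω‖ ^ 2 / stepDenom p b₀ dir S n ω ^ 2) := by
  rw [h.x_succ_sub, norm_smul, mul_pow, norm_neg, Real.norm_eq_abs, sq_abs]
  ring

theorem essBdd_inv_stepDenom (h : Trajectory μ σ σhat β p a₀ b₀ η Δ F x dir grad ν ν' S)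
    (hp0 : 0 < p) (hp : p ≤ 1 / 2) (hb₀ : 0 < b₀) (n : ℕ) :
    EssBdd μ (fun ω => (stepDenom p b₀ dir S n ω)⁻¹) := by
  refine ⟨?_, b₀⁻¹, .of_forall fun ω => ?_⟩
  · unfold stepDenom
    exact (((measurable_const.add (Finset.measurable_sum _ fun i _ =>
      (h.bdd_dir i).meas.norm.pow_const 2)).pow_const p).mul
      ((h.bdd_S n).meas.pow_const _)).inv
  · have := h.le_stepDenom hp0 hp hb₀ n ω
    rw [norm_inv, Real.norm_of_nonneg (hb₀.le.trans this)]
    gcongr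

theorem essBdd_dir_div (h : Trajectory μ σ σhat β p a₀ b₀ η Δ F x dir grad ν ν' S)
    (hp0 : 0 < p) (hp : p ≤ 1 / 2) (hb₀ : 0 < b₀) (n : ℕ) :
    EssBdd μ (fun ω => ‖dir n ω‖ ^ 2 / stepDenom p b₀ dir S n ω) := by
  simp_rw [div_eq_mul_inv]
  exact (h.bdd_dir n).norm.sq.mul (h.essBdd_inv_stepDenom hp0 hp hb₀ n)

theorem essBdd_dir_div_sq (h : Trajectory μ σ σhat β p a₀ b₀ η Δ F x dir grad ν ν' S)
    (hp0 : 0 < p) (hp : p ≤ 1 / 2) (hb₀ : 0 < b₀) (n : ℕ) :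
    EssBdd μ (fun ω => S n ω ^ (1 / 3 : ℝ) * ‖dir n ω‖ ^ 2 / stepDenom p b₀ dir S n ω ^ 2) := by
  simp_rw [div_eq_mul_inv, ← inv_pow]
  exact ((h.essBdd_rpow n _).mul (h.bdd_dir n).norm.sq).mul
    (h.essBdd_inv_stepDenom hp0 hp hb₀ n).sq

/-- Summing the descent inequality along the run. -/
theorem ae_two_mul_sum_dir_le (h : Trajectory μ σ σhat β p a₀ b₀ η Δ F x dir grad ν ν' S)
    (ha₀ : 0 < a₀) (hσhat : 0 ≤ σhat) (hβ : 0 ≤ β) (hη : 0 < η) (hp0 : 0 < p) (hp : p ≤ 1 / 2)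
    (hb₀ : 0 < b₀) {c : ℝ} (hc : 0 < c) (N : ℕ) : ∀ᵐ ω ∂μ,
    2 * ∑ n ∈ Finset.range N, ‖dir n ω‖ ^ 2 / stepDenom p b₀ dir S n ω ≤
      2 / η * Δ + c⁻¹ * ∑ n ∈ Finset.range N,
        S (n + 1) ω ^ (-(1 / 3) : ℝ) * ‖dir n ω - grad n ω‖ ^ 2 +
      (η * β + c * (1 + 2 * σhat ^ (2 / 3 : ℝ) / a₀ ^ (2 / 3 : ℝ))) * ∑ n ∈ Finset.range N,
        S n ω ^ (1 / 3 : ℝ) * ‖dir n ω‖ ^ 2 / stepDenom p b₀ dir S n ω ^ 2 := by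
  filter_upwards [h.ae_S_step] with ω hstep
  set δ := 4 * σhat ^ 2 / a₀ ^ 2
  have hδ0 : 0 ≤ δ := by positivity
  have hu := four_mul_sq_div_sq_rpow_third_le ha₀ hσhat
  set U := 2 * σhat ^ (2 / 3 : ℝ) / a₀ ^ (2 / 3 : ℝ)
  have hU0 : 0 ≤ U := by positivity
  have hterm : ∀ n ∈ Finset.range N, 2 * (‖dir n ω‖ ^ 2 / stepDenom p b₀ dir S n ω) ≤
      2 / η * (F (x n ω) - F (x (n + 1) ω)) + c⁻¹ *
        (S (n + 1) ω ^ (-(1 / 3) : ℝ) * ‖dir n ω - grad n ω‖ ^ 2) +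
      (η * β + c * (1 + U)) *
        (S n ω ^ (1 / 3 : ℝ) * ‖dir n ω‖ ^ 2 / stepDenom p b₀ dir S n ω ^ 2) := by
    intro n _
    have hd := h.descent n ω
    rw [h.norm_sq_step] at hd
    rw [h.x_succ_sub] at hd
    have hb0 : 0 < stepDenom p b₀ dir S n ω := hb₀.trans_le (h.le_stepDenom hp0 hp hb₀ n ω)
    set b := stepDenom p b₀ dir S n ω
    have hi : inner ℝ (grad n ω) (-(η / b) • dir n ω) =
        -η * (‖dir n ω‖ ^ 2 / b) + η * (inner ℝ (dir n ω - grad n ω) (dir n ω) / b) := by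
      rw [inner_smul_right, inner_sub_left, real_inner_self_eq_norm_sq]
      ring
    rw [hi] at hd
    have hS1 := h.one_le_S n ω
    have hS0 : 0 < S (n + 1) ω := zero_lt_one.trans_le (h.one_le_S (n + 1) ω)
    have hw := rpow_le_rpow_add (r := 1 / 3) (zero_lt_one.trans_le hS1) hδ0 (h.S_le_succ n ω)
      (hstep n) (by norm_num) (by norm_num)
    have hw1 : 1 ≤ S n ω ^ (1 / 3 : ℝ) := Real.one_le_rpow hS1 (by norm_num)
    have hW : 0 < S (n + 1) ω ^ (1 / 3 : ℝ) := Real.rpow_pos_of_pos hS0 _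
    rw [Real.rpow_neg hS0.le]
    have hw2 : S (n + 1) ω ^ (1 / 3 : ℝ) ≤ (1 + U) * S n ω ^ (1 / 3 : ℝ) := by nlinarith
    set W := S (n + 1) ω ^ (1 / 3 : ℝ)
    set w := S n ω ^ (1 / 3 : ℝ)
    have hcs := real_inner_le_norm (dir n ω - grad n ω) (dir n ω)
    set e := ‖dir n ω - grad n ω‖
    set D := ‖dir n ω‖
    set I := inner ℝ (dir n ω - grad n ω) (dir n ω)
    -- Young's inequality with weight cW. The power of S is placed so that the error appears with
    -- the weight S^(-1/3) = a^(1/2) of the next iteration, the one in `integral_err_le` at ℓ = 1/4.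
    have h1 : 2 * (I / b) ≤ c⁻¹ * (W⁻¹ * e ^ 2) + c * W * (D ^ 2 / b ^ 2) := by
      have h2 : 2 * (I / b) ≤ 2 * (e * D / b) := by gcongr
      have h3 : c⁻¹ * (W⁻¹ * e ^ 2) + c * W * (D ^ 2 / b ^ 2) - 2 * (e * D / b) =
          (c * W)⁻¹ * (e - c * W * (D / b)) ^ 2 := by field_simp; ring
      have h4 : 0 ≤ (c * W)⁻¹ * (e - c * W * (D / b)) ^ 2 := by positivity
      linarith
    have h5 : 0 ≤ D ^ 2 / b ^ 2 := by positivity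
    have h6 : c * W * (D ^ 2 / b ^ 2) ≤ c * ((1 + U) * w) * (D ^ 2 / b ^ 2) := by gcongr
    have h7 : η * β * (D ^ 2 / b ^ 2) ≤ η * β * (w * (D ^ 2 / b ^ 2)) := by
      gcongr; exact le_mul_of_one_le_left h5 hw1
    have h8 : 2 * (D ^ 2 / b) ≤ 2 / η * (F (x n ω) - F (x (n + 1) ω)) + 2 * (I / b) +
        η * β * (D ^ 2 / b ^ 2) := by
      have h9 : 0 ≤ 2 / η * (F (x n ω) + (-η * (D ^ 2 / b) + η * (I / b)) +
          β / 2 * (η ^ 2 * (D ^ 2 / b ^ 2)) - F (x (n + 1) ω)) :=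
        mul_nonneg (by positivity) (by linarith)
      have h10 : 2 / η * (F (x n ω) + (-η * (D ^ 2 / b) + η * (I / b)) +
          β / 2 * (η ^ 2 * (D ^ 2 / b ^ 2)) - F (x (n + 1) ω)) =
          2 / η * (F (x n ω) - F (x (n + 1) ω)) - 2 * (D ^ 2 / b) + 2 * (I / b) +
            η * β * (D ^ 2 / b ^ 2) := by field_simp; ring
      linarith
    have h11 : (η * β + c * (1 + U)) * (w * D ^ 2 / b ^ 2) =
        η * β * (w * (D ^ 2 / b ^ 2)) + c * ((1 + U) * w) * (D ^ 2 / b ^ 2) := by ring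
    linarith
  have hsum := Finset.sum_le_sum hterm
  rw [Finset.sum_add_distrib, Finset.sum_add_distrib, ← Finset.mul_sum, ← Finset.mul_sum,
    ← Finset.mul_sum, ← Finset.mul_sum,
    Finset.sum_range_sub' (fun n => F (x n ω))] at hsum
  have hg := mul_le_mul_of_nonneg_left (h.gap N ω) (show 0 ≤ 2 / η by positivity)
  linarith

variable [IsProbabilityMeasure μ]

/-- Inserting the error bound at ℓ = 1/4 into the summed descent inequality produces the same
quadratic sum of steps again. Its total coefficient is at most K₈ + K₉, so it can be moved to the
left, where `rpow_sum_dir_le` expects it. -/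
theorem integral_dir_sub_le (h : Trajectory μ σ σhat β p a₀ b₀ η Δ F x dir grad ν ν' S)
    (ha₀ : 0 < a₀) (hσhat : 0 ≤ σhat) (hβ : 0 ≤ β) (hη : 0 < η) (hp0 : 0 < p) (hp : p ≤ 1 / 2)
    (hb₀ : 0 < b₀) {lam : ℝ} (hlam : 0 < lam) (M : ℕ) :
    ∫ ω, (2 * ∑ n ∈ Finset.range (M + 1), ‖dir n ω‖ ^ 2 / stepDenom p b₀ dir S n ω -
        (K₈ a₀ η σhat β lam + K₉ a₀ η σhat β lam) * ∑ n ∈ Finset.range (M + 1),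
          S n ω ^ (1 / 3 : ℝ) * ‖dir n ω‖ ^ 2 / stepDenom p b₀ dir S n ω ^ 2) ∂μ ≤
      2 / η * Δ + lam * K₁ a₀ σ σhat (1 / 4) / (η * max β 1) +
        K₆ a₀ η β lam * Real.log (1 + 2 * σ ^ 2 * (M + 1 : ℕ) / a₀ ^ 2) := by
  set m := max β 1 with hm
  have hm0 : 0 < m := lt_max_of_lt_right zero_lt_one
  have hmβ : β ≤ m := le_max_left _ _
  -- The Young parameter is c = ηm/λ with m = max(β, 1). It makes all quadratic contributions
  -- proportional to ηm and is the source of the free parameter λ.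
  have hc : 0 < η * m / lam := by positivity
  have hu : 0 ≤ 2 * σhat ^ (2 / 3 : ℝ) / a₀ ^ (2 / 3 : ℝ) := by positivity
  have hK₃ := K₃_nonneg (ℓ := 1 / 4) ha₀ hσhat
  have herr := h.integral_err_le ha₀ hσhat (ℓ := 1 / 4) le_rfl (by norm_num) M
  rw [if_pos rfl, show (4 * (1 / 4) / 3 - 2 / 3 : ℝ) = -(1 / 3) by norm_num,
    show (4 * (1 / 4) / 3 : ℝ) = 1 / 3 by norm_num,
    show (3 * (1 + 2 * (1 / 4) ^ 2) / (1 / 4) ^ 2 : ℝ) = 54 by norm_num] at herr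
  have hE : EssBdd μ (fun ω => ∑ n ∈ Finset.range (M + 1),
      S (n + 1) ω ^ (-(1 / 3) : ℝ) * ‖dir n ω - grad n ω‖ ^ 2) :=
    EssBdd.sum _ fun n _ => (h.essBdd_rpow (n + 1) _).mul (h.essBdd_err n).norm.sq
  have hQ : EssBdd μ (fun ω => ∑ n ∈ Finset.range (M + 1),
      S n ω ^ (1 / 3 : ℝ) * ‖dir n ω‖ ^ 2 / stepDenom p b₀ dir S n ω ^ 2) :=
    EssBdd.sum _ fun n _ => h.essBdd_dir_div_sq hp0 hp hb₀ n
  have hL : EssBdd μ (fun ω => ∑ n ∈ Finset.range (M + 1),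
      ‖dir n ω‖ ^ 2 / stepDenom p b₀ dir S n ω) :=
    EssBdd.sum _ fun n _ => h.essBdd_dir_div hp0 hp hb₀ n
  have herr2 : ∫ ω, ∑ n ∈ Finset.range (M + 1), (K₃ a₀ σhat (1 / 4) + 54 * S n ω ^ (1 / 3 : ℝ)) *
      ‖x (n + 1) ω - x n ω‖ ^ 2 ∂μ ≤ (K₃ a₀ σhat (1 / 4) + 54) * η ^ 2 *
        ∫ ω, ∑ n ∈ Finset.range (M + 1),
          S n ω ^ (1 / 3 : ℝ) * ‖dir n ω‖ ^ 2 / stepDenom p b₀ dir S n ω ^ 2 ∂μ := by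
    rw [← integral_const_mul]
    refine integral_mono (EssBdd.sum _ fun n _ => ((EssBdd.const _).add
      ((h.essBdd_rpow n _).const_mul 54)).mul (h.essBdd_sqStep n)).integrable
      (hQ.const_mul _).integrable fun ω => ?_
    simp only
    rw [Finset.mul_sum]
    refine Finset.sum_le_sum fun n _ => ?_
    rw [h.norm_sq_step]
    have hw1 : 1 ≤ S n ω ^ (1 / 3 : ℝ) := Real.one_le_rpow (h.one_le_S n ω) (by norm_num)
    set w := S n ω ^ (1 / 3 : ℝ)
    set Z := ‖dir n ω‖ ^ 2 / stepDenom p b₀ dir S n ω ^ 2 with hZ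
    have hZ0 : 0 ≤ Z := by positivity
    rw [mul_div_assoc, ← hZ]
    calc (K₃ a₀ σhat (1 / 4) + 54 * w) * (η ^ 2 * Z) ≤
        (K₃ a₀ σhat (1 / 4) * w + 54 * w) * (η ^ 2 * Z) := by
          gcongr; exact le_mul_of_one_le_right hK₃ hw1
      _ = _ := by ring
  have hQ0 : 0 ≤ ∫ ω, ∑ n ∈ Finset.range (M + 1),
      S n ω ^ (1 / 3 : ℝ) * ‖dir n ω‖ ^ 2 / stepDenom p b₀ dir S n ω ^ 2 ∂μ :=
    integral_nonneg fun ω => Finset.sum_nonneg fun n _ => by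
      have := Real.rpow_nonneg (zero_le_one.trans (h.one_le_S n ω)) (1 / 3)
      positivity
  have hdesc := integral_mono_ae (hL.const_mul 2).integrable
    (((EssBdd.const (2 / η * Δ)).add (hE.const_mul _)).add (hQ.const_mul _)).integrable
    (h.ae_two_mul_sum_dir_le ha₀ hσhat hβ hη hp0 hp hb₀ hc (M + 1))
  rw [integral_add ((EssBdd.const (2 / η * Δ)).add (hE.const_mul _)).integrable
    (hQ.const_mul _).integrable, integral_add (integrable_const _) (hE.const_mul _).integrable,
    integral_const_mul, integral_const_mul, integral_const_mul, integral_const_mul] at hdesc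
  simp only [integral_const, probReal_univ, one_smul] at hdesc
  rw [integral_sub (hL.const_mul 2).integrable (hQ.const_mul _).integrable, integral_const_mul,
    integral_const_mul]
  set Lg := Real.log (1 + 2 * σ ^ 2 * (M + 1 : ℕ) / a₀ ^ 2)
  set IE := ∫ ω, ∑ n ∈ Finset.range (M + 1),
      S (n + 1) ω ^ (-(1 / 3) : ℝ) * ‖dir n ω - grad n ω‖ ^ 2 ∂μ
  set IQ := ∫ ω, ∑ n ∈ Finset.range (M + 1),
      S n ω ^ (1 / 3 : ℝ) * ‖dir n ω‖ ^ 2 / stepDenom p b₀ dir S n ω ^ 2 ∂μ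
  have k1 : IE ≤ K₁ a₀ σ σhat (1 / 4) + K₂ a₀ (1 / 4) * Lg +
      m ^ 2 * ((K₃ a₀ σhat (1 / 4) + 54) * η ^ 2 * IQ) := by
    refine herr.trans ?_
    gcongr
    · exact integral_nonneg fun ω => Finset.sum_nonneg fun n _ => by
        have := Real.rpow_nonneg (zero_le_one.trans (h.one_le_S n ω)) (1 / 3)
        positivity
  have k2 := mul_le_mul_of_nonneg_left k1 (inv_pos.2 hc).le
  have k3 : (η * m / lam)⁻¹ * (K₁ a₀ σ σhat (1 / 4) + K₂ a₀ (1 / 4) * Lg +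
      m ^ 2 * ((K₃ a₀ σhat (1 / 4) + 54) * η ^ 2 * IQ)) =
      lam * K₁ a₀ σ σhat (1 / 4) / (η * m) + K₆ a₀ η β lam * Lg +
        lam * (K₃ a₀ σhat (1 / 4) + 54) * (η * m) * IQ := by
    rw [K₆, ← hm]; field_simp
  have k4 : η * β * IQ ≤ η * m * IQ := by gcongr
  have k5 : K₈ a₀ η σhat β lam + K₉ a₀ η σhat β lam =
      η * m + η * m / lam * (1 + 2 * σhat ^ (2 / 3 : ℝ) / a₀ ^ (2 / 3 : ℝ)) +
        lam * (K₃ a₀ σhat (1 / 4) + 54) * (η * m) := by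
    rw [K₈, K₉, ← hm]; field_simp; ring
  rw [k5]
  linarith

end Trajectory

/-! ### Signs of the constants in the direction bound. -/

section Base

/-- The base of the power in `boundD`. -/
noncomputable def dirBase (p a₀ b₀ η σ σhat β Δ lam s : ℝ) : ℝ :=
  K₅ p a₀ b₀ η σ σhat β Δ lam + (K₆ a₀ η β lam + K₇ p a₀ η σhat β lam / 3) * Real.log s +
    K₇ p a₀ η σhat β lam * Real.log ((K₈ a₀ η σhat β lam + K₉ a₀ η σhat β lam) / b₀)

theorem boundD_eq (p a₀ b₀ η σ σhat β Δ lam s : ℝ) :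
    boundD p b₀ (K₅ p a₀ b₀ η σ σhat β Δ lam) (K₆ a₀ η β lam) (K₇ p a₀ η σhat β lam)
      (K₈ a₀ η σhat β lam) (K₉ a₀ η σhat β lam) s =
      dirBase p a₀ b₀ η σ σhat β Δ lam s ^ (pHat p / (1 - p)) * s ^ (pHat p / 3) := rfl

variable {p a₀ b₀ η σ σhat β Δ lam s : ℝ}

theorem K₈_add_K₉_pos (ha₀ : 0 < a₀) (hσhat : 0 ≤ σhat) (hη : 0 < η) (hlam : 0 < lam) :
    0 < K₈ a₀ η σhat β lam + K₉ a₀ η σhat β lam := by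
  have hK₃ := K₃_nonneg (ℓ := 1 / 4) ha₀ hσhat
  have hm : 0 < max β 1 := lt_max_of_lt_right zero_lt_one
  unfold K₈ K₉
  positivity

theorem K₇_nonneg (hp : p ≤ 1 / 2) (ha₀ : 0 < a₀) (hσhat : 0 ≤ σhat) (hη : 0 < η)
    (hlam : 0 < lam) : 0 ≤ K₇ p a₀ η σhat β lam := by
  have hk := K₈_add_K₉_pos (β := β) ha₀ hσhat hη hlam
  have hr : 0 < 1 - p := by linarith
  unfold K₇
  positivity

/-- The logarithm may be negative; the empty sum, N = 0, in `rpow_sum_dir_le` shows that it never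
outweighs the first term. -/
theorem rpow_add_K₇_mul_log_nonneg (hp0 : 0 < p) (hp : p ≤ 1 / 2) (ha₀ : 0 < a₀) (hb₀ : 0 < b₀)
    (hσhat : 0 ≤ σhat) (hη : 0 < η) (hlam : 0 < lam) :
    0 ≤ b₀ ^ (1 / p - 1) + K₇ p a₀ η σhat β lam *
      Real.log ((K₈ a₀ η σhat β lam + K₉ a₀ η σhat β lam) / b₀) := by
  have hk := K₈_add_K₉_pos (β := β) ha₀ hσhat hη hlam
  have := rpow_sum_dir_le (S := fun _ => 1) (y := fun _ => 0) hp0 hp hk hb₀ (fun _ => le_rfl)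
    monotone_const (fun _ => le_rfl) (fun _ => rfl) 0
  have hr : 1 - p ≠ 0 := by linarith
  simpa [hr, K₇] using this

theorem dirBase_nonneg (hp0 : 0 < p) (hp : p ≤ 1 / 2) (ha₀ : 0 < a₀) (hb₀ : 0 < b₀) (hσhat : 0 ≤ σhat)
    (hη : 0 < η) (hlam : 0 < lam) (hΔ : 0 ≤ Δ) (hs : 1 ≤ s) :
    0 ≤ dirBase p a₀ b₀ η σ σhat β Δ lam s := by
  have h1 := rpow_add_K₇_mul_log_nonneg (β := β) hp0 hp ha₀ hb₀ hσhat hη hlam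
  have h2 := K₇_nonneg (β := β) hp ha₀ hσhat hη hlam
  have h3 := K₁_nonneg (σ := σ) (ℓ := 1 / 4) ha₀ hσhat
  have h4 := K₂_nonneg (a₀ := a₀) (ℓ := 1 / 4) le_rfl
  have hm : 0 < max β 1 := lt_max_of_lt_right zero_lt_one
  have hlog := Real.log_nonneg hs
  have h5 : 0 ≤ (K₆ a₀ η β lam + K₇ p a₀ η σhat β lam / 3) * Real.log s := by
    unfold K₆; positivity
  have h6 : 0 ≤ 2 / η * Δ + lam * K₁ a₀ σ σhat (1 / 4) / (η * max β 1) := by positivity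
  unfold dirBase K₅
  linarith

end Base

/-! ### Moment bound for the directions. -/

namespace Trajectory

variable {d : ℕ} {Ω : Type*} [MeasurableSpace Ω] {μ : Measure Ω}
  {σ σhat β p a₀ b₀ η Δ : ℝ} {F : EuclideanSpace ℝ (Fin d) → ℝ}
  {x dir grad ν ν' : ℕ → Ω → EuclideanSpace ℝ (Fin d)} {S : ℕ → Ω → ℝ}

theorem essBdd_sumDir (h : Trajectory μ σ σhat β p a₀ b₀ η Δ F x dir grad ν ν' S) (N : ℕ) :
    EssBdd μ (fun ω => ∑ n ∈ Finset.range N, ‖dir n ω‖ ^ 2) :=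
  EssBdd.sum _ fun n _ => (h.bdd_dir n).norm.sq

theorem essBdd_sumErr (h : Trajectory μ σ σhat β p a₀ b₀ η Δ F x dir grad ν ν' S) (N : ℕ) :
    EssBdd μ (fun ω => ∑ n ∈ Finset.range N, ‖dir n ω - grad n ω‖ ^ 2) :=
  EssBdd.sum _ fun n _ => (h.essBdd_err n).norm.sq

/-- The total movement, weighted as in the error bound with `ℓ = q`. -/
theorem sum_weighted_step_le (h : Trajectory μ σ σhat β p a₀ b₀ η Δ F x dir grad ν ν' S)
    (hp0 : 0 < p) (hp : p ≤ 1 / 2) (hb₀ : 0 < b₀) (N : ℕ) (ω : Ω) :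
    ∑ n ∈ Finset.range N, S n ω ^ (2 * (1 - p) / 3) * ‖x (n + 1) ω - x n ω‖ ^ 2 ≤
      η ^ 2 * if p = 1 / 2 then
        Real.log (1 + (∑ n ∈ Finset.range N, ‖dir n ω‖ ^ 2) / b₀ ^ 2) else
        (∑ n ∈ Finset.range N, ‖dir n ω‖ ^ 2) ^ (1 - 2 * p) / (1 - 2 * p) := by
  have hB : 0 < b₀ ^ (1 / p) := Real.rpow_pos_of_pos hb₀ _
  set X : ℕ → ℝ := fun n => b₀ ^ (1 / p) + ∑ i ∈ Finset.range n, ‖dir i ω‖ ^ 2 with hXdef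
  have hX0 : ∀ n, 0 < X n := fun n =>
    add_pos_of_pos_of_nonneg hB (Finset.sum_nonneg fun n _ => sq_nonneg _)
  have hXs : ∀ n, X (n + 1) = X n + ‖dir n ω‖ ^ 2 := fun n => by
    simp only [hXdef, Finset.sum_range_succ, add_assoc]
  have hXm : ∀ n, X n ≤ X (n + 1) := fun n => by rw [hXs]; linarith [sq_nonneg ‖dir n ω‖]
  -- The weight is exactly the power of S n in the squared step denominator, so S disappears and
  -- only increments of X divided by X^(2p) remain.
  have hterm : ∀ n, S n ω ^ (2 * (1 - p) / 3) * ‖x (n + 1) ω - x n ω‖ ^ 2 =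
      η ^ 2 * (X (n + 1) ^ (-(2 * p)) * (X (n + 1) - X n)) := fun n => by
    have hS0 : 0 < S n ω := zero_lt_one.trans_le (h.one_le_S n ω)
    have hSp := Real.rpow_pos_of_pos hS0 ((1 - p) / 3)
    have e1 : stepDenom p b₀ dir S n ω = X (n + 1) ^ p * S n ω ^ ((1 - p) / 3) := rfl
    have e2 : S n ω ^ (2 * (1 - p) / 3) = (S n ω ^ ((1 - p) / 3)) ^ 2 := by
      rw [← Real.rpow_mul_natCast hS0.le]; congr 1; push_cast; ring
    have e3 : X (n + 1) ^ (-(2 * p)) = ((X (n + 1) ^ p) ^ 2)⁻¹ := by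
      rw [← Real.rpow_mul_natCast (hX0 _).le, ← Real.rpow_neg (hX0 _).le]; congr 1; push_cast; ring
    rw [h.norm_sq_step, e1, e2, e3, hXs]
    have := Real.rpow_pos_of_pos (hX0 (n + 1)) p
    field_simp
    ring
  simp_rw [hterm]
  rw [← Finset.mul_sum]
  refine mul_le_mul_of_nonneg_left ?_ (sq_nonneg η)
  split_ifs with hq
  · have h1 : ∀ n ∈ Finset.range N, X (n + 1) ^ (-(2 * p)) * (X (n + 1) - X n) ≤
        Real.log (X (n + 1)) - Real.log (X n) := fun n _ => by
      have := inv_mul_le_sub_log (hX0 n) (hXm n)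
      rwa [hq, show -(2 * (1 / 2 : ℝ)) = -1 by norm_num, Real.rpow_neg_one]
    refine (Finset.sum_le_sum h1).trans ?_
    rw [Finset.sum_range_sub (fun n => Real.log (X n)), ← Real.log_div (hX0 N).ne' (hX0 0).ne']
    refine le_of_eq ?_
    have e : b₀ ^ (1 / p) = b₀ ^ 2 := by
      rw [hq, show (1 / (1 / 2) : ℝ) = (2 : ℕ) by norm_num, Real.rpow_natCast]
    simp only [hXdef, e, Finset.range_zero, Finset.sum_empty, add_zero]
    congr 1
    field_simp
  · have hκ : 0 < 1 - 2 * p := by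
      rcases hp.eq_or_lt with h1 | h1
      · exact absurd h1 hq
      · linarith
    have h1 : ∀ n ∈ Finset.range N, X (n + 1) ^ (-(2 * p)) * (X (n + 1) - X n) ≤
        X (n + 1) ^ (1 - 2 * p) / (1 - 2 * p) - X n ^ (1 - 2 * p) / (1 - 2 * p) := fun n _ => by
      have := mul_rpow_le_sub_rpow hκ (by linarith) (hX0 n) (hXm n)
      rwa [sub_sub_cancel_left, sub_div] at this
    refine (Finset.sum_le_sum h1).trans ?_
    rw [Finset.sum_range_sub (fun n => X n ^ (1 - 2 * p) / (1 - 2 * p)), ← sub_div]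
    gcongr
    have := rpow_add_le_of_le_one hB.le (Finset.sum_nonneg fun n (_ : n ∈ Finset.range N) =>
      sq_nonneg ‖dir n ω‖) hκ.le (by linarith : 1 - 2 * p ≤ 1)
    simp only [hXdef, Finset.range_zero, Finset.sum_empty, add_zero]
    linarith

variable [IsProbabilityMeasure μ]

/-- The expectation of `rpow_sum_dir_le` with k = K₈ + K₉: the difference of sums is
`integral_dir_sub_le`, and log S is treated by Jensen. -/
theorem integral_weighted_sumDir_le (h : Trajectory μ σ σhat β p a₀ b₀ η Δ F x dir grad ν ν' S)
    (ha₀ : 0 < a₀) (hσhat : 0 ≤ σhat) (hβ : 0 ≤ β) (hη : 0 < η) (hp0 : 0 < p) (hp : p ≤ 1 / 2)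
    (hb₀ : 0 < b₀) {lam : ℝ} (hlam : 0 < lam) (M : ℕ) :
    ∫ ω, S (M + 1) ω ^ (-((1 - p) / 3)) *
        (∑ n ∈ Finset.range (M + 1), ‖dir n ω‖ ^ 2) ^ (1 - p) ∂μ ≤
      dirBase p a₀ b₀ η σ σhat β Δ lam (1 + 2 * σ ^ 2 * (M + 1 : ℕ) / a₀ ^ 2) := by
  have hk := K₈_add_K₉_pos (β := β) ha₀ hσhat hη hlam
  have hK₇ := K₇_nonneg (β := β) hp ha₀ hσhat hη hlam
  have hmain := h.integral_dir_sub_le ha₀ hσhat hβ hη hp0 hp hb₀ hlam M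
  have hlogS := h.integral_log_S_le (M + 1)
  set k := K₈ a₀ η σhat β lam + K₉ a₀ η σhat β lam with hkdef
  have hQ := (EssBdd.sum (Finset.range (M + 1)) fun n _ =>
    h.essBdd_dir_div_sq hp0 hp hb₀ n).const_mul k
  have hL := (EssBdd.sum (Finset.range (M + 1)) fun n _ =>
    h.essBdd_dir_div hp0 hp hb₀ n).const_mul 2
  have hlog := (h.bdd_S (M + 1)).log_of_one_le (h.one_le_S (M + 1))
  have hle := integral_mono
    (((h.essBdd_rpow (M + 1) (-((1 - p) / 3))).mul ((h.essBdd_sumDir (M + 1)).rpow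
      (fun ω => Finset.sum_nonneg fun _ _ => sq_nonneg _) (show 0 ≤ 1 - p by linarith))).integrable)
    (((hL.sub hQ).add (EssBdd.const (b₀ ^ (1 / p - 1) + K₇ p a₀ η σhat β lam *
      Real.log (k / b₀)))).add (hlog.const_mul (K₇ p a₀ η σhat β lam / 3))).integrable
    (fun ω => by
      have := rpow_sum_dir_le (b := fun n => stepDenom p b₀ dir S n ω) hp0 hp hk hb₀
        (fun n => h.one_le_S n ω) (h.monotone_S ω) (fun n => sq_nonneg ‖dir n ω‖) (fun n => rfl)
        (M + 1)
      rw [show k ^ (1 / p - 1) / (1 - p) = K₇ p a₀ η σhat β lam from rfl] at this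
      simp only
      linarith)
  rw [integral_add ((hL.sub hQ).add (EssBdd.const _)).integrable (hlog.const_mul _).integrable,
    integral_add (hL.sub hQ).integrable (integrable_const _), integral_const_mul] at hle
  simp only [integral_const, probReal_univ, one_smul] at hle
  have h3 := mul_le_mul_of_nonneg_left hlogS (show 0 ≤ K₇ p a₀ η σhat β lam / 3 by linarith)
  unfold dirBase K₅
  rw [← hkdef]
  linarith

/-- The bound on the sum of the squared directions. -/
theorem integral_sumDir_rpow_le (h : Trajectory μ σ σhat β p a₀ b₀ η Δ F x dir grad ν ν' S)
    (ha₀ : 0 < a₀) (hσhat : 0 ≤ σhat) (hβ : 0 ≤ β) (hη : 0 < η) (hp0 : 0 < p) (hp : p ≤ 1 / 2)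
    (hb₀ : 0 < b₀) {lam : ℝ} (hlam : 0 < lam) (M : ℕ) :
    ∫ ω, (∑ n ∈ Finset.range (M + 1), ‖dir n ω‖ ^ 2) ^ pHat p ∂μ ≤
      dirBase p a₀ b₀ η σ σhat β Δ lam (1 + 2 * σ ^ 2 * (M + 1 : ℕ) / a₀ ^ 2) ^
        (pHat p / (1 - p)) * (1 + 2 * σ ^ 2 * (M + 1 : ℕ) / a₀ ^ 2) ^ (pHat p / 3) := by
  have hr : 0 < 1 - p := by linarith
  have h4 : 0 < 4 - p := by linarith
  have e1 : pHat p / (1 - p) = 3 / (4 - p) := by unfold pHat; field_simp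
  have e2 : pHat p / 3 = 1 - 3 / (4 - p) := by unfold pHat; field_simp; ring
  have hD0 : ∀ ω, 0 ≤ ∑ n ∈ Finset.range (M + 1), ‖dir n ω‖ ^ 2 := fun ω =>
    Finset.sum_nonneg fun _ _ => sq_nonneg _
  have hS1 := h.one_le_S (M + 1)
  have hS0 : ∀ ω, 0 < S (M + 1) ω := fun ω => zero_lt_one.trans_le (hS1 ω)
  -- θ is chosen so that the powers of S cancel: the factor S^(-(1-p)/3) to the power θ is
  -- compensated by S^(1-θ). The remaining exponent of D is (1-p)θ = p̂, which is the origin of p̂.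
  have hH := integral_rpow_mul_rpow_le (θ := 3 / (4 - p))
    ((h.essBdd_rpow (M + 1) (-((1 - p) / 3))).mul ((h.essBdd_sumDir (M + 1)).rpow hD0 hr.le))
    (h.bdd_S (M + 1)) (fun ω => mul_nonneg (Real.rpow_nonneg (hS0 ω).le _)
      (Real.rpow_nonneg (hD0 ω) _)) (fun ω => (hS0 ω).le) (by positivity)
    (by rw [div_lt_one h4]; linarith)
  have hI := h.integral_weighted_sumDir_le ha₀ hσhat hβ hη hp0 hp hb₀ hlam M
  have hI2 := h.integral_S_le (M + 1)
  rw [e1, e2]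
  calc _ = ∫ ω, (S (M + 1) ω ^ (-((1 - p) / 3)) *
        (∑ n ∈ Finset.range (M + 1), ‖dir n ω‖ ^ 2) ^ (1 - p)) ^ (3 / (4 - p)) *
          S (M + 1) ω ^ (1 - 3 / (4 - p)) ∂μ := by
        congr 1; ext ω
        rw [Real.mul_rpow (Real.rpow_nonneg (hS0 ω).le _) (Real.rpow_nonneg (hD0 ω) _),
          ← Real.rpow_mul (hS0 ω).le, ← Real.rpow_mul (hD0 ω), mul_right_comm,
          ← Real.rpow_add (hS0 ω)]
        have e3 : -((1 - p) / 3) * (3 / (4 - p)) + (1 - 3 / (4 - p)) = 0 := by field_simp; ring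
        have e4 : (1 - p) * (3 / (4 - p)) = pHat p := by unfold pHat; ring
        rw [e3, e4, Real.rpow_zero, one_mul]
    _ ≤ _ := hH
    _ ≤ _ := by
        have hi1 : 0 ≤ ∫ ω, S (M + 1) ω ^ (-((1 - p) / 3)) *
            (∑ n ∈ Finset.range (M + 1), ‖dir n ω‖ ^ 2) ^ (1 - p) ∂μ :=
          integral_nonneg fun ω => mul_nonneg (Real.rpow_nonneg (hS0 ω).le _)
            (Real.rpow_nonneg (hD0 ω) _)
        have hi2 : 0 ≤ ∫ ω, S (M + 1) ω ∂μ := integral_nonneg fun ω => (hS0 ω).le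
        refine mul_le_mul (Real.rpow_le_rpow hi1 hI (by positivity))
          (Real.rpow_le_rpow hi2 hI2 ?_) (Real.rpow_nonneg hi2 _)
          (Real.rpow_nonneg (hi1.trans hI) _)
        rw [sub_nonneg, div_le_one h4]; linarith

end Trajectory

/-! ### Solving the self-bounding inequality; the admissible range of p. -/

section Solve

variable {p b₀ k₁ k₂ k₄ s : ℝ}

theorem pHat_pos (hp : p ≤ 1 / 2) : 0 < pHat p := by
  unfold pHat
  exact div_pos (by linarith) (by linarith)

theorem pHat_lt_one (hp0 : 0 < p) (hp : p ≤ 1 / 2) : pHat p < 1 := by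
  unfold pHat
  rw [div_lt_one (by linarith)]
  linarith

theorem boundE_nonneg (hb₀ : 0 < b₀) (hk₁ : 0 ≤ k₁) (hk₂ : 0 ≤ k₂) (hk₄ : 0 ≤ k₄) (hs : 1 ≤ s) :
    0 ≤ boundE p b₀ k₁ k₂ k₄ s := by
  unfold boundE
  split_ifs
  · have := Real.rpow_nonneg (le_max_left 0 (2 * k₁ + 2 * (k₂ + k₄ / 3) * Real.log s +
        2 * k₄ / pHat p * Real.log (4 * k₄ / b₀ ^ (2 * pHat p)))) (pHat p)
    positivity
  · positivity

/-- Solving the self-bounding inequality for the error sum. -/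
theorem le_boundE_of_le (hp0 : 0 < p) (hp : p < 1 / 2) (hk₁ : 0 ≤ k₁) (hk₂ : 0 ≤ k₂) (hk₄ : 0 < k₄)
    (hs : 1 ≤ s) {z : ℝ} (hz : 0 ≤ z)
    (h : z ≤ (k₁ + k₂ * s ^ ((1 - 2 * p) / 3) + k₄ * z ^ (1 - 2 * p)) * s ^ (2 * p / 3)) :
    z ^ pHat p ≤ boundE p b₀ k₁ k₂ k₄ s := by
  have hph := pHat_pos hp.le
  have hκ : 0 < 1 - 2 * p := by linarith
  have hs0 : 0 < s := by linarith
  rw [boundE, if_neg hp.ne]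
  have t1 : 0 ≤ (2 * k₁ / k₄) ^ (pHat p / (1 - 2 * p)) := by positivity
  have t2 : 0 ≤ (2 * k₂ / k₄) ^ (pHat p / (1 - 2 * p)) * s ^ (pHat p / 3) := by positivity
  have t3 : 0 ≤ (2 * k₄) ^ (pHat p / (2 * p)) * s ^ (pHat p / 3) := by positivity
  rw [add_mul]
  rcases hz.eq_or_lt with rfl | hz0
  · rw [Real.zero_rpow hph.ne']; linarith
  have hzp := Real.rpow_pos_of_pos hz0 (1 - 2 * p)
  -- If the k₄ term dominates, the self-bound gives z^(2p) ≤ 2k₄ s^(2p/3). Otherwise the case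
  -- assumption itself bounds k₄ z^(1-2p) by twice the larger of the other two terms. The three
  -- outcomes are the three summands.
  rcases le_total (k₁ + k₂ * s ^ ((1 - 2 * p) / 3)) (k₄ * z ^ (1 - 2 * p)) with h1 | h1
  · have h2 : z ≤ 2 * k₄ * s ^ (2 * p / 3) * z ^ (1 - 2 * p) := by
      refine h.trans ?_
      have := Real.rpow_nonneg hs0.le (2 * p / 3)
      nlinarith
    have h3 : z ^ (2 * p) ≤ 2 * k₄ * s ^ (2 * p / 3) := by
      have e : z = z ^ (2 * p) * z ^ (1 - 2 * p) := by
        rw [← Real.rpow_add hz0]; simp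
      rw [e] at h2
      rw [← e] at h2
      nth_rewrite 1 [e] at h2
      exact le_of_mul_le_mul_right h2 hzp
    have h4 : z ^ pHat p ≤ (2 * k₄) ^ (pHat p / (2 * p)) * s ^ (pHat p / 3) := by
      calc z ^ pHat p = (z ^ (2 * p)) ^ (pHat p / (2 * p)) := by
            rw [← Real.rpow_mul hz]; congr 1; field_simp
        _ ≤ (2 * k₄ * s ^ (2 * p / 3)) ^ (pHat p / (2 * p)) :=
            Real.rpow_le_rpow (Real.rpow_nonneg hz _) h3 (by positivity)
        _ = _ := by
            rw [Real.mul_rpow (by positivity) (by positivity), ← Real.rpow_mul hs0.le]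
            congr 2; field_simp
    linarith
  · have key : ∀ K r : ℝ, 0 ≤ K → k₄ * z ^ (1 - 2 * p) ≤ 2 * (K * s ^ r) →
        z ^ pHat p ≤ (2 * K / k₄) ^ (pHat p / (1 - 2 * p)) * s ^ (r * (pHat p / (1 - 2 * p))) := by
      intro K r hK hle
      have h2 : z ^ (1 - 2 * p) ≤ 2 * K / k₄ * s ^ r := by
        rw [div_mul_eq_mul_div, le_div_iff₀ hk₄]; linarith
      calc z ^ pHat p = (z ^ (1 - 2 * p)) ^ (pHat p / (1 - 2 * p)) := by
            rw [← Real.rpow_mul hz]; congr 1; field_simp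
        _ ≤ (2 * K / k₄ * s ^ r) ^ (pHat p / (1 - 2 * p)) :=
            Real.rpow_le_rpow hzp.le h2 (by positivity)
        _ = _ := by
            rw [Real.mul_rpow (by positivity) (by positivity), ← Real.rpow_mul hs0.le]
    rcases le_total (k₂ * s ^ ((1 - 2 * p) / 3)) k₁ with h2 | h2
    · have := key k₁ 0 hk₁ (by rw [Real.rpow_zero]; linarith)
      rw [zero_mul, Real.rpow_zero, mul_one] at this
      linarith
    · have := key k₂ ((1 - 2 * p) / 3) hk₂ (by linarith)
      rw [show (1 - 2 * p) / 3 * (pHat p / (1 - 2 * p)) = pHat p / 3 by field_simp] at this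
      linarith

/-- Equivalent to 2p² - 6p + 1 ≤ 0, whose smaller root is (3 - √7)/2. This is the reason for the
lower limit on p. -/
theorem one_sub_two_mul_le_pHat (hp : (3 - Real.sqrt 7) / 2 ≤ p) (hp' : p ≤ 1 / 2) :
    1 - 2 * p ≤ pHat p := by
  have h7 : Real.sqrt 7 ^ 2 = 7 := Real.sq_sqrt (by norm_num)
  have h0 := Real.sqrt_nonneg 7
  have h3 : Real.sqrt 7 ≤ 3 := by nlinarith
  unfold pHat
  rw [le_div_iff₀ (by linarith)]
  nlinarith [mul_nonneg (show 0 ≤ 2 * p - 3 + Real.sqrt 7 by linarith)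
    (show 0 ≤ 3 + Real.sqrt 7 - 2 * p by linarith)]

theorem lower_pos (hp : (3 - Real.sqrt 7) / 2 ≤ p) : 0 < p := by
  have h7 : Real.sqrt 7 ^ 2 = 7 := Real.sq_sqrt (by norm_num)
  have h0 := Real.sqrt_nonneg 7
  nlinarith

end Solve

/-! ### Moment bound for the errors in terms of the directions. -/

namespace Trajectory

variable {d : ℕ} {Ω : Type*} [MeasurableSpace Ω] {μ : Measure Ω}
  {σ σhat β p a₀ b₀ η Δ : ℝ} {F : EuclideanSpace ℝ (Fin d) → ℝ}
  {x dir grad ν ν' : ℕ → Ω → EuclideanSpace ℝ (Fin d)} {S : ℕ → Ω → ℝ}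
  [IsProbabilityMeasure μ]

/-- The error bound at ℓ = q, where the weights are S^(-2p/3). Being decreasing, they may be
replaced by their last value, and the steps are summed by `sum_weighted_step_le`. -/
theorem integral_weighted_sumErr_le (h : Trajectory μ σ σhat β p a₀ b₀ η Δ F x dir grad ν ν' S)
    (ha₀ : 0 < a₀) (hσhat : 0 ≤ σhat) (hp0 : 0 < p) (hp : p ≤ 1 / 2) (hb₀ : 0 < b₀) (M : ℕ) :
    ∫ ω, S (M + 1) ω ^ (-(2 * p / 3)) *
        ∑ n ∈ Finset.range (M + 1), ‖dir n ω - grad n ω‖ ^ 2 ∂μ ≤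
      K₁ a₀ σ σhat ((1 - p) / 2) + K₂ a₀ ((1 - p) / 2) * (if p = 1 / 2 then
        Real.log (1 + 2 * σ ^ 2 * (M + 1 : ℕ) / a₀ ^ 2) else
        (1 + 2 * σ ^ 2 * (M + 1 : ℕ) / a₀ ^ 2) ^ ((1 - 2 * p) / 3)) +
      K₄ a₀ η σhat β ((1 - p) / 2) * ∫ ω, (if p = 1 / 2 then
        Real.log (1 + (∑ n ∈ Finset.range (M + 1), ‖dir n ω‖ ^ 2) / b₀ ^ 2) else
        (∑ n ∈ Finset.range (M + 1), ‖dir n ω‖ ^ 2) ^ (1 - 2 * p)) ∂μ := by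
  set q := (1 - p) / 2 with hq
  have hq1 : 1 / 4 ≤ q := by rw [hq]; linarith
  have hiff : q = 1 / 4 ↔ p = 1 / 2 := by
    rw [hq]; constructor <;> intro <;> linarith
  have herr := h.integral_err_le ha₀ hσhat hq1 (by rw [hq]; linarith) M
  simp only [hiff] at herr
  rw [show (4 * q - 1) / 3 = (1 - 2 * p) / 3 by rw [hq]; ring,
    show 4 * q / 3 - 2 / 3 = -(2 * p / 3) by rw [hq]; ring,
    show 4 * q / 3 = 2 * (1 - p) / 3 by rw [hq]; ring] at herr
  have hK₃ := K₃_nonneg (ℓ := q) ha₀ hσhat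
  set c := K₃ a₀ σhat q + 3 * (1 + 2 * q ^ 2) / q ^ 2 with hc
  have hc0 : 0 ≤ c := by positivity
  have hD0 : ∀ ω, 0 ≤ ∑ n ∈ Finset.range (M + 1), ‖dir n ω‖ ^ 2 := fun ω =>
    Finset.sum_nonneg fun _ _ => sq_nonneg _
  have hbd : EssBdd μ (fun ω => if p = 1 / 2 then
        Real.log (1 + (∑ n ∈ Finset.range (M + 1), ‖dir n ω‖ ^ 2) / b₀ ^ 2) else
        (∑ n ∈ Finset.range (M + 1), ‖dir n ω‖ ^ 2) ^ (1 - 2 * p)) := by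
    by_cases hh : p = 1 / 2
    · simp only [if_pos hh]
      simp only [div_eq_mul_inv]
      exact ((EssBdd.const 1).add ((h.essBdd_sumDir _).mul (EssBdd.const _))).log_of_one_le
        fun ω => le_add_of_nonneg_right (mul_nonneg (hD0 ω) (by positivity))
    · simp only [if_neg hh]
      exact (h.essBdd_sumDir _).rpow hD0 (by linarith)
  have hstep : β ^ 2 * ∫ ω, ∑ n ∈ Finset.range (M + 1), (K₃ a₀ σhat q +
      3 * (1 + 2 * q ^ 2) / q ^ 2 * S n ω ^ (2 * (1 - p) / 3)) * ‖x (n + 1) ω - x n ω‖ ^ 2 ∂μ ≤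
      K₄ a₀ η σhat β q * ∫ ω, (if p = 1 / 2 then
        Real.log (1 + (∑ n ∈ Finset.range (M + 1), ‖dir n ω‖ ^ 2) / b₀ ^ 2) else
        (∑ n ∈ Finset.range (M + 1), ‖dir n ω‖ ^ 2) ^ (1 - 2 * p)) ∂μ := by
    rw [← integral_const_mul, ← integral_const_mul]
    refine integral_mono ((EssBdd.sum _ fun n _ => ((EssBdd.const _).add
      ((h.essBdd_rpow n _).const_mul _)).mul (h.essBdd_sqStep n)).const_mul _).integrable
      (hbd.const_mul _).integrable fun ω => ?_
    have h1 := h.sum_weighted_step_le hp0 hp hb₀ (M + 1) ω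
    have h2 : ∑ n ∈ Finset.range (M + 1), (K₃ a₀ σhat q +
        3 * (1 + 2 * q ^ 2) / q ^ 2 * S n ω ^ (2 * (1 - p) / 3)) * ‖x (n + 1) ω - x n ω‖ ^ 2 ≤
        c * ∑ n ∈ Finset.range (M + 1),
          S n ω ^ (2 * (1 - p) / 3) * ‖x (n + 1) ω - x n ω‖ ^ 2 := by
      rw [Finset.mul_sum]
      refine Finset.sum_le_sum fun n _ => ?_
      have h3 := mul_le_mul_of_nonneg_left (mul_le_mul_of_nonneg_right (Real.one_le_rpow
        (h.one_le_S n ω) (show 0 ≤ 2 * (1 - p) / 3 by linarith))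
        (sq_nonneg ‖x (n + 1) ω - x n ω‖)) hK₃
      rw [hc]
      linarith
    refine (mul_le_mul_of_nonneg_left (h2.trans (mul_le_mul_of_nonneg_left h1 hc0))
      (sq_nonneg β)).trans (le_of_eq ?_)
    simp only [K₄, hiff, ← hc]
    rw [show 4 * q - 1 = 1 - 2 * p by rw [hq]; ring]
    split_ifs <;> ring
  refine le_trans (integral_mono ((h.essBdd_rpow _ _).mul (h.essBdd_sumErr _)).integrable
    (EssBdd.sum _ fun n _ => (h.essBdd_rpow (n + 1) _).mul (h.essBdd_err n).norm.sq).integrable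
    fun ω => ?_) (herr.trans (add_le_add_right hstep _))
  simp only
  rw [Finset.mul_sum]
  refine Finset.sum_le_sum fun n hn => ?_
  have hn' : n + 1 ≤ M + 1 := Finset.mem_range.1 hn
  refine mul_le_mul_of_nonneg_right ?_ (sq_nonneg _)
  exact Real.rpow_le_rpow_of_nonpos (zero_lt_one.trans_le (h.one_le_S _ ω))
    (h.monotone_S ω hn') (by linarith)

theorem integral_sumErr_rpow_le (h : Trajectory μ σ σhat β p a₀ b₀ η Δ F x dir grad ν ν' S)
    (hp0 : 0 < p) (hp : p ≤ 1 / 2) (M : ℕ) :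
    ∫ ω, (∑ n ∈ Finset.range (M + 1), ‖dir n ω - grad n ω‖ ^ 2) ^ pHat p ∂μ ≤
      (∫ ω, S (M + 1) ω ^ (-(2 * p / 3)) *
        ∑ n ∈ Finset.range (M + 1), ‖dir n ω - grad n ω‖ ^ 2 ∂μ) ^ pHat p *
      (1 + 2 * σ ^ 2 * (M + 1 : ℕ) / a₀ ^ 2) ^ (2 * p / 3 * pHat p) := by
  have hph := pHat_pos hp
  have hph1 := pHat_lt_one hp0 hp
  have h4 : 0 < 4 - p := by linarith
  have h1p : 0 < 1 + 2 * p := by linarith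
  have hE0 : ∀ ω, 0 ≤ ∑ n ∈ Finset.range (M + 1), ‖dir n ω - grad n ω‖ ^ 2 := fun ω =>
    Finset.sum_nonneg fun _ _ => sq_nonneg _
  have hS1 := h.one_le_S (M + 1)
  have hS0 : ∀ ω, 0 < S (M + 1) ω := fun ω => zero_lt_one.trans_le (hS1 ω)
  -- Hölder with exponents p̂ and 1 - p̂ has to compensate S^(-2p/3 · p̂); κ is the power of S whose
  -- (1 - p̂)-th power does this. It is at most 1, so Jensen applies to it.
  set κ := 2 * p * (1 - p) / (1 + 2 * p) with hκ
  have hκ0 : 0 < κ := div_pos (mul_pos (by linarith) (by linarith)) h1p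
  have hκ1 : κ ≤ 1 := by rw [hκ, div_le_one h1p]; nlinarith
  have eκ : κ * (1 - pHat p) = 2 * p / 3 * pHat p := by
    rw [hκ]; unfold pHat; field_simp; ring
  have hH := integral_rpow_mul_rpow_le (θ := pHat p)
    ((h.essBdd_rpow (M + 1) (-(2 * p / 3))).mul (h.essBdd_sumErr (M + 1)))
    (h.essBdd_rpow (M + 1) κ) (fun ω => mul_nonneg (Real.rpow_nonneg (hS0 ω).le _) (hE0 ω))
    (fun ω => Real.rpow_nonneg (hS0 ω).le _) hph hph1
  have hI := h.integral_rpow_S_le (M + 1) hκ0 hκ1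
  have hs0 : (0 : ℝ) ≤ 1 + 2 * σ ^ 2 * (M + 1 : ℕ) / a₀ ^ 2 := by positivity
  calc _ = ∫ ω, (S (M + 1) ω ^ (-(2 * p / 3)) *
        ∑ n ∈ Finset.range (M + 1), ‖dir n ω - grad n ω‖ ^ 2) ^ pHat p *
          (S (M + 1) ω ^ κ) ^ (1 - pHat p) ∂μ := by
        congr 1; ext ω
        rw [Real.mul_rpow (Real.rpow_nonneg (hS0 ω).le _) (hE0 ω), ← Real.rpow_mul (hS0 ω).le,
          ← Real.rpow_mul (hS0 ω).le, mul_right_comm, ← Real.rpow_add (hS0 ω), eκ, neg_mul,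
          neg_add_cancel, Real.rpow_zero, one_mul]
    _ ≤ _ := hH
    _ ≤ _ := by
        rw [← eκ, Real.rpow_mul hs0]
        refine mul_le_mul_of_nonneg_left (Real.rpow_le_rpow (integral_nonneg fun ω =>
          Real.rpow_nonneg (hS0 ω).le _) hI (by linarith)) (Real.rpow_nonneg
          (integral_nonneg fun ω => mul_nonneg (Real.rpow_nonneg (hS0 ω).le _) (hE0 ω)) _)

end Trajectory

/-! ### The case p = 1/2. -/

section Half

/-- The arithmetic behind the bound of the error sum by the square of the direction bound when
`p = 1/2`. -/
theorem add_mul_log_le_four_mul_sq {k b N A κ L : ℝ} (hk : 0 < k) (hb : 0 < b)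
    (hκ : κ ≤ k ^ 2 / 4) (hL : 0 ≤ L)
    (hN : b + A / k + 2 * k / 3 * L + 2 * k * Real.log (k / b) ≤ N) (hA : 0 ≤ A) :
    A + κ * (2 * Real.log (1 + N / b) + 1 / 3 * L) ≤ 4 * N ^ 2 := by
  have hl2 := Real.log_two_lt_d9
  have h1 : Real.log (k / b) = -Real.log (b / k) := by rw [← Real.log_inv, inv_div]
  have h2 : Real.log (b / k) ≤ b / k / 2 - 1 + 0.6931471808 := by
    have h3 := Real.log_le_sub_one_of_pos (show 0 < b / k / 2 by positivity)
    rw [Real.log_div (by positivity) two_ne_zero] at h3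
    linarith
  have h3 : k * Real.log (b / k) ≤ b / 2 - 0.3068528192 * k := by
    calc _ ≤ k * (b / k / 2 - 1 + 0.6931471808) := by gcongr
      _ = _ := by field_simp; ring
  rw [h1] at hN
  have hA' : A = k * (A / k) := by field_simp
  have hAk : 0 ≤ A / k := by positivity
  have hkL : 0 ≤ k * L := by positivity
  -- The terms in b cancel, since 2k log(b/k) ≤ b - 0.6137k. So N dominates k, and every product kN
  -- below is at most a multiple of N².
  have hNb : 0.6 * k ≤ N - A / k - 2 * k / 3 * L := by linarith
  have hN0 : 0 < N := by linarith
  have hbN : 0 < b + N := by linarith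
  have h4 : Real.log (1 + N / b) = Real.log ((b + N) / k) - Real.log (b / k) := by
    rw [← Real.log_div (by positivity) (by positivity)]; congr 1; field_simp
  have h5 : k * Real.log ((b + N) / k) ≤ 0.368 * (b + N) := by
    calc _ ≤ k * (0.368 * ((b + N) / k)) := by gcongr; exact log_le_mul_of_pos (by positivity)
      _ = _ := by field_simp
  have h6 : k * Real.log (1 + N / b) ≤ 0.868 * N := by
    rw [h4]; linarith
  have hlog : 0 ≤ Real.log (1 + N / b) := Real.log_nonneg (by
    have : 0 ≤ N / b := by positivity
    linarith)
  have h7 : κ * (2 * Real.log (1 + N / b) + 1 / 3 * L) ≤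
      k ^ 2 / 4 * (2 * Real.log (1 + N / b) + 1 / 3 * L) := by gcongr
  have h8 : A ≤ k * (N - 2 * k / 3 * L) := by
    rw [hA']; exact mul_le_mul_of_nonneg_left (by linarith) hk.le
  have h9 := mul_le_mul_of_nonneg_left h6 hk.le
  have h10 : 0 ≤ k * (k * L) := by positivity
  have h11 : k * N ≤ 5 / 3 * N * N := by gcongr; linarith
  have h12 : 0 ≤ N * N := by positivity
  linarith

/-- AM-GM: K₈ + K₉ contains λ(K₃ + 54) + 1/λ times η max(β, 1), and (λc + 1/λ)² ≥ 4c for every λ. -/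
theorem four_mul_K₄_le {a₀ η σhat β lam : ℝ} (ha₀ : 0 < a₀) (hσhat : 0 ≤ σhat) (hβ : 0 ≤ β)
    (hη : 0 < η) (hlam : 0 < lam) :
    K₄ a₀ η σhat β (1 / 4) ≤ (K₈ a₀ η σhat β lam + K₉ a₀ η σhat β lam) ^ 2 / 4 := by
  have hK₃ := K₃_nonneg (ℓ := 1 / 4) ha₀ hσhat
  have hu : 0 ≤ 2 * σhat ^ (2 / 3 : ℝ) / (a₀ ^ (2 / 3 : ℝ) * lam) := by positivity
  have hm : β ≤ max β 1 := le_max_left _ _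
  have hm0 : 0 < max β 1 := lt_max_of_lt_right zero_lt_one
  rw [K₄, if_pos rfl, show (3 * (1 + 2 * (1 / 4) ^ 2) / (1 / 4) ^ 2 : ℝ) = 54 by norm_num]
  set c := K₃ a₀ σhat (1 / 4) + 54 with hc
  set w := lam * c + 1 / lam with hw
  have h1 : 4 * c ≤ w ^ 2 := by
    have : w ^ 2 - 4 * c = (lam * c - 1 / lam) ^ 2 := by rw [hw]; field_simp; ring
    nlinarith [sq_nonneg (lam * c - 1 / lam)]
  have hw0 : 0 ≤ w := by positivity
  have h2 : w * (η * max β 1) ≤ K₈ a₀ η σhat β lam + K₉ a₀ η σhat β lam := by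
    have e : K₈ a₀ η σhat β lam + K₉ a₀ η σhat β lam =
        (w + 1 + 2 * σhat ^ (2 / 3 : ℝ) / (a₀ ^ (2 / 3 : ℝ) * lam)) * (η * max β 1) := by
      rw [K₈, K₉, hw, hc]; ring
    rw [e]
    gcongr
    linarith
  calc c * (η ^ 2 * β ^ 2) ≤ (w ^ 2 / 4) * (η ^ 2 * (max β 1) ^ 2) := by gcongr; linarith
    _ = (w * (η * max β 1)) ^ 2 / 4 := by ring
    _ ≤ _ := by gcongr

end Half

namespace Trajectory

variable {d : ℕ} {Ω : Type*} [MeasurableSpace Ω] {μ : Measure Ω}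
  {σ σhat β p a₀ b₀ η Δ : ℝ} {F : EuclideanSpace ℝ (Fin d) → ℝ}
  {x dir grad ν ν' : ℕ → Ω → EuclideanSpace ℝ (Fin d)} {S : ℕ → Ω → ℝ}
  [IsProbabilityMeasure μ]

theorem gap_nonneg (h : Trajectory μ σ σhat β p a₀ b₀ η Δ F x dir grad ν ν' S) : 0 ≤ Δ := by
  obtain ⟨ω⟩ : Nonempty Ω := nonempty_of_isProbabilityMeasure μ
  simpa using h.gap 0 ω

/-- Writing D^(1/2) = S^(1/6) Y, where E Y is at most the direction bound, gives 1 + D/b₀² ≤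
(S^(1/6)(1 + Y/b₀))². Jensen for both logarithms then suffices, with no moment of D itself. -/
theorem integral_log_sumDir_le
    (h : Trajectory μ σ σhat β (1 / 2) a₀ b₀ η Δ F x dir grad ν ν' S)
    (ha₀ : 0 < a₀) (hσhat : 0 ≤ σhat) (hβ : 0 ≤ β) (hη : 0 < η) (hb₀ : 0 < b₀) {lam : ℝ}
    (hlam : 0 < lam) (M : ℕ) :
    ∫ ω, Real.log (1 + (∑ n ∈ Finset.range (M + 1), ‖dir n ω‖ ^ 2) / b₀ ^ 2) ∂μ ≤
      2 * Real.log (1 + dirBase (1 / 2) a₀ b₀ η σ σhat β Δ lam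
        (1 + 2 * σ ^ 2 * (M + 1 : ℕ) / a₀ ^ 2) / b₀) +
      1 / 3 * Real.log (1 + 2 * σ ^ 2 * (M + 1 : ℕ) / a₀ ^ 2) := by
  have hI := h.integral_weighted_sumDir_le ha₀ hσhat hβ hη (by norm_num) le_rfl hb₀ hlam M
  have hlogS := h.integral_log_S_le (M + 1)
  set N := dirBase (1 / 2) a₀ b₀ η σ σhat β Δ lam (1 + 2 * σ ^ 2 * (M + 1 : ℕ) / a₀ ^ 2)
  have hD0 : ∀ ω, 0 ≤ ∑ n ∈ Finset.range (M + 1), ‖dir n ω‖ ^ 2 := fun ω =>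
    Finset.sum_nonneg fun _ _ => sq_nonneg _
  have hS1 := h.one_le_S (M + 1)
  have hS0 : ∀ ω, 0 < S (M + 1) ω := fun ω => zero_lt_one.trans_le (hS1 ω)
  set Y : Ω → ℝ := fun ω => S (M + 1) ω ^ (-((1 - 1 / 2) / 3) : ℝ) *
    (∑ n ∈ Finset.range (M + 1), ‖dir n ω‖ ^ 2) ^ (1 - 1 / 2 : ℝ) with hY
  have hY0 : ∀ ω, 0 ≤ Y ω := fun ω => mul_nonneg (Real.rpow_nonneg (hS0 ω).le _)
    (Real.rpow_nonneg (hD0 ω) _)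
  have hYb : EssBdd μ Y := (h.essBdd_rpow (M + 1) _).mul
    ((h.essBdd_sumDir (M + 1)).rpow hD0 (by norm_num))
  have hZb : EssBdd μ (fun ω => 1 + b₀⁻¹ * Y ω) := (EssBdd.const 1).add (hYb.const_mul _)
  have hZ1 : ∀ ω, 1 ≤ 1 + b₀⁻¹ * Y ω := fun ω =>
    le_add_of_nonneg_right (mul_nonneg (inv_pos.2 hb₀).le (hY0 ω))
  have hpt : ∀ ω, Real.log (1 + (∑ n ∈ Finset.range (M + 1), ‖dir n ω‖ ^ 2) / b₀ ^ 2) ≤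
      2 * Real.log (1 + b₀⁻¹ * Y ω) + 1 / 3 * Real.log (S (M + 1) ω) := by
    intro ω
    have hSp : 0 < S (M + 1) ω ^ (1 / 6 : ℝ) := Real.rpow_pos_of_pos (hS0 ω) _
    have hSp1 : 1 ≤ S (M + 1) ω ^ (1 / 6 : ℝ) := Real.one_le_rpow (hS1 ω) (by norm_num)
    have e1 : S (M + 1) ω ^ (1 / 6 : ℝ) * Y ω =
        Real.sqrt (∑ n ∈ Finset.range (M + 1), ‖dir n ω‖ ^ 2) := by
      rw [hY, Real.sqrt_eq_rpow]
      simp only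
      rw [← mul_assoc, ← Real.rpow_add (hS0 ω)]
      norm_num
    have e2 : 2 * Real.log (1 + b₀⁻¹ * Y ω) + 1 / 3 * Real.log (S (M + 1) ω) =
        Real.log ((S (M + 1) ω ^ (1 / 6 : ℝ) * (1 + b₀⁻¹ * Y ω)) ^ 2) := by
      rw [Real.log_pow, Real.log_mul hSp.ne' (zero_lt_one.trans_le (hZ1 ω)).ne',
        Real.log_rpow (hS0 ω)]
      push_cast; ring
    rw [e2]
    refine Real.log_le_log (add_pos_of_pos_of_nonneg one_pos (div_nonneg (hD0 ω) (sq_nonneg _))) ?_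
    have e3 : S (M + 1) ω ^ (1 / 6 : ℝ) * (1 + b₀⁻¹ * Y ω) = S (M + 1) ω ^ (1 / 6 : ℝ) +
        b₀⁻¹ * Real.sqrt (∑ n ∈ Finset.range (M + 1), ‖dir n ω‖ ^ 2) := by rw [← e1]; ring
    rw [e3, div_eq_inv_mul]
    have hsq := Real.sq_sqrt (hD0 ω)
    have hs0 := Real.sqrt_nonneg (∑ n ∈ Finset.range (M + 1), ‖dir n ω‖ ^ 2)
    set r := Real.sqrt (∑ n ∈ Finset.range (M + 1), ‖dir n ω‖ ^ 2)
    rw [← hsq, ← inv_pow, ← mul_pow]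
    have : 0 ≤ b₀⁻¹ * r := by positivity
    nlinarith
  have hlogD := ((EssBdd.const (μ := μ) 1).add ((h.essBdd_sumDir (M + 1)).mul
    (EssBdd.const (b₀ ^ 2)⁻¹))).log_of_one_le
      fun ω => le_add_of_nonneg_right (mul_nonneg (hD0 ω) (by positivity))
  simp only [← div_eq_mul_inv] at hlogD
  have hlogZ := hZb.log_of_one_le hZ1
  have hlogSb := (h.bdd_S (M + 1)).log_of_one_le hS1
  have h1 := integral_mono hlogD.integrable
    ((hlogZ.const_mul 2).add (hlogSb.const_mul (1 / 3))).integrable hpt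
  rw [integral_add (hlogZ.const_mul 2).integrable (hlogSb.const_mul (1 / 3)).integrable,
    integral_const_mul, integral_const_mul] at h1
  have h2 := integral_log_le hZb hZ1
  have h3 : ∫ ω, (1 + b₀⁻¹ * Y ω) ∂μ ≤ 1 + N / b₀ := by
    rw [integral_add (integrable_const _) (hYb.const_mul _).integrable, integral_const_mul]
    simp only [integral_const, probReal_univ, one_smul]
    rw [div_eq_inv_mul]
    gcongr
  have h4 := Real.log_le_log (zero_lt_one.trans_le (one_le_integral hZb hZ1)) h3
  linarith

/-- For `p = 1/2`, the error sum is controlled by the bound for the directions. -/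
theorem integral_sumErr_rpow_le_of_half
    (h : Trajectory μ σ σhat β (1 / 2) a₀ b₀ η Δ F x dir grad ν ν' S)
    (ha₀ : 0 < a₀) (hσhat : 0 ≤ σhat) (hβ : 0 ≤ β) (hη : 0 < η) (hb₀ : 0 < b₀) {lam : ℝ}
    (hlam : 0 < lam) (M : ℕ) :
    ∫ ω, (∑ n ∈ Finset.range (M + 1), ‖dir n ω - grad n ω‖ ^ 2) ^ pHat (1 / 2) ∂μ ≤
      2 ^ (6 / 7 : ℝ) * (dirBase (1 / 2) a₀ b₀ η σ σhat β Δ lam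
          (1 + 2 * σ ^ 2 * (M + 1 : ℕ) / a₀ ^ 2) ^ (pHat (1 / 2) / (1 - 1 / 2)) *
        (1 + 2 * σ ^ 2 * (M + 1 : ℕ) / a₀ ^ 2) ^ (pHat (1 / 2) / 3)) := by
  have hs1 : (1 : ℝ) ≤ 1 + 2 * σ ^ 2 * (M + 1 : ℕ) / a₀ ^ 2 :=
    le_add_of_nonneg_right (by positivity)
  have hΔ := h.gap_nonneg
  have hE := h.integral_weighted_sumErr_le ha₀ hσhat (by norm_num) le_rfl hb₀ M
  have hE2 := h.integral_sumErr_rpow_le (by norm_num) le_rfl M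
  have hlogD := h.integral_log_sumDir_le ha₀ hσhat hβ hη hb₀ hlam M
  have hN0 := dirBase_nonneg (p := 1 / 2) (β := β) (σ := σ) (by norm_num) le_rfl ha₀ hb₀ hσhat hη hlam hΔ hs1
  simp only [if_true] at hE
  rw [show ((1 - 1 / 2) / 2 : ℝ) = 1 / 4 by norm_num] at hE
  have hK₁ := K₁_nonneg (σ := σ) (ℓ := 1 / 4) ha₀ hσhat
  have hK₂ := K₂_nonneg (a₀ := a₀) (ℓ := 1 / 4) le_rfl
  have hK₃ := K₃_nonneg (ℓ := 1 / 4) ha₀ hσhat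
  have hK₄ : 0 ≤ K₄ a₀ η σhat β (1 / 4) := by rw [K₄, if_pos rfl]; positivity
  have hκ := four_mul_K₄_le (β := β) ha₀ hσhat hβ hη hlam
  have hk := K₈_add_K₉_pos (β := β) ha₀ hσhat hη hlam
  have hm0 : 0 < max β 1 := lt_max_of_lt_right zero_lt_one
  -- The 1/λ term of K₉ alone. It makes A/(K₈ + K₉) at most the share of K₁ and K₂ contained in
  -- `dirBase`.
  have hkm : η * max β 1 / lam ≤ K₈ a₀ η σhat β lam + K₉ a₀ η σhat β lam := by
    have e : K₈ a₀ η σhat β lam + K₉ a₀ η σhat β lam = η * max β 1 / lam +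
        (1 + lam * K₃ a₀ σhat (1 / 4) + 2 * σhat ^ (2 / 3 : ℝ) / (a₀ ^ (2 / 3 : ℝ) * lam) +
          54 * lam) * (η * max β 1) := by rw [K₈, K₉]; ring
    rw [e]
    exact le_add_of_nonneg_right (by positivity)
  set s := 1 + 2 * σ ^ 2 * (M + 1 : ℕ) / a₀ ^ 2
  have hL := Real.log_nonneg hs1
  set A := K₁ a₀ σ σhat (1 / 4) + K₂ a₀ (1 / 4) * Real.log s with hA
  have hA0 : 0 ≤ A := by positivity
  have hNle : b₀ + A / (K₈ a₀ η σhat β lam + K₉ a₀ η σhat β lam) +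
      2 * (K₈ a₀ η σhat β lam + K₉ a₀ η σhat β lam) / 3 * Real.log s +
      2 * (K₈ a₀ η σhat β lam + K₉ a₀ η σhat β lam) *
        Real.log ((K₈ a₀ η σhat β lam + K₉ a₀ η σhat β lam) / b₀) ≤
      dirBase (1 / 2) a₀ b₀ η σ σhat β Δ lam s := by
    have e7 : K₇ (1 / 2) a₀ η σhat β lam =
        2 * (K₈ a₀ η σhat β lam + K₉ a₀ η σhat β lam) := by
      rw [K₇]; norm_num; ring
    have h1 : A / (K₈ a₀ η σhat β lam + K₉ a₀ η σhat β lam) ≤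
        lam * K₁ a₀ σ σhat (1 / 4) / (η * max β 1) + K₆ a₀ η β lam * Real.log s := by
      refine (div_le_div_of_nonneg_left hA0 (by positivity) hkm).trans (le_of_eq ?_)
      rw [hA, K₆]; field_simp
    have h2 : 0 ≤ 2 / η * Δ := by positivity
    rw [dirBase, K₅, e7]
    norm_num
    linarith
  have hfour := add_mul_log_le_four_mul_sq hk hb₀ hκ hL hNle hA0
  set N := dirBase (1 / 2) a₀ b₀ η σ σhat β Δ lam s
  have hI : ∫ ω, S (M + 1) ω ^ (-(2 * (1 / 2) / 3) : ℝ) *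
        ∑ n ∈ Finset.range (M + 1), ‖dir n ω - grad n ω‖ ^ 2 ∂μ ≤ 4 * N ^ 2 :=
    (hE.trans (add_le_add_right (mul_le_mul_of_nonneg_left hlogD hK₄) _)).trans hfour
  have hph : pHat (1 / 2) = 3 / 7 := by unfold pHat; norm_num
  refine hE2.trans ?_
  rw [hph, ← mul_assoc]
  norm_num
  gcongr
  have hi0 : 0 ≤ ∫ ω, S (M + 1) ω ^ (-(2 * (1 / 2) / 3) : ℝ) *
        ∑ n ∈ Finset.range (M + 1), ‖dir n ω - grad n ω‖ ^ 2 ∂μ :=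
    integral_nonneg fun ω => mul_nonneg
      (Real.rpow_nonneg (zero_le_one.trans (h.one_le_S _ ω)) _)
      (Finset.sum_nonneg fun _ _ => sq_nonneg _)
  norm_num at hI hi0
  refine (Real.rpow_le_rpow hi0 hI (by norm_num)).trans (le_of_eq ?_)
  rw [show 4 * N ^ 2 = (2 * N) ^ (2 : ℝ) by rw [Real.rpow_two]; ring,
    ← Real.rpow_mul (by positivity), Real.mul_rpow two_pos.le hN0]
  norm_num

end Trajectory

/-! ### From directions and errors to gradients. -/

section Combine

theorem K₄_pos {a₀ η σhat β q : ℝ} (ha₀ : 0 < a₀) (hσhat : 0 ≤ σhat) (hβ : 0 < β) (hη : 0 < η)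
    (hq : 1 / 4 ≤ q) : 0 < K₄ a₀ η σhat β q := by
  have hK₃ := K₃_nonneg (ℓ := q) ha₀ hσhat
  have hq0 : 0 < q := by linarith
  unfold K₄
  split_ifs with h
  · positivity
  · have : 0 < 4 * q - 1 := by
      rcases hq.eq_or_lt with h1 | h1
      · exact absurd h1.symm h
      · linarith
    positivity

/-- Shows that the final factor 4 also suffices for p = 1/2, where p̂ = 3/7 and the error costs
2^(6/7) times the direction bound. -/
theorem two_rpow_mul_le : (2 : ℝ) ^ (3 / 7 : ℝ) * (2 ^ (6 / 7 : ℝ) + 1) ≤ 4 := by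
  set t : ℝ := 2 ^ (1 / 7 : ℝ) with ht
  have ht7 : t ^ 7 = 2 := by
    rw [ht, ← Real.rpow_mul_natCast two_pos.le]; norm_num
  have e3 : (2 : ℝ) ^ (3 / 7 : ℝ) = t ^ 3 := by
    rw [ht, ← Real.rpow_mul_natCast two_pos.le]; norm_num
  have e6 : (2 : ℝ) ^ (6 / 7 : ℝ) = t ^ 6 := by
    rw [ht, ← Real.rpow_mul_natCast two_pos.le]; norm_num
  have ht0 : 0 < t := by positivity
  have ht1 : t ≤ 1.105 := by
    by_contra! hc
    have := pow_le_pow_left₀ (by norm_num) hc.le 7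
    rw [ht7] at this
    norm_num at this
  rw [e3, e6]
  have h2 : t ^ 2 ≤ 1.105 ^ 2 := pow_le_pow_left₀ ht0.le ht1 2
  have h3 : t ^ 3 ≤ 1.105 ^ 3 := pow_le_pow_left₀ ht0.le ht1 3
  have : t ^ 3 * (t ^ 6 + 1) = t ^ 7 * t ^ 2 + t ^ 3 := by ring
  rw [this, ht7]
  norm_num at h2 h3 ⊢
  linarith

theorem sum_norm_sq_rpow_le {V : Type*} [NormedAddCommGroup V] (grad dir : ℕ → V) {r : ℝ}
    (hr0 : 0 < r) (hr1 : r ≤ 1) (N : ℕ) :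
    (∑ n ∈ Finset.range N, ‖grad n‖ ^ 2) ^ r ≤
      2 ^ r * ((∑ n ∈ Finset.range N, ‖dir n - grad n‖ ^ 2) ^ r +
        (∑ n ∈ Finset.range N, ‖dir n‖ ^ 2) ^ r) := by
  have h1 : ∑ n ∈ Finset.range N, ‖grad n‖ ^ 2 ≤ 2 *
      (∑ n ∈ Finset.range N, ‖dir n - grad n‖ ^ 2 + ∑ n ∈ Finset.range N, ‖dir n‖ ^ 2) := by
    rw [← Finset.sum_add_distrib, Finset.mul_sum]
    refine Finset.sum_le_sum fun n _ => ?_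
    have h2 := norm_sub_le (dir n) (dir n - grad n)
    rw [sub_sub_cancel] at h2
    nlinarith [norm_nonneg (grad n), sq_nonneg (‖dir n‖ - ‖dir n - grad n‖)]
  have hE : 0 ≤ ∑ n ∈ Finset.range N, ‖dir n - grad n‖ ^ 2 :=
    Finset.sum_nonneg fun _ _ => sq_nonneg _
  have hD : 0 ≤ ∑ n ∈ Finset.range N, ‖dir n‖ ^ 2 := Finset.sum_nonneg fun _ _ => sq_nonneg _
  refine (Real.rpow_le_rpow (Finset.sum_nonneg fun _ _ => sq_nonneg _) h1 hr0.le).trans ?_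
  rw [Real.mul_rpow two_pos.le (add_nonneg hE hD)]
  gcongr
  exact rpow_add_le_of_le_one hE hD hr0.le hr1

end Combine

namespace Trajectory

variable {d : ℕ} {Ω : Type*} [MeasurableSpace Ω] {μ : Measure Ω}
  {σ σhat β p a₀ b₀ η Δ : ℝ} {F : EuclideanSpace ℝ (Fin d) → ℝ}
  {x dir grad ν ν' : ℕ → Ω → EuclideanSpace ℝ (Fin d)} {S : ℕ → Ω → ℝ}

variable [IsProbabilityMeasure μ]

/-- The error sum is controlled by `boundE` when it dominates the sum of the directions. -/
theorem integral_sumErr_rpow_le_boundE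
    (h : Trajectory μ σ σhat β p a₀ b₀ η Δ F x dir grad ν ν' S)
    (ha₀ : 0 < a₀) (hσhat : 0 ≤ σhat) (hβ : 0 < β) (hη : 0 < η)
    (hp : (3 - Real.sqrt 7) / 2 ≤ p) (hp' : p < 1 / 2) (hb₀ : 0 < b₀) (M : ℕ)
    (hle : ∫ ω, (∑ n ∈ Finset.range (M + 1), ‖dir n ω‖ ^ 2) ^ pHat p ∂μ ≤
      ∫ ω, (∑ n ∈ Finset.range (M + 1), ‖dir n ω - grad n ω‖ ^ 2) ^ pHat p ∂μ) :
    ∫ ω, (∑ n ∈ Finset.range (M + 1), ‖dir n ω - grad n ω‖ ^ 2) ^ pHat p ∂μ ≤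
      boundE p b₀ (K₁ a₀ σ σhat ((1 - p) / 2)) (K₂ a₀ ((1 - p) / 2))
        (K₄ a₀ η σhat β ((1 - p) / 2)) (1 + 2 * σ ^ 2 * (M + 1 : ℕ) / a₀ ^ 2) := by
  have hp0 := lower_pos hp
  have hph := pHat_pos hp'.le
  have hκ := one_sub_two_mul_le_pHat hp hp'.le
  have hκ0 : 0 < 1 - 2 * p := by linarith
  have hq : 1 / 4 ≤ (1 - p) / 2 := by linarith
  have hs1 : (1 : ℝ) ≤ 1 + 2 * σ ^ 2 * (M + 1 : ℕ) / a₀ ^ 2 :=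
    le_add_of_nonneg_right (by positivity)
  have hE := h.integral_weighted_sumErr_le ha₀ hσhat hp0 hp'.le hb₀ M
  have hE2 := h.integral_sumErr_rpow_le hp0 hp'.le M
  simp only [if_neg hp'.ne] at hE
  have hD0 : ∀ ω, 0 ≤ ∑ n ∈ Finset.range (M + 1), ‖dir n ω‖ ^ 2 := fun ω =>
    Finset.sum_nonneg fun _ _ => sq_nonneg _
  -- Jensen from exponent p̂ down to 1 - 2p; this requires (1 - 2p)/p̂ ≤ 1, the condition on p.
  have hJ := integral_rpow_le ((h.essBdd_sumDir (M + 1)).rpow hD0 hph.le)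
    (fun ω => Real.rpow_nonneg (hD0 ω) _) (θ := (1 - 2 * p) / pHat p) (by positivity)
    ((div_le_one hph).2 hκ)
  have e1 : ∀ ω, ((∑ n ∈ Finset.range (M + 1), ‖dir n ω‖ ^ 2) ^ pHat p) ^
      ((1 - 2 * p) / pHat p) = (∑ n ∈ Finset.range (M + 1), ‖dir n ω‖ ^ 2) ^ (1 - 2 * p) :=
    fun ω => by rw [← Real.rpow_mul (hD0 ω), mul_div_cancel₀ _ hph.ne']
  simp_rw [e1] at hJ
  have hK₄ := K₄_pos ha₀ hσhat hβ hη hq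
  set X := ∫ ω, (∑ n ∈ Finset.range (M + 1), ‖dir n ω - grad n ω‖ ^ 2) ^ pHat p ∂μ with hX
  have hX0 : 0 ≤ X := integral_nonneg fun ω =>
    Real.rpow_nonneg (Finset.sum_nonneg fun _ _ => sq_nonneg _) _
  have hDX0 : 0 ≤ ∫ ω, (∑ n ∈ Finset.range (M + 1), ‖dir n ω‖ ^ 2) ^ pHat p ∂μ :=
    integral_nonneg fun ω => Real.rpow_nonneg (hD0 ω) _
  have hJ2 := hJ.trans (Real.rpow_le_rpow hDX0 hle (by positivity))
  set s := 1 + 2 * σ ^ 2 * (M + 1 : ℕ) / a₀ ^ 2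
  set A := ∫ ω, S (M + 1) ω ^ (-(2 * p / 3)) *
        ∑ n ∈ Finset.range (M + 1), ‖dir n ω - grad n ω‖ ^ 2 ∂μ
  have hA0 : 0 ≤ A := integral_nonneg fun ω => mul_nonneg
      (Real.rpow_nonneg (zero_le_one.trans (h.one_le_S _ ω)) _)
      (Finset.sum_nonneg fun _ _ => sq_nonneg _)
  have hs0 : 0 < s := by linarith
  have e2 : (X ^ (1 / pHat p)) ^ pHat p = X := by
    rw [← Real.rpow_mul hX0, one_div_mul_cancel hph.ne', Real.rpow_one]
  have e3 : (X ^ (1 / pHat p)) ^ (1 - 2 * p) = X ^ ((1 - 2 * p) / pHat p) := by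
    rw [← Real.rpow_mul hX0]; congr 1; ring
  rw [← e2]
  -- The unknown of the self-bounding inequality is z = X^(1/p̂).
  refine le_boundE_of_le hp0 hp' (K₁_nonneg ha₀ hσhat) (K₂_nonneg hq) hK₄ hs1
    (Real.rpow_nonneg hX0 _) ?_
  rw [e3]
  have h2 : X ^ (1 / pHat p) ≤ A * s ^ (2 * p / 3) := by
    calc X ^ (1 / pHat p) ≤ (A ^ pHat p * s ^ (2 * p / 3 * pHat p)) ^ (1 / pHat p) :=
          Real.rpow_le_rpow hX0 hE2 (by positivity)
      _ = _ := by
          rw [Real.rpow_mul hs0.le, ← Real.mul_rpow hA0 (by positivity), ← Real.rpow_mul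
            (by positivity), mul_one_div_cancel hph.ne', Real.rpow_one]
  refine h2.trans (mul_le_mul_of_nonneg_right (hE.trans ?_) (by positivity))
  gcongr

/-- The bound on the sum of the squared gradients. -/
theorem integral_sumGrad_rpow_le (h : Trajectory μ σ σhat β p a₀ b₀ η Δ F x dir grad ν ν' S)
    (ha₀ : 0 < a₀) (hσhat : 0 ≤ σhat) (hβ : 0 < β) (hη : 0 < η)
    (hp : (3 - Real.sqrt 7) / 2 ≤ p) (hp' : p ≤ 1 / 2) (hb₀ : 0 < b₀) {lam : ℝ} (hlam : 0 < lam)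
    (M : ℕ) :
    ∫ ω, (∑ n ∈ Finset.range (M + 1), ‖grad n ω‖ ^ 2) ^ pHat p ∂μ ≤
      4 * (if p = 1 / 2 then 0 else boundE p b₀ (K₁ a₀ σ σhat ((1 - p) / 2))
        (K₂ a₀ ((1 - p) / 2)) (K₄ a₀ η σhat β ((1 - p) / 2))
          (1 + 2 * σ ^ 2 * (M + 1 : ℕ) / a₀ ^ 2)) +
      4 * (dirBase p a₀ b₀ η σ σhat β Δ lam (1 + 2 * σ ^ 2 * (M + 1 : ℕ) / a₀ ^ 2) ^
        (pHat p / (1 - p)) * (1 + 2 * σ ^ 2 * (M + 1 : ℕ) / a₀ ^ 2) ^ (pHat p / 3)) := by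
  have hp0 := lower_pos hp
  have hph := pHat_pos hp'
  have hph1 := pHat_lt_one hp0 hp'
  have hq : 1 / 4 ≤ (1 - p) / 2 := by linarith
  have hs1 : (1 : ℝ) ≤ 1 + 2 * σ ^ 2 * (M + 1 : ℕ) / a₀ ^ 2 :=
    le_add_of_nonneg_right (by positivity)
  have hD := h.integral_sumDir_rpow_le ha₀ hσhat hβ.le hη hp0 hp' hb₀ hlam M
  have nn : ∀ (v : ℕ → Ω → EuclideanSpace ℝ (Fin d)) ω,
      0 ≤ ∑ n ∈ Finset.range (M + 1), ‖v n ω‖ ^ 2 := fun v ω =>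
    Finset.sum_nonneg fun _ _ => sq_nonneg _
  have bG := (EssBdd.sum (Finset.range (M + 1)) fun n _ => (h.bdd_grad n).norm.sq).rpow
    (nn grad) hph.le
  have bE := (h.essBdd_sumErr (M + 1)).rpow (nn fun n ω => dir n ω - grad n ω) hph.le
  have bD := (h.essBdd_sumDir (M + 1)).rpow (nn dir) hph.le
  have hsum : ∫ ω, (∑ n ∈ Finset.range (M + 1), ‖grad n ω‖ ^ 2) ^ pHat p ∂μ ≤ 2 ^ pHat p *
      (∫ ω, (∑ n ∈ Finset.range (M + 1), ‖dir n ω - grad n ω‖ ^ 2) ^ pHat p ∂μ +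
        ∫ ω, (∑ n ∈ Finset.range (M + 1), ‖dir n ω‖ ^ 2) ^ pHat p ∂μ) := by
    rw [← integral_add bE.integrable bD.integrable, ← integral_const_mul]
    exact integral_mono bG.integrable ((bE.add bD).const_mul _).integrable
      fun ω => sum_norm_sq_rpow_le (fun n => grad n ω) (fun n => dir n ω) hph hph1.le (M + 1)
  have hD0 : 0 ≤ ∫ ω, (∑ n ∈ Finset.range (M + 1), ‖dir n ω‖ ^ 2) ^ pHat p ∂μ :=
    integral_nonneg fun ω => Real.rpow_nonneg (nn dir ω) _
  have hE0 : 0 ≤ ∫ ω, (∑ n ∈ Finset.range (M + 1), ‖dir n ω - grad n ω‖ ^ 2) ^ pHat p ∂μ :=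
    integral_nonneg fun ω => Real.rpow_nonneg (nn (fun n ω => dir n ω - grad n ω) ω) _
  rcases eq_or_lt_of_le hp' with rfl | hlt
  · rw [if_pos rfl]
    have hE := h.integral_sumErr_rpow_le_of_half ha₀ hσhat hβ.le hη hb₀ hlam M
    refine hsum.trans ?_
    have e : pHat (1 / 2) = 3 / 7 := by unfold pHat; norm_num
    set B := dirBase (1 / 2) a₀ b₀ η σ σhat β Δ lam (1 + 2 * σ ^ 2 * (M + 1 : ℕ) / a₀ ^ 2) ^
        (pHat (1 / 2) / (1 - 1 / 2)) * (1 + 2 * σ ^ 2 * (M + 1 : ℕ) / a₀ ^ 2) ^ (pHat (1 / 2) / 3)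
    have hB : 0 ≤ B := hD0.trans hD
    have h2 : (0 : ℝ) ≤ 2 ^ pHat (1 / 2) := by positivity
    calc _ ≤ 2 ^ pHat (1 / 2) * (2 ^ (6 / 7 : ℝ) * B + B) := by gcongr
      _ = 2 ^ (3 / 7 : ℝ) * (2 ^ (6 / 7 : ℝ) + 1) * B := by rw [e]; ring
      _ ≤ 4 * B := by gcongr; exact two_rpow_mul_le
      _ = _ := by ring
  · rw [if_neg hlt.ne]
    have hbE := boundE_nonneg (p := p) (s := 1 + 2 * σ ^ 2 * (M + 1 : ℕ) / a₀ ^ 2) hb₀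
      (K₁_nonneg (σ := σ) (ℓ := (1 - p) / 2) ha₀ hσhat) (K₂_nonneg (a₀ := a₀) hq)
      (K₄_pos ha₀ hσhat hβ hη hq).le hs1
    have h2 : (2 : ℝ) ^ pHat p ≤ 2 := by
      calc (2 : ℝ) ^ pHat p ≤ 2 ^ (1 : ℝ) :=
            Real.rpow_le_rpow_of_exponent_le one_le_two hph1.le
        _ = 2 := Real.rpow_one 2
    have h3 := hsum.trans (mul_le_mul_of_nonneg_right h2 (add_nonneg hE0 hD0))
    -- The gradient moment is at most 2(E E^p̂ + E D^p̂), hence at most four times the larger one.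
    -- Only when the error is the larger one is the self-bounding argument needed.
    rcases le_total (∫ ω, (∑ n ∈ Finset.range (M + 1), ‖dir n ω‖ ^ 2) ^ pHat p ∂μ)
      (∫ ω, (∑ n ∈ Finset.range (M + 1), ‖dir n ω - grad n ω‖ ^ 2) ^ pHat p ∂μ) with hc | hc
    · have := h.integral_sumErr_rpow_le_boundE ha₀ hσhat hβ hη hp hlt hb₀ M hc
      linarith
    · linarith

end Trajectory

/-! ### Bounds for the actual run. -/

section Run

variable {d : ℕ} {Ξ Ω : Type*} [MeasurableSpace Ξ] {𝒟 : Measure Ξ}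
  {f : EuclideanSpace ℝ (Fin d) → Ξ → ℝ} {σ σhat β p a₀ b₀ η : ℝ} {x₁ : EuclideanSpace ℝ (Fin d)} {ξ : ℕ → Ω → Ξ}

theorem gradSum_eq (T : ℕ) (ω : Ω) : gradSum 𝒟 f p a₀ b₀ η x₁ ξ T ω =
    ∑ n ∈ Finset.range T, ‖trueGrad 𝒟 f (stateAt f p a₀ b₀ η x₁ ξ n ω).x‖ ^ 2 := by
  rw [gradSum]
  induction T with
  | zero => simp
  | succ T ih => rw [Finset.sum_Icc_succ_top (by omega), ih, Finset.sum_range_succ]; rfl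

theorem initialGap_nonneg (h : Assumptions 𝒟 f σ σhat β) : 0 ≤ initialGap 𝒟 f x₁ :=
  sub_nonneg.2 (ciInf_le h.bddBelow x₁)

variable [MeasurableSpace Ω] {μ : Measure Ω} [IsProbabilityMeasure μ]

theorem essBdd_gradSum_rpow (h : Assumptions 𝒟 f σ σhat β) (hβ : 0 ≤ β) (hs : IsSampling μ 𝒟 ξ)
    (hp0 : 0 < p) (hp : p ≤ 1 / 2) (hb₀ : 0 < b₀) (T : ℕ) :
    EssBdd μ (fun ω => gradSum 𝒟 f p a₀ b₀ η x₁ ξ T ω ^ pHat p) := by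
  have ht := trajectory_run (a₀ := a₀) (η := η) (x₁ := x₁) h hβ hs hp0 (by linarith) hb₀
  simp_rw [gradSum_eq]
  exact (EssBdd.sum _ fun n _ => (ht.bdd_grad n).norm.sq).rpow
    (fun ω => Finset.sum_nonneg fun _ _ => sq_nonneg _) (pHat_pos hp).le

/-- For p = 1/2 the first term is dropped altogether. This is stronger than the explicit bound, and
it spares the rate an estimate of that term. -/
theorem integral_gradSum_rpow_le (h : Assumptions 𝒟 f σ σhat β) (hs : IsSampling μ 𝒟 ξ)
    (ha₀ : 0 < a₀) (hσhat : 0 ≤ σhat) (hβ : 0 < β) (hη : 0 < η)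
    (hp : (3 - Real.sqrt 7) / 2 ≤ p) (hp' : p ≤ 1 / 2) (hb₀ : 0 < b₀) {lam : ℝ} (hlam : 0 < lam)
    (T : ℕ) :
    ∫ ω, gradSum 𝒟 f p a₀ b₀ η x₁ ξ T ω ^ pHat p ∂μ ≤
      4 * (if p = 1 / 2 then 0 else boundE p b₀ (K₁ a₀ σ σhat ((1 - p) / 2))
        (K₂ a₀ ((1 - p) / 2)) (K₄ a₀ η σhat β ((1 - p) / 2))
          (1 + 2 * σ ^ 2 * T / a₀ ^ 2)) +
      4 * (dirBase p a₀ b₀ η σ σhat β (initialGap 𝒟 f x₁) lam (1 + 2 * σ ^ 2 * T / a₀ ^ 2) ^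
        (pHat p / (1 - p)) * (1 + 2 * σ ^ 2 * T / a₀ ^ 2) ^ (pHat p / 3)) := by
  have hp0 := lower_pos hp
  cases T with
  | zero =>
    have hq : 1 / 4 ≤ (1 - p) / 2 := by linarith
    have hs1 : (1 : ℝ) ≤ 1 + 2 * σ ^ 2 * (0 : ℕ) / a₀ ^ 2 := by simp
    have hbE := boundE_nonneg (p := p) hb₀
      (K₁_nonneg (σ := σ) (ℓ := (1 - p) / 2) ha₀ hσhat) (K₂_nonneg (a₀ := a₀) hq)
      (K₄_pos ha₀ hσhat hβ hη hq).le hs1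
    have hN := dirBase_nonneg (β := β) (σ := σ) hp0 hp' ha₀ hb₀ hσhat hη hlam
      (initialGap_nonneg (x₁ := x₁) h) hs1
    have e : ∫ ω, gradSum 𝒟 f p a₀ b₀ η x₁ ξ 0 ω ^ pHat p ∂μ = 0 := by
      simp [gradSum, Real.zero_rpow (pHat_pos hp').ne']
    rw [e]
    have := Real.rpow_nonneg hN (pHat p / (1 - p))
    split_ifs <;> positivity
  | succ M =>
    have ht := trajectory_run (a₀ := a₀) (η := η) (x₁ := x₁) h hβ.le hs hp0 (by linarith) hb₀
    simp_rw [gradSum_eq]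
    exact ht.integral_sumGrad_rpow_le ha₀ hσhat hβ hη hp hp' hb₀ hlam M

theorem integral_gradSum_rpow_le_explicitBound (h : Assumptions 𝒟 f σ σhat β)
    (hs : IsSampling μ 𝒟 ξ) (ha₀ : 0 < a₀) (hσhat : 0 ≤ σhat) (hβ : 0 < β) (hη : 0 < η)
    (hp : (3 - Real.sqrt 7) / 2 ≤ p) (hp' : p ≤ 1 / 2) (hb₀ : 0 < b₀) {lam : ℝ} (hlam : 0 < lam)
    (T : ℕ) :
    ∫ ω, gradSum 𝒟 f p a₀ b₀ η x₁ ξ T ω ^ pHat p ∂μ ≤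
      explicitBound p a₀ b₀ η σ σhat β (initialGap 𝒟 f x₁) lam T := by
  have hq : 1 / 4 ≤ (1 - p) / 2 := by linarith
  have hbE := boundE_nonneg (p := p) hb₀
    (K₁_nonneg (σ := σ) (ℓ := (1 - p) / 2) ha₀ hσhat) (K₂_nonneg (a₀ := a₀) hq)
    (K₄_pos ha₀ hσhat hβ hη hq).le
    (show (1 : ℝ) ≤ 1 + 2 * σ ^ 2 * T / a₀ ^ 2 from le_add_of_nonneg_right (by positivity))
  refine (integral_gradSum_rpow_le h hs ha₀ hσhat hβ hη hp hp' hb₀ hlam T).trans ?_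
  rw [explicitBound, boundD_eq]
  gcongr
  split_ifs
  · exact hbE
  · exact le_rfl

end Run

/-- p̂ decreases in p, and the endpoints of the range of p give the two bounds. -/
theorem pHat_mem_Icc {p : ℝ} (hp : p ∈ Set.Icc ((3 - Real.sqrt 7) / 2) (1 / 2)) :
    pHat p ∈ Set.Icc (3 / 7) (Real.sqrt 7 - 2) := by
  obtain ⟨hp1, hp2⟩ := hp
  have h7 : Real.sqrt 7 ^ 2 = 7 := Real.sq_sqrt (by norm_num)
  have h0 := Real.sqrt_nonneg 7
  have h3 : Real.sqrt 7 ≤ 3 := by nlinarith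
  have h4 : 0 < 4 - p := by linarith
  unfold pHat
  constructor
  · rw [div_le_div_iff₀ (by norm_num) h4]; linarith
  · rw [div_le_iff₀ h4]
    nlinarith [mul_nonneg (show 0 ≤ 2 * p - 3 + Real.sqrt 7 by linarith)
      (show 0 ≤ 5 - Real.sqrt 7 by linarith)]

/-! ### Order of the explicit bound in B, Δ and T. -/

section Rate

variable {p a₀ b₀ η σ σhat : ℝ}

theorem rateFactor_nonneg {B Δ : ℝ} (hB : 1 ≤ B) (hΔ : 0 ≤ Δ) (T : ℕ) :
    0 ≤ rateFactor p σ B Δ T := by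
  have h1 := Real.log_nonneg hB
  have h2 : 0 ≤ Real.log (1 + σ ^ 2 * T) :=
    Real.log_nonneg (le_add_of_nonneg_right (by positivity))
  unfold rateFactor
  positivity

theorem one_add_two_mul_le (σ a₀ : ℝ) (T : ℕ) :
    1 + 2 * σ ^ 2 * T / a₀ ^ 2 ≤ max 1 (2 / a₀ ^ 2) * (1 + σ ^ 2 * T) := by
  have h1 : (1 : ℝ) ≤ max 1 (2 / a₀ ^ 2) := le_max_left _ _
  have h2 : 2 / a₀ ^ 2 * (σ ^ 2 * T) ≤ max 1 (2 / a₀ ^ 2) * (σ ^ 2 * T) := by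
    gcongr; exact le_max_right _ _
  have h3 : 2 * σ ^ 2 * T / a₀ ^ 2 = 2 / a₀ ^ 2 * (σ ^ 2 * T) := by ring
  rw [h3]
  linarith

theorem one_le_two_mul_log {B : ℝ} (hB : 2 ≤ B) : 1 ≤ 2 * Real.log B := by
  have h1 := Real.log_le_log two_pos hB
  have h2 := Real.log_two_gt_d9
  linarith

/-- The base of the direction bound has the claimed order. -/
theorem exists_dirBase_le (hp0 : 0 < p) (hp : p ≤ 1 / 2) (ha₀ : 0 < a₀) (hb₀ : 0 < b₀)
    (hσhat : 0 ≤ σhat) (hη : 0 < η) : ∃ C : ℝ, 0 ≤ C ∧ ∀ (B Δ : ℝ) (T : ℕ), 2 ≤ B → 0 ≤ Δ →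
      dirBase p a₀ b₀ η σ σhat B Δ 1 (1 + 2 * σ ^ 2 * T / a₀ ^ 2) ≤
        C * (Δ + B ^ (1 / p - 1) * Real.log B + B ^ (1 / p - 1) * Real.log (1 + σ ^ 2 * T)) := by
  have hr : 0 < 1 - p := by linarith
  have hm : 0 ≤ 1 / p - 1 := by
    rw [sub_nonneg, le_div_iff₀ hp0]; linarith
  set c := K₈ a₀ η σhat 1 1 + K₉ a₀ η σhat 1 1 with hc
  have hc0 : 0 < c := K₈_add_K₉_pos ha₀ hσhat hη one_pos
  set cs := max 1 (2 / a₀ ^ 2)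
  have hcs1 : 1 ≤ cs := le_max_left _ _
  have hcl := Real.log_nonneg hcs1
  set g₁ := K₁ a₀ σ σhat (1 / 4) / η
  have hg₁ : 0 ≤ g₁ := div_nonneg (K₁_nonneg ha₀ hσhat) hη.le
  set g₂ := K₂ a₀ (1 / 4) / η
  have hg₂ : 0 ≤ g₂ := div_nonneg (K₂_nonneg le_rfl) hη.le
  set g := c ^ (1 / p - 1) / (1 - p)
  have hg : 0 ≤ g := by positivity
  set lc := |Real.log (c / b₀)|
  have hlc : 0 ≤ lc := abs_nonneg _
  set u := b₀ ^ (1 / p - 1)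
  have hu : 0 ≤ u := by positivity
  set w := 2 * u + 2 * g₁ + 2 * (g₂ + g / 3) * Real.log cs + g * (2 * lc + 1) with hw
  have hw0 : 0 ≤ w := by positivity
  refine ⟨2 / η + w + (g₂ + g / 3), by positivity, fun B Δ T hB hΔ => ?_⟩
  have hB1 : 1 ≤ B := by linarith
  have hB0 : 0 < B := by linarith
  have hmax : max B 1 = B := max_eq_left hB1
  -- For B ≥ 1 the maximum disappears and K₈ + K₉ is linear in B, so K₇ scales as B^(1/p-1) with a
  -- constant free of B.
  have ek : K₈ a₀ η σhat B 1 + K₉ a₀ η σhat B 1 = c * B := by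
    simp only [hc, K₈, K₉, hmax, max_self]; ring
  have hP1 : 1 ≤ B ^ (1 / p - 1) := Real.one_le_rpow hB1 hm
  have e7 : K₇ p a₀ η σhat B 1 = g * B ^ (1 / p - 1) := by
    rw [K₇, ek, Real.mul_rpow hc0.le hB0.le]; simp only [g]; ring
  have hl := one_le_two_mul_log hB
  have hL : 0 ≤ Real.log (1 + σ ^ 2 * T) :=
    Real.log_nonneg (le_add_of_nonneg_right (by positivity))
  have hs := one_add_two_mul_le σ a₀ T
  have hlogs : Real.log (1 + 2 * σ ^ 2 * T / a₀ ^ 2) ≤ Real.log cs + Real.log (1 + σ ^ 2 * T) := by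
    rw [← Real.log_mul (by positivity) (by positivity)]
    exact Real.log_le_log (by positivity) hs
  have hlogs0 : 0 ≤ Real.log (1 + 2 * σ ^ 2 * T / a₀ ^ 2) :=
    Real.log_nonneg (le_add_of_nonneg_right (by positivity))
  have hlogk : Real.log (c * B / b₀) ≤ lc + Real.log B := by
    rw [mul_div_right_comm, Real.log_mul (by positivity) hB0.ne']
    gcongr
    exact le_abs_self _
  have h5 : K₁ a₀ σ σhat (1 / 4) / (η * B) ≤ g₁ := by
    refine div_le_div_of_nonneg_left (K₁_nonneg ha₀ hσhat) hη ?_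
    exact le_mul_of_one_le_right hη.le hB1
  have h6 : K₂ a₀ (1 / 4) / (η * B) ≤ g₂ := by
    refine div_le_div_of_nonneg_left (K₂_nonneg le_rfl) hη ?_
    exact le_mul_of_one_le_right hη.le hB1
  rw [dirBase, K₅, K₆, ek, e7, hmax, one_mul, one_mul]
  set P := B ^ (1 / p - 1)
  set l := Real.log B
  set L := Real.log (1 + σ ^ 2 * T)
  set ls := Real.log (1 + 2 * σ ^ 2 * T / a₀ ^ 2)
  have hP0 : 0 ≤ P := by linarith
  have hl0 : 0 ≤ l := by linarith
  -- Since B ≥ 2, log B ≥ 1/2; terms without a logarithm are absorbed into P log B.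
  have hPP : P ≤ 2 * (P * l) := by
    rw [mul_left_comm]; exact le_mul_of_one_le_right hP0 hl
  have hPl : 1 ≤ 2 * (P * l) := hP1.trans hPP
  have k1 : u + g₁ ≤ (u + g₁) * (2 * (P * l)) := le_mul_of_one_le_right (by positivity) hPl
  have k2 : (K₂ a₀ (1 / 4) / (η * B) + g * P / 3) * ls ≤
      (g₂ + g / 3) * (2 * (P * l)) * Real.log cs + (g₂ + g / 3) * (P * L) := by
    have t0 : K₂ a₀ (1 / 4) / (η * B) + g * P / 3 ≤ (g₂ + g / 3) * P := by
      have := le_mul_of_one_le_right hg₂ hP1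
      have e : (g₂ + g / 3) * P = g₂ * P + g * P / 3 := by ring
      rw [e]
      exact add_le_add_left (h6.trans this) _
    calc _ ≤ (g₂ + g / 3) * P * (Real.log cs + L) :=
          mul_le_mul t0 hlogs hlogs0 (by positivity)
      _ = (g₂ + g / 3) * P * Real.log cs + (g₂ + g / 3) * (P * L) := by ring
      _ ≤ _ := by gcongr
  have k3 : g * P * Real.log (c * B / b₀) ≤ g * (2 * (P * l)) * lc + g * (P * l) := by
    calc _ ≤ g * P * (lc + l) := by gcongr
      _ = g * P * lc + g * (P * l) := by ring
      _ ≤ _ := by gcongr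
  have k4 : 0 ≤ P * l := by positivity
  have k5 : 0 ≤ P * L := by positivity
  have k6 : 0 ≤ (w + (g₂ + g / 3)) * Δ := by positivity
  have k7 : 0 ≤ (2 / η + (g₂ + g / 3)) * (P * l) := by positivity
  have k8 : 0 ≤ (2 / η + w) * (P * L) := by positivity
  have k9 : (2 / η + w + (g₂ + g / 3)) * (Δ + P * l + P * L) =
      2 / η * Δ + (w + (g₂ + g / 3)) * Δ + w * (P * l) + (2 / η + (g₂ + g / 3)) * (P * l) +
        (g₂ + g / 3) * (P * L) + (2 / η + w) * (P * L) := by ring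
  have k10 : w * (P * l) = (u + g₁) * (2 * (P * l)) + (g₂ + g / 3) * (2 * (P * l)) * Real.log cs +
      g * (2 * (P * l)) * lc + g * (P * l) := by rw [hw]; ring
  linarith

theorem dirBase_rpow_le (hp0 : 0 < p) (hp : p ≤ 1 / 2) {B Δ C N : ℝ} {T : ℕ} (hC : 0 ≤ C)
    (hB : 2 ≤ B) (hΔ : 0 ≤ Δ) (hN0 : 0 ≤ N)
    (hN : N ≤ C * (Δ + B ^ (1 / p - 1) * Real.log B +
      B ^ (1 / p - 1) * Real.log (1 + σ ^ 2 * T))) :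
    N ^ (pHat p / (1 - p)) ≤ C ^ (pHat p / (1 - p)) * rateFactor p σ B Δ T := by
  have hr : 0 < 1 - p := by linarith
  have hph := pHat_pos hp
  have hB0 : 0 < B := by linarith
  have hl : 0 ≤ Real.log B := Real.log_nonneg (by linarith)
  have hL : 0 ≤ Real.log (1 + σ ^ 2 * T) :=
    Real.log_nonneg (le_add_of_nonneg_right (by positivity))
  have hP : 0 ≤ B ^ (1 / p - 1) := by positivity
  have hθ0 : 0 ≤ pHat p / (1 - p) := by positivity
  have hθ1 : pHat p / (1 - p) ≤ 1 := by
    have : pHat p / (1 - p) = 3 / (4 - p) := by unfold pHat; field_simp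
    rw [this, div_le_one (by linarith)]; linarith
  have e : (B ^ (1 / p - 1)) ^ (pHat p / (1 - p)) = B ^ (pHat p / p) := by
    rw [← Real.rpow_mul hB0.le]; congr 1; field_simp
  refine (Real.rpow_le_rpow hN0 hN hθ0).trans ?_
  rw [Real.mul_rpow hC (by positivity)]
  gcongr
  refine (rpow_add_le_of_le_one (by positivity) (by positivity) hθ0 hθ1).trans ?_
  rw [rateFactor, ← e, ← Real.mul_rpow hP hl, ← Real.mul_rpow hP hL]
  gcongr
  exact rpow_add_le_of_le_one hΔ (by positivity) hθ0 hθ1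

/-- The error bound has the claimed order. -/
theorem exists_boundE_le (hp0 : 0 < p) (hp : p < 1 / 2) (ha₀ : 0 < a₀)
    (hσhat : 0 ≤ σhat) (hη : 0 < η) : ∃ C : ℝ, 0 ≤ C ∧ ∀ B s : ℝ, 2 ≤ B → 1 ≤ s →
      boundE p b₀ (K₁ a₀ σ σhat ((1 - p) / 2)) (K₂ a₀ ((1 - p) / 2))
        (K₄ a₀ η σhat B ((1 - p) / 2)) s ≤ C * B ^ (pHat p / p) * s ^ (pHat p / 3) := by
  have hph := pHat_pos hp.le
  have hκ : 0 < 1 - 2 * p := by linarith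
  have hq : 1 / 4 ≤ (1 - p) / 2 := by linarith
  have hq' : (1 - p) / 2 ≠ 1 / 4 := by intro hh; linarith
  set k₁ := K₁ a₀ σ σhat ((1 - p) / 2)
  have hk₁ : 0 ≤ k₁ := K₁_nonneg ha₀ hσhat
  set k₂ := K₂ a₀ ((1 - p) / 2)
  have hk₂ : 0 ≤ k₂ := K₂_nonneg hq
  set c := K₄ a₀ η σhat 1 ((1 - p) / 2) with hc
  have hc0 : 0 < c := K₄_pos ha₀ hσhat one_pos hη hq
  refine ⟨(2 * k₁ / c) ^ (pHat p / (1 - 2 * p)) + ((2 * k₂ / c) ^ (pHat p / (1 - 2 * p)) +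
    (2 * c) ^ (pHat p / (2 * p))), by positivity, fun B s hB hs => ?_⟩
  have hB1 : 1 ≤ B := by linarith
  have hB0 : 0 < B := by linarith
  -- K₄ is quadratic in B. The summands with K₄ in the denominator only decrease, and the last one
  -- grows as (B²)^(p̂/(2p)) = B^(p̂/p).
  have e4 : K₄ a₀ η σhat B ((1 - p) / 2) = c * B ^ 2 := by
    rw [hc, K₄, K₄, if_neg hq', if_neg hq']; ring
  have hcB : c ≤ c * B ^ 2 := le_mul_of_one_le_right hc0.le (one_le_pow₀ hB1)
  have hBp : 1 ≤ B ^ (pHat p / p) := Real.one_le_rpow hB1 (by positivity)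
  have hsp : 1 ≤ s ^ (pHat p / 3) := Real.one_le_rpow hs (by positivity)
  have e5 : (2 * (c * B ^ 2)) ^ (pHat p / (2 * p)) =
      (2 * c) ^ (pHat p / (2 * p)) * B ^ (pHat p / p) := by
    rw [← mul_assoc, Real.mul_rpow (by positivity) (by positivity), ← Real.rpow_two,
      ← Real.rpow_mul hB0.le]
    congr 2; field_simp
  have t1 : (2 * k₁ / (c * B ^ 2)) ^ (pHat p / (1 - 2 * p)) ≤
      (2 * k₁ / c) ^ (pHat p / (1 - 2 * p)) := by gcongr
  have t2 : (2 * k₂ / (c * B ^ 2)) ^ (pHat p / (1 - 2 * p)) ≤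
      (2 * k₂ / c) ^ (pHat p / (1 - 2 * p)) := by gcongr
  rw [boundE, if_neg hp.ne, e4, e5]
  have n1 : 0 ≤ (2 * k₁ / c) ^ (pHat p / (1 - 2 * p)) := by positivity
  have n2 : 0 ≤ (2 * k₂ / c) ^ (pHat p / (1 - 2 * p)) := by positivity
  set U := (2 * k₁ / c) ^ (pHat p / (1 - 2 * p))
  set V := (2 * k₂ / c) ^ (pHat p / (1 - 2 * p))
  set W := (2 * c) ^ (pHat p / (2 * p))
  set Q := B ^ (pHat p / p)
  set Z := s ^ (pHat p / 3)
  have hQZ : 1 ≤ Q * Z := one_le_mul_of_one_le_of_one_le hBp hsp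
  have hZQ : Z ≤ Q * Z := le_mul_of_one_le_left (by linarith) hBp
  calc _ ≤ U + (V + W * Q) * Z := by gcongr
    _ = U + V * Z + W * (Q * Z) := by ring
    _ ≤ U * (Q * Z) + V * (Q * Z) + W * (Q * Z) := by
        gcongr
        exact le_mul_of_one_le_right n1 hQZ
    _ = _ := by ring

/-- The explicit bound has the claimed order. -/
theorem exists_bound_le_rate (hp0 : 0 < p) (hp : p ≤ 1 / 2) (ha₀ : 0 < a₀) (hb₀ : 0 < b₀)
    (hσhat : 0 ≤ σhat) (hη : 0 < η) : ∃ C : ℝ, 0 ≤ C ∧ ∀ (B Δ : ℝ) (T : ℕ), 2 ≤ B → 0 ≤ Δ →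
      4 * (if p = 1 / 2 then 0 else boundE p b₀ (K₁ a₀ σ σhat ((1 - p) / 2))
        (K₂ a₀ ((1 - p) / 2)) (K₄ a₀ η σhat B ((1 - p) / 2))
          (1 + 2 * σ ^ 2 * T / a₀ ^ 2)) +
      4 * (dirBase p a₀ b₀ η σ σhat B Δ 1 (1 + 2 * σ ^ 2 * T / a₀ ^ 2) ^
        (pHat p / (1 - p)) * (1 + 2 * σ ^ 2 * T / a₀ ^ 2) ^ (pHat p / 3)) ≤
      C * (rateFactor p σ B Δ T * (1 + σ ^ 2 * T) ^ (pHat p / 3)) := by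
  have hph := pHat_pos hp
  have hr : 0 < 1 - p := by linarith
  obtain ⟨C₁, hC₁, h₁⟩ := exists_dirBase_le (σ := σ) hp0 hp ha₀ hb₀ hσhat hη
  obtain ⟨C₂, hC₂, h₂⟩ : ∃ C : ℝ, 0 ≤ C ∧ ∀ B s : ℝ, 2 ≤ B → 1 ≤ s →
      (if p = 1 / 2 then 0 else boundE p b₀ (K₁ a₀ σ σhat ((1 - p) / 2)) (K₂ a₀ ((1 - p) / 2))
        (K₄ a₀ η σhat B ((1 - p) / 2)) s) ≤ C * B ^ (pHat p / p) * s ^ (pHat p / 3) := by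
    rcases hp.eq_or_lt with hh | hh
    · refine ⟨0, le_rfl, fun B s _ _ => ?_⟩
      simp [hh]
    · simp only [if_neg hh.ne]
      exact exists_boundE_le hp0 hh ha₀ hσhat hη
  set θ := pHat p / (1 - p) with hθ
  have hθ0 : 0 ≤ θ := by positivity
  refine ⟨(4 * (C₂ * 2 ^ θ) + 4 * C₁ ^ θ) * max 1 (2 / a₀ ^ 2) ^ (pHat p / 3), by positivity,
    fun B Δ T hB hΔ => ?_⟩
  have hs1 : 1 ≤ 1 + 2 * σ ^ 2 * T / a₀ ^ 2 := le_add_of_nonneg_right (by positivity)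
  have hB0 : 0 < B := by linarith
  have hR := rateFactor_nonneg (p := p) (σ := σ) (show 1 ≤ B by linarith) hΔ T
  have hl : 0 ≤ Real.log B := Real.log_nonneg (by linarith)
  have hL : 0 ≤ Real.log (1 + σ ^ 2 * T) :=
    Real.log_nonneg (le_add_of_nonneg_right (by positivity))
  have hBR : B ^ (pHat p / p) ≤ 2 ^ θ * rateFactor p σ B Δ T := by
    have h3 : 1 ≤ 2 ^ θ * Real.log B ^ θ := by
      rw [← Real.mul_rpow two_pos.le hl]
      exact Real.one_le_rpow (one_le_two_mul_log hB) hθ0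
    have h4 : B ^ (pHat p / p) * Real.log B ^ θ ≤ rateFactor p σ B Δ T := by
      rw [rateFactor, ← hθ]
      have h5 : 0 ≤ Δ ^ θ := by positivity
      have h6 : 0 ≤ B ^ (pHat p / p) * Real.log (1 + σ ^ 2 * T) ^ θ := by positivity
      linarith
    have h7 : 0 ≤ B ^ (pHat p / p) := by positivity
    calc B ^ (pHat p / p) ≤ B ^ (pHat p / p) * (2 ^ θ * Real.log B ^ θ) :=
          le_mul_of_one_le_right h7 h3
      _ = 2 ^ θ * (B ^ (pHat p / p) * Real.log B ^ θ) := by ring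
      _ ≤ _ := by gcongr
  have hd := dirBase_rpow_le hp0 hp hC₁ hB hΔ
    (dirBase_nonneg (β := B) (σ := σ) hp0 hp ha₀ hb₀ hσhat hη one_pos hΔ hs1) (h₁ B Δ T hB hΔ)
  have he := h₂ B _ hB hs1
  have hs2 := one_add_two_mul_le σ a₀ T
  have hsp : (1 + 2 * σ ^ 2 * T / a₀ ^ 2) ^ (pHat p / 3) ≤
      max 1 (2 / a₀ ^ 2) ^ (pHat p / 3) * (1 + σ ^ 2 * T) ^ (pHat p / 3) := by
    rw [← Real.mul_rpow (by positivity) (by positivity)]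
    exact Real.rpow_le_rpow (by linarith) hs2 (by positivity)
  set R := rateFactor p σ B Δ T
  set s := 1 + 2 * σ ^ 2 * T / a₀ ^ 2
  have hsp0 : 0 ≤ s ^ (pHat p / 3) := Real.rpow_nonneg (by linarith) _
  calc _ ≤ 4 * (C₂ * (2 ^ θ * R) * s ^ (pHat p / 3)) + 4 * (C₁ ^ θ * R * s ^ (pHat p / 3)) := by
        gcongr
        exact he.trans (by gcongr)
    _ = (4 * (C₂ * 2 ^ θ) + 4 * C₁ ^ θ) * R * s ^ (pHat p / 3) := by ring
    _ ≤ (4 * (C₂ * 2 ^ θ) + 4 * C₁ ^ θ) * R *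
        (max 1 (2 / a₀ ^ 2) ^ (pHat p / 3) * (1 + σ ^ 2 * T) ^ (pHat p / 3)) := by gcongr
    _ = _ := by ring

end Rate

/-! ### Averaging over the random output index. -/

section RandomIndex

variable {Ω Ω' : Type*} [MeasurableSpace Ω] [MeasurableSpace Ω'] {μ : Measure Ω}
  [IsProbabilityMeasure μ] {T : ℕ} {τ : Ω → ℕ} {Y : Ω → Ω'}

/-- Averaging over an independent uniform index. -/
theorem integrable_and_integral_uniform_index (hτ : Measurable τ)
    (hlaw : μ.map τ = uniformOn (Finset.Icc 1 T : Set ℕ)) (hind : IndepFun τ Y μ)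
    (g : ℕ → Ω' → ℝ) (hg : ∀ t, Measurable (g t)) (hb : ∀ t ∈ Finset.Icc 1 T,
      EssBdd μ (fun ω => g t (Y ω))) :
    Integrable (fun ω => g (τ ω) (Y ω)) μ ∧
      ∫ ω, g (τ ω) (Y ω) ∂μ = (T : ℝ)⁻¹ * ∑ t ∈ Finset.Icc 1 T, ∫ ω, g t (Y ω) ∂μ := by
  classical
  -- Indicators of τ = t. They split the randomly indexed variable into a finite sum of products to
  -- which independence applies.
  set φ : ℕ → ℕ → ℝ := fun t n => if n = t then 1 else 0 with hφ
  have hφm : ∀ t, Measurable (φ t) := fun t => measurable_of_countable _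
  have hmem : ∀ᵐ ω ∂μ, τ ω ∈ Finset.Icc 1 T := by
    have : ∀ᵐ n ∂(μ.map τ), n ∈ Finset.Icc 1 T := by
      rw [hlaw, ae_iff]
      rw [uniformOn_eq_zero_iff (Finset.finite_toSet _)]
      ext n; simp
    exact ae_of_ae_map hτ.aemeasurable this
  have heq : (fun ω => g (τ ω) (Y ω)) =ᵐ[μ]
      fun ω => ∑ t ∈ Finset.Icc 1 T, φ t (τ ω) * g t (Y ω) := by
    filter_upwards [hmem] with ω hω
    simp only [hφ, ite_mul, one_mul, zero_mul]
    rw [Finset.sum_ite_eq, if_pos hω]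
  have hφb : ∀ t, EssBdd μ (fun ω => φ t (τ ω)) := fun t =>
    ⟨(hφm t).comp hτ, 1, .of_forall fun ω => by simp only [hφ]; split_ifs <;> simp⟩
  have hterm : ∀ t ∈ Finset.Icc 1 T, EssBdd μ (fun ω => φ t (τ ω) * g t (Y ω)) :=
    fun t ht => (hφb t).mul (hb t ht)
  refine ⟨(EssBdd.sum _ hterm).integrable.congr heq.symm, ?_⟩
  rw [integral_congr_ae heq, integral_finsetSum _ fun t ht => (hterm t ht).integrable,
    Finset.mul_sum]
  refine Finset.sum_congr rfl fun t ht => ?_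
  have hind' : IndepFun (fun ω => φ t (τ ω)) (fun ω => g t (Y ω)) μ := hind.comp (hφm t) (hg t)
  rw [hind'.integral_fun_mul_eq_mul_integral
    (hφb t).meas.aestronglyMeasurable (hb t ht).meas.aestronglyMeasurable]
  congr 1
  have e1 : (fun ω => φ t (τ ω)) = (τ ⁻¹' {t}).indicator 1 := by
    ext ω
    simp [hφ, Set.indicator_apply]
  have hm : MeasurableSet (τ ⁻¹' {t}) := hτ (measurableSet_singleton t)
  rw [e1, integral_indicator_one hm, measureReal_def,
    ← Measure.map_apply hτ (measurableSet_singleton t), hlaw]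
  have e2 : uniformOn (Finset.Icc 1 T : Set ℕ) {t} = (T : ENNReal)⁻¹ := by
    have := uniformOn_apply_finset (s := Finset.Icc 1 T) (t := {t})
    rw [Finset.coe_singleton] at this
    rw [this, Finset.inter_singleton_of_mem ht]
    simp
  rw [e2]
  simp

/-- Jensen for the concave power r under the uniform distribution on the indices. -/
theorem inv_mul_sum_rpow_le {r : ℝ} (hr0 : 0 ≤ r) (hr1 : r ≤ 1) (hT : 1 ≤ T) {z : ℕ → ℝ}
    (hz : ∀ t, 0 ≤ z t) :
    (T : ℝ)⁻¹ * ∑ t ∈ Finset.Icc 1 T, z t ^ r ≤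
      (T : ℝ) ^ (-r) * (∑ t ∈ Finset.Icc 1 T, z t) ^ r := by
  have hT0 : (0 : ℝ) < T := by exact_mod_cast hT
  have h := (Real.concaveOn_rpow hr0 hr1).le_map_sum (t := Finset.Icc 1 T)
    (w := fun _ => (T : ℝ)⁻¹) (p := z) (fun _ _ => by positivity)
    (by simp [hT0.ne']) (fun t _ => hz t)
  simp only [smul_eq_mul] at h
  rw [← Finset.mul_sum, ← Finset.mul_sum] at h
  refine h.trans (le_of_eq ?_)
  rw [Real.mul_rpow (by positivity) (Finset.sum_nonneg fun t _ => hz t), Real.inv_rpow hT0.le,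
    ← Real.rpow_neg hT0.le]

end RandomIndex

/-! ### The output iterate. -/

section Output

variable {d : ℕ} {Ξ Ω : Type*} [MeasurableSpace Ξ] [MeasurableSpace Ω] {𝒟 : Measure Ξ}
  {f : EuclideanSpace ℝ (Fin d) → Ξ → ℝ} {μ : Measure Ω} [IsProbabilityMeasure μ]
  {σ σhat β p a₀ b₀ η : ℝ} {x₁ : EuclideanSpace ℝ (Fin d)} {ξ : ℕ → Ω → Ξ}

theorem outGradNorm_rpow_le (h : Assumptions 𝒟 f σ σhat β) (hβ : 0 ≤ β) (hs : IsSampling μ 𝒟 ξ)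
    (hp0 : 0 < p) (hp : p ≤ 1 / 2) (hb₀ : 0 < b₀) {T : ℕ} (hT : 1 ≤ T) {τ : Ω → ℕ}
    (hτ : IsUniformIndex μ ξ T τ) :
    Integrable (fun ω => outGradNorm 𝒟 f p a₀ b₀ η x₁ ξ τ ω ^ (2 * pHat p)) μ ∧
      ∫ ω, outGradNorm 𝒟 f p a₀ b₀ η x₁ ξ τ ω ^ (2 * pHat p) ∂μ ≤
        (T : ℝ) ^ (-pHat p) * ∫ ω, gradSum 𝒟 f p a₀ b₀ η x₁ ξ T ω ^ pHat p ∂μ := by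
  have hph := pHat_pos hp
  have hph1 := pHat_lt_one hp0 hp
  have ht := trajectory_run (a₀ := a₀) (η := η) (x₁ := x₁) h hβ hs hp0 (by linarith) hb₀
  set g : ℕ → (ℕ → Ξ) → ℝ := fun t s =>
    (‖trueGrad 𝒟 f (run (stochGrad f) p a₀ b₀ η x₁ s t).x‖ ^ 2) ^ pHat p with hg
  have hgm : ∀ t, Measurable (g t) := fun t =>
    ((((h.continuous_trueGrad hβ).measurable.comp
      (measurable_run _ _ _ _ _ _ h.measurable_grad t).1).norm.pow_const 2).pow_const _)
  have hb : ∀ t ∈ Finset.Icc 1 T, EssBdd μ (fun ω => g t (fun i => ξ i ω)) := by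
    intro t ht1
    obtain ⟨n, rfl⟩ : ∃ n, t = n + 1 := ⟨t - 1, by have := Finset.mem_Icc.1 ht1; omega⟩
    exact (ht.bdd_grad n).norm.sq.rpow (fun _ => sq_nonneg _) hph.le
  have e : ∀ ω, outGradNorm 𝒟 f p a₀ b₀ η x₁ ξ τ ω ^ (2 * pHat p) =
      g (τ ω) (fun i => ξ i ω) := fun ω => by
    simp only [hg]
    rw [← Real.rpow_two, ← Real.rpow_mul (norm_nonneg _)]
    rfl
  simp_rw [e]
  obtain ⟨hi, hI⟩ := integrable_and_integral_uniform_index hτ.measurable hτ.law hτ.indep g hgm hb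
  refine ⟨hi, ?_⟩
  rw [hI, ← integral_finsetSum _ fun t ht1 => (hb t ht1).integrable, ← integral_const_mul,
    ← integral_const_mul]
  exact integral_mono ((EssBdd.sum _ hb).const_mul _).integrable
    ((essBdd_gradSum_rpow h hβ hs hp0 hp hb₀ T).const_mul _).integrable
    fun ω => inv_mul_sum_rpow_le hph.le hph1.le hT
      (z := fun t => ‖trueGrad 𝒟 f (iterate f p a₀ b₀ η x₁ ξ t ω)‖ ^ 2) fun t => sq_nonneg _

theorem rpow_neg_mul_rpow_le (hσ : 0 ≤ σ) {r : ℝ} (hr0 : 0 ≤ r) (hr1 : r ≤ 1) {T : ℕ}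
    (hT : 1 ≤ T) : (T : ℝ) ^ (-r) * (1 + σ ^ 2 * T) ^ (r / 3) ≤
      1 / (T : ℝ) ^ r + σ ^ (2 * r / 3) / (T : ℝ) ^ (2 * r / 3) := by
  have hT0 : (0 : ℝ) < T := by exact_mod_cast hT
  have h1 := rpow_add_le_of_le_one zero_le_one (show 0 ≤ σ ^ 2 * T by positivity)
    (show 0 ≤ r / 3 by positivity) (show r / 3 ≤ 1 by linarith)
  rw [Real.one_rpow, Real.mul_rpow (by positivity) hT0.le, ← Real.rpow_two,
    ← Real.rpow_mul hσ] at h1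
  have e : (T : ℝ) ^ (-r) * (1 + σ ^ (2 * (r / 3)) * (T : ℝ) ^ (r / 3)) =
      1 / (T : ℝ) ^ r + σ ^ (2 * r / 3) / (T : ℝ) ^ (2 * r / 3) := by
    have e1 : (T : ℝ) ^ (-(2 * r / 3)) = (T : ℝ) ^ (-r) * (T : ℝ) ^ (r / 3) := by
      rw [← Real.rpow_add hT0]; congr 1; ring
    rw [one_div, ← Real.rpow_neg hT0.le, div_eq_mul_inv (σ ^ (2 * r / 3)), ← Real.rpow_neg hT0.le, e1,
      show 2 * (r / 3) = 2 * r / 3 by ring]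
    ring
  rw [← e, ← Real.rpow_two]
  gcongr

end Output

end MetaStorm

theorem mainTheorem5
    (p a₀ b₀ η σ σhat : ℝ)
    (hp : p ∈ Set.Icc ((3 - Real.sqrt 7) / 2) (1 / 2))
    (ha₀ : 0 < a₀) (hb₀ : 0 < b₀) (hη : 0 < η) (hσ : 0 ≤ σ) (hσhat : 0 ≤ σhat) :
    pHat p ∈ Set.Icc (3 / 7) (Real.sqrt 7 - 2) ∧
    ∃ C : ℝ, ∀ (d : ℕ) (Ξ Ω : Type*) [MeasurableSpace Ξ] [MeasurableSpace Ω]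
      (𝒟 : Measure Ξ) (f : EuclideanSpace ℝ (Fin d) → Ξ → ℝ) (β : ℝ)
      (μ : Measure Ω) [IsProbabilityMeasure μ] (ξ : ℕ → Ω → Ξ)
      (x₁ : EuclideanSpace ℝ (Fin d)) (T : ℕ),
      0 ≤ β → Assumptions 𝒟 f σ σhat β → IsSampling μ 𝒟 ξ →
      Integrable (fun ω => gradSum 𝒟 f p a₀ b₀ η x₁ ξ T ω ^ pHat p) μ ∧
      (0 < β → ∀ lam : ℝ, 0 < lam →
        ∫ ω, gradSum 𝒟 f p a₀ b₀ η x₁ ξ T ω ^ pHat p ∂μ ≤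
          explicitBound p a₀ b₀ η σ σhat β (initialGap 𝒟 f x₁) lam T) ∧
      ∫ ω, gradSum 𝒟 f p a₀ b₀ η x₁ ξ T ω ^ pHat p ∂μ ≤
        C * (rateFactor p σ (max β 2) (initialGap 𝒟 f x₁) T *
          (1 + σ ^ 2 * T) ^ (pHat p / 3)) ∧
      (1 ≤ T → ∀ τ : Ω → ℕ, IsUniformIndex μ ξ T τ →
        Integrable (fun ω => outGradNorm 𝒟 f p a₀ b₀ η x₁ ξ τ ω ^ (2 * pHat p)) μ ∧
        ∫ ω, outGradNorm 𝒟 f p a₀ b₀ η x₁ ξ τ ω ^ (2 * pHat p) ∂μ ≤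
          C * (rateFactor p σ (max β 2) (initialGap 𝒟 f x₁) T *
            (1 / (T : ℝ) ^ pHat p + σ ^ (2 * pHat p / 3) / (T : ℝ) ^ (2 * pHat p / 3)))) := by
  have hp0 := lower_pos hp.1
  refine ⟨pHat_mem_Icc hp, ?_⟩
  obtain ⟨C, hC, hbound⟩ := exists_bound_le_rate (σ := σ) hp0 hp.2 ha₀ hb₀ hσhat hη
  refine ⟨C, fun d Ξ Ω _ _ 𝒟 f β μ _ ξ x₁ T hβ h hs => ?_⟩
  have hB2 : 2 ≤ max β 2 := le_max_right _ _
  have hB0 : 0 < max β 2 := by linarith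
  have hΔ := initialGap_nonneg (x₁ := x₁) h
  have hrate := (integral_gradSum_rpow_le (x₁ := x₁) (h.mono hβ (le_max_left β 2)) hs ha₀ hσhat
    hB0 hη hp.1 hp.2 hb₀ one_pos T).trans (hbound _ _ T hB2 hΔ)
  refine ⟨(essBdd_gradSum_rpow h hβ hs hp0 hp.2 hb₀ T).integrable, fun hβ0 lam hlam =>
    integral_gradSum_rpow_le_explicitBound h hs ha₀ hσhat hβ0 hη hp.1 hp.2 hb₀ hlam T, hrate,
    fun hT τ hτ => ?_⟩
  obtain ⟨hi, hI⟩ := outGradNorm_rpow_le (a₀ := a₀) (η := η) (x₁ := x₁) h hβ hs hp0 hp.2 hb₀ hT hτ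
  refine ⟨hi, hI.trans ?_⟩
  have hR := rateFactor_nonneg (p := p) (σ := σ) (show 1 ≤ max β 2 by linarith) hΔ T
  have hfac := rpow_neg_mul_rpow_le hσ (pHat_pos hp.2).le (pHat_lt_one hp0 hp.2).le hT
  calc _ ≤ (T : ℝ) ^ (-pHat p) * (C * (rateFactor p σ (max β 2) (initialGap 𝒟 f x₁) T *
        (1 + σ ^ 2 * T) ^ (pHat p / 3))) := by gcongr
    _ = C * (rateFactor p σ (max β 2) (initialGap 𝒟 f x₁) T *
        ((T : ℝ) ^ (-pHat p) * (1 + σ ^ 2 * T) ^ (pHat p / 3))) := by ring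
    _ ≤ _ := by gcongr
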